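/- **Setting.** Let $m,d,n,T\ge 1$. Features lie in a set $X\subseteq\mathbb R^m$ with $\|x\|_2\le K_X$ and have an arbitrary law $D_x$ on $X$. The action space $W\subseteq\mathbb R^d$ is continuous: a measurable subset of the unit $\ell^2$-ball with positive Lebesgue measure. The label of feature $x$ under action $w$ is $c=Fx+Gw+\varepsilon$ with $F,G$ fixed unknown matrices and $\varepsilon\sim\mathcal N(0,\sigma^2I_d)$; the cost of action $w$ is $u=c^{\dagger}w+\mu^{\dagger}w+\eta$ with $\mu\in\mathbb R^d$ fixed and unknown and $\eta\sim\mathcal N(0,\sigma^2)$, and besides $c$ the number $u_b=\mu^\dagger w+\eta$ is observed. Assume $\|Fx+Gw\|_2\le K_C$ for all $x\in X$, $w\in W$, that $\|\mu\|_2\le K_\mu$, that $m\le\kappa n$, and that for $x\sim D_x$ and $w$ uniform on $W$, independent, all eigenvalues of the second moment matrix $\mathbb E\left[\binom{x}{w}\binom{x}{w}^{\dagger}\right]$ are at least $K_\Sigma/(m+d)$, where $K_\Sigma>0$. In each round $t=0,1,\dots,T$ there are $n$ individuals with features $x_i^t\sim D_x$; all features, exploratory actions and noises are independent over rounds and individuals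 and of each other. Round $0$ is an initial dataset with arbitrary default actions $w_i^0\in W$, which may depend on the features of that round but not on its noises. **Algorithm** (explore-then-exploit PROOF, with parameter $\gamma\in(0,1]$ and exploration length $\tilde T$). Let $b_1,\dots,b_d\in W$ be a barycentric spanner of $W$ (every $w\in W$ is $\sum_j a_jb_j$ with $|a_j|\le1$), and put $$A_i^t=\sum_{j=1}^d b_jb_j^{\dagger}+\sum_{s=1}^{t-1}w_i^s(w_i^s)^{\dagger},\qquad \hat\mu_i^t=(A_i^t)^{-1}\sum_{s=1}^{t-1}u_{b,i}^s\,w_i^s,$$ $$\beta^t=\max\left(128\,d\log t\,\log\tfrac{nt^2}{\gamma},\ \left(\tfrac83\log\tfrac{nt^2}{\gamma}\right)^2\right),\qquad B_i^t=\left\{\nu:\ (\nu-\hat\mu_i^t)^{\dagger}A_i^t(\nu-\hat\mu_i^t)\le\beta^t\right\}.$$ In the rounds $1\le t\le\min(\tilde T,T)$ each $w_i^t$ is drawn uniformly at random from $W$. In the rounds $\tilde T<t\le T$ an ordinary least squares fit $(\hat F,\hat G)$ of the labels on (feature, action) is computed from all data of the rounds $0,\dots,t-1$, and $w_i^t\in\arg\min_{w\in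 W}\min_{\nu\in B_i^t}(\hat Fx_i^t+\hat Gw+\nu)^{\dagger}w$. Ties are broken measurably, and the actions of a round depend only on what has been observed before its labels and costs are revealed. **Regret.** Let $\pi(x)\in\arg\min_{w\in W}\mathbb E[u\mid x,w]$ be a measurable optimal policy and $$R_T=\mathbb E\left[\sum_{t=1}^T\sum_{i=1}^n\left(u_i^t(w_i^t)-u_i^t(\pi(x_i^t))\right)\right],$$ where $u_i^t(w)$ is the cost that action $w$ incurs for individual $i$ in round $t$. **Theorem.** There are an absolute constant $p\in\mathbb N$ and, for all $\sigma\ge0$, $K_X,K_C,K_\mu,\kappa$ and $K_\Sigma>0$, a constant $C$ depending only on these six numbers, such that for all $m,d,n,T\ge1$, all $\gamma\in(0,1]$, and $\tilde T$ equal to $m^{1/3}d^{2/3}T^{2/3}$ rounded down or up to an integer, the expectation defining $R_T$ exists and $$R_T\le C\left(1+\log\tfrac{nT}{\gamma}\right)^{p}m^{1/3}d^{2/3}\,n\,T^{2/3}.$$ That is, the regret is $\tilde O\left(m^{1/3}d^{2/3}nT^{2/3}\right)$. -/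

import Mathlib

open MeasureTheory ProbabilityTheory
open scoped Matrix NNReal

noncomputable section

namespace PROOFBandit

/-- Euclidean norm of a coordinate vector. -/
def l2norm {k : ℕ} (v : Fin k → ℝ) : ℝ := √(v ⬝ᵥ v)

/-- An environment: features in `X ⊆ ℝ^m` with marginal law `Dx`, actions in `W ⊆ ℝ^d`, labels
`c = F x + G w + ε` with `ε ∼ N(0, σ² I)`, and the unknown part `q(w) = μᵀ w + η` of the cost,
`η ∼ N(0, σ²)`. -/
structure Env (m d : ℕ) where
  X : Set (Fin m → ℝ)
  Dx : Measure (Fin m → ℝ)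
  W : Set (Fin d → ℝ)
  F : Matrix (Fin d) (Fin m) ℝ
  G : Matrix (Fin d) (Fin d) ℝ
  μ : Fin d → ℝ
  σ : ℝ≥0

namespace Env

variable {m d : ℕ} (E : Env m d)

/-- Uniform distribution on the action space (normalized Lebesgue measure). -/
def unif : Measure (Fin d → ℝ) := ProbabilityTheory.cond volume E.W

/-- Law `N(0, σ² I_d)` of the label noise. -/
def labelNoise : Measure (Fin d → ℝ) := Measure.pi fun _ => gaussianReal 0 (E.σ ^ 2)

/-- Law `N(0, σ²)` of the cost noise. -/
def costNoise : Measure ℝ := gaussianReal 0 (E.σ ^ 2)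

/-- Label of feature `x` under action `w` when the label noise is `e`. -/
def label (x : Fin m → ℝ) (w e : Fin d → ℝ) : Fin d → ℝ := E.F *ᵥ x + E.G *ᵥ w + e

/-- Cost `p(c, w) + q(w) + η = cᵀ w + μᵀ w + η` of action `w`, with `c` the label under `w`. -/
def cost (x : Fin m → ℝ) (e : Fin d → ℝ) (h : ℝ) (w : Fin d → ℝ) : ℝ :=
  E.label x w e ⬝ᵥ w + (E.μ ⬝ᵥ w + h)

/-- Expected cost of action `w` given feature `x` (over the label and the cost noise). -/
def expectedCost (x : Fin m → ℝ) (w : Fin d → ℝ) : ℝ :=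
  ∫ e, ∫ h, E.cost x e h w ∂E.costNoise ∂E.labelNoise

/-- `π` is an optimal policy: `π x` minimizes the expected cost given `x` over `W`. -/
structure IsOptimalPolicy (π : (Fin m → ℝ) → (Fin d → ℝ)) : Prop where
  measurable : Measurable π
  mem : ∀ x ∈ E.X, π x ∈ E.W
  le : ∀ x ∈ E.X, ∀ w ∈ E.W, E.expectedCost x (π x) ≤ E.expectedCost x w

/-- Standing assumptions: bounded features, a continuous action space (so that it carries a uniform
distribution) inside the unit Euclidean ball, bounded mean labels and bounded `μ`, and a lower bound
on the eigenvalues of the second moment matrix of the regressor `(x, w)`, `x ∼ Dx`, `w` uniform.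
As `‖(x, w)‖² ≤ KX² + 1`, these eigenvalues are at most `(KX² + 1) / (m + d)` on average, whence the
normalization by `m + d`, which lets `KS` be a constant while `m` and `d` grow. -/
structure IsRegular (KX KC Kμ KS : ℝ) : Prop where
  prob : IsProbabilityMeasure E.Dx
  ae_mem : ∀ᵐ x ∂E.Dx, x ∈ E.X
  norm_feature : ∀ x ∈ E.X, l2norm x ≤ KX
  measurableSet_action : MeasurableSet E.W
  volume_pos : 0 < volume E.W
  norm_action : ∀ w ∈ E.W, l2norm w ≤ 1
  norm_label : ∀ x ∈ E.X, ∀ w ∈ E.W, l2norm (E.F *ᵥ x + E.G *ᵥ w) ≤ KC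
  norm_mu : l2norm E.μ ≤ Kμ
  eigenvalue : ∀ (a : Fin m → ℝ) (b : Fin d → ℝ),
    KS / (m + d) * (a ⬝ᵥ a + b ⬝ᵥ b) ≤
      ∫ z, (a ⬝ᵥ z.1 + b ⬝ᵥ z.2) ^ 2 ∂(E.Dx.prod E.unif)

end Env

/-- The primitive random variables for round `t` and individual `i`: feature `x t i`, random action
`u t i` (used when exploring), label noise `e t i`, cost noise `η t i`.
Round `0` is the initial dataset. -/
structure Primitives (m d n : ℕ) (Ω : Type*) where
  x : ℕ → Fin n → Ω → (Fin m → ℝ)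
  u : ℕ → Fin n → Ω → (Fin d → ℝ)
  e : ℕ → Fin n → Ω → (Fin d → ℝ)
  η : ℕ → Fin n → Ω → ℝ

namespace Primitives

variable {m d n : ℕ} {Ω : Type*} (S : Primitives m d n Ω)

/-- All primitives of round `t` and individual `i`, as one random variable. -/
def all (t : ℕ) (i : Fin n) (ω : Ω) :
    (Fin m → ℝ) × (Fin d → ℝ) × (Fin d → ℝ) × ℝ :=
  (S.x t i ω, S.u t i ω, S.e t i ω, S.η t i ω)

/-- The primitives are mutually independent, with the laws prescribed by the environment. -/
structure IsSample [MeasurableSpace Ω] (P : Measure Ω) (E : Env m d) : Prop where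
  measurable : ∀ t i, Measurable (S.all t i)
  indep : iIndepFun (fun (k : ℕ × Fin n) => S.all k.1 k.2) P
  law : ∀ t i, P.map (S.all t i) =
    E.Dx.prod (E.unif.prod (E.labelNoise.prod E.costNoise))

/-- Information available when the actions of round `t` are chosen: everything about the earlier
rounds, and the features and the randomization of round `t`. -/
@[reducible] def info (t : ℕ) : MeasurableSpace Ω :=
  (⨆ s : Fin t, ⨆ i : Fin n, MeasurableSpace.comap (S.all s i) inferInstance) ⊔
    ⨆ i : Fin n, MeasurableSpace.comap (fun ω => (S.x t i ω, S.u t i ω)) inferInstance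

end Primitives

/-- `b` is a barycentric spanner of `W`. -/
def IsBarycentricSpanner {d : ℕ} (W : Set (Fin d → ℝ)) (b : Fin d → Fin d → ℝ) : Prop :=
  (∀ j, b j ∈ W) ∧ ∀ w ∈ W, ∃ a : Fin d → ℝ, (∀ j, |a j| ≤ 1) ∧ w = ∑ j, a j • b j

/-- Squared radius `β^t` of the confidence balls. -/
def radius (d n : ℕ) (γ : ℝ) (t : ℕ) : ℝ :=
  max (128 * d * Real.log t * Real.log (n * (t : ℝ) ^ 2 / γ))
    ((8 / 3 * Real.log (n * (t : ℝ) ^ 2 / γ)) ^ 2)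

section Algorithm

variable {m d n : ℕ} {Ω : Type*} (E : Env m d) (S : Primitives m d n Ω)
  (w : ℕ → Fin n → Ω → (Fin d → ℝ))

/-- Observed label of individual `i` in round `t`. -/
def obsLabel (t : ℕ) (i : Fin n) (ω : Ω) : Fin d → ℝ :=
  E.label (S.x t i ω) (w t i ω) (S.e t i ω)

/-- Observed bandit part `μᵀ w + η` of the cost. -/
def obsBandit (t : ℕ) (i : Fin n) (ω : Ω) : ℝ := E.μ ⬝ᵥ w t i ω + S.η t i ω

/-- Sum of squared residuals of the linear predictor `(x, w) ↦ F' x + G' w` on the data of the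
rounds `0, …, t - 1`. -/
def squaredLoss (t : ℕ) (ω : Ω) (F' : Matrix (Fin d) (Fin m) ℝ) (G' : Matrix (Fin d) (Fin d) ℝ) :
    ℝ :=
  ∑ s ∈ Finset.range t, ∑ i : Fin n,
    l2norm (obsLabel E S w s i ω - (F' *ᵥ S.x s i ω + G' *ᵥ w s i ω)) ^ 2

/-- `(F', G')` is an ordinary least squares fit to the data of the rounds `0, …, t - 1`. -/
def IsOLS (t : ℕ) (ω : Ω) (F' : Matrix (Fin d) (Fin m) ℝ) (G' : Matrix (Fin d) (Fin d) ℝ) : Prop :=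
  ∀ F'' G'', squaredLoss E S w t ω F' G' ≤ squaredLoss E S w t ω F'' G''

/-- `A_i^t = ∑_j b_j b_jᵀ + ∑_{1 ≤ s < t} w_i^s (w_i^s)ᵀ`. -/
def gram (b : Fin d → Fin d → ℝ) (t : ℕ) (i : Fin n) (ω : Ω) : Matrix (Fin d) (Fin d) ℝ :=
  ∑ j, Matrix.vecMulVec (b j) (b j) +
    ∑ s ∈ Finset.Ico 1 t, Matrix.vecMulVec (w s i ω) (w s i ω)

/-- `μ̂_i^t = (A_i^t)⁻¹ ∑_{1 ≤ s < t} u_{b,i}^s w_i^s`. -/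
def muHat (b : Fin d → Fin d → ℝ) (t : ℕ) (i : Fin n) (ω : Ω) : Fin d → ℝ :=
  (gram w b t i ω)⁻¹ *ᵥ ∑ s ∈ Finset.Ico 1 t, obsBandit E S w s i ω • w s i ω

/-- Confidence ball `B_i^t = {ν : ‖ν - μ̂_i^t‖_{2, A_i^t} ≤ √β^t}`. -/
def confBall (b : Fin d → Fin d → ℝ) (γ : ℝ) (t : ℕ) (i : Fin n) (ω : Ω) : Set (Fin d → ℝ) :=
  {ν | √((ν - muHat E S w b t i ω) ⬝ᵥ gram w b t i ω *ᵥ (ν - muHat E S w b t i ω)) ≤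
    √(radius d n γ t)}

/-- `v` minimizes `w ↦ min_{ν ∈ B} (ĉ(w) + ν)ᵀ w` over `W`, the inner minimum being attained. -/
def IsOptimisticChoice (W B : Set (Fin d → ℝ)) (chat : (Fin d → ℝ) → (Fin d → ℝ))
    (v : Fin d → ℝ) : Prop :=
  v ∈ W ∧ ∃ ν ∈ B, ∀ v' ∈ W, ∀ ν' ∈ B, (chat v + ν) ⬝ᵥ v ≤ (chat v' + ν') ⬝ᵥ v'

/-- `w` is the sequence of actions of the explore-then-exploit variant of PROOF with barycentric
spanner `b`, confidence parameter `γ`, exploration length `T₀` and horizon `T`.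
Ties (in the regression and in the choice of the action) are broken arbitrarily, but without looking
at anything that is not yet observed. -/
structure IsRun (b : Fin d → Fin d → ℝ) (γ : ℝ) (T₀ T : ℕ) : Prop where
  spanner : IsBarycentricSpanner E.W b
  adapted : ∀ t ≤ T, ∀ i, Measurable[S.info t] (w t i)
  initial : ∀ i ω, w 0 i ω ∈ E.W
  explore : ∀ t, 1 ≤ t → t ≤ T₀ → t ≤ T → ∀ i, w t i = S.u t i
  exploit : ∀ t, T₀ < t → t ≤ T → ∀ ω,
    ∃ Fhat Ghat, IsOLS E S w t ω Fhat Ghat ∧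
      ∀ i, IsOptimisticChoice E.W (confBall E S w b γ t i ω)
        (fun v => Fhat *ᵥ S.x t i ω + Ghat *ᵥ v) (w t i ω)

/-- Total cost of the actions `w` minus that of the policy `π` in the rounds `1, …, T`. -/
def excessCost (π : (Fin m → ℝ) → (Fin d → ℝ)) (T : ℕ) (ω : Ω) : ℝ :=
  ∑ t ∈ Finset.Icc 1 T, ∑ i : Fin n,
    (E.cost (S.x t i ω) (S.e t i ω) (S.η t i ω) (w t i ω) -
      E.cost (S.x t i ω) (S.e t i ω) (S.η t i ω) (π (S.x t i ω)))

/-- The regret `R_T`. -/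
def regret [MeasurableSpace Ω] (P : Measure Ω) (π : (Fin m → ℝ) → (Fin d → ℝ)) (T : ℕ) : ℝ :=
  ∫ ω, excessCost E S w π T ω ∂P

end Algorithm

end PROOFBandit

end

/-! The excess cost of a round is `Env.gap` plus a term linear in the label noise. That noise is
centred and independent of both actions, so the regret is the sum of the mean gaps (`regret_eq`).
Write ρ = m^{1/3} d^{2/3} T^{2/3}, ε = ρ / T and l = 1 + log(nT/γ). Gaps are bounded, which pays for
the about ρ exploration rounds; what has to be shown is that an exploitation round costs O(ε l) per
individual.

An exploiting action is optimal for estimated parameters, so its gap is at most twice the estimation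
error along actions (`gap_le_of_isOptimisticChoice`). It does not matter whether μ lies in the
confidence ball: exploration makes the Gram matrices at least N₁ ≈ n T₀ / (m + d) for the regression
and N₂ ≈ T₀ / (m + d) for each individual, so every element of the ball is close to μ̂, and μ̂ to μ.

All errors are controlled in expectation, without high-probability events. For fixed directions, the
noise and Gram processes have exponential moment at most 1 (`lintegral_exp_sum_compensated_le_one`,
`lintegral_exp_gram_le_one`). A union over a grid turns this into one integrable random variable G
that dominates the process in all directions and whose mean is the dimension times a logarithm
(`exists_integrable_bound`). The least squares and ridge identities then bound each error r by a
scale-dependent inequality, which `le_of_forall_scale` converts into r ≤ ε + (2τ/ε + 2) G/N. This is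
linear in G, so a first moment suffices. When the Gram bound degenerates, the bounded gap is itself
dominated by a linear expression in the Gram deviations, a pointwise form of Markov's inequality
(`integral_gap_exploit_le`).

The rate comes from ρ³ = m d² T², that is, m d² / ρ = ε². With m ≤ κ n, both (m + d)² / (n T₀) and d
(m + d) / T₀ are O(ε²), so the errors and the confidence radius are O(ε l) (`div_gram_le`). If T ≤
8ρ, the trivial bound is enough. -/

noncomputable section

namespace PROOFBandit

/-! ### Independence of the noises -/

section

/-- If `H` is independent of the pair `(A, N)` and `A` is independent of `N`, then `H` and `A`
together are independent of `N`. -/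
lemma indep_sup_comap {Ω α β : Type*} {H mΩ : MeasurableSpace Ω} [MeasurableSpace α]
    [MeasurableSpace β] {P : Measure Ω} [IsProbabilityMeasure P]
    {A : Ω → α} {N : Ω → β} (hH : H ≤ mΩ) (hA : Measurable A) (hN : Measurable N)
    (h1 : Indep H (MeasurableSpace.comap (fun ω => (A ω, N ω)) inferInstance) P)
    (h2 : IndepFun A N P) :
    Indep (H ⊔ MeasurableSpace.comap A inferInstance) (MeasurableSpace.comap N inferInstance) P := by
  -- The sets h ∩ A⁻¹(a) form a π-system generating the join, so the product formula need only be
  -- checked on them.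
  let p : Set (Set Ω) := {s | ∃ h a, MeasurableSet[H] h ∧ MeasurableSet a ∧ s = h ∩ A ⁻¹' a}
  have hp : IsPiSystem p := by
    rintro _ ⟨h, a, hh, ha, rfl⟩ _ ⟨h', a', hh', ha', rfl⟩ -
    exact ⟨h ∩ h', a ∩ a', hh.inter hh', ha.inter ha', by
      rw [Set.preimage_inter, Set.inter_inter_inter_comm]⟩
  have hgen : H ⊔ MeasurableSpace.comap A inferInstance = MeasurableSpace.generateFrom p := by
    apply le_antisymm
    · refine sup_le (fun s hs => ?_) ?_
      · exact MeasurableSpace.measurableSet_generateFrom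
          ⟨s, Set.univ, hs, MeasurableSet.univ, by simp⟩
      · rintro _ ⟨a, ha, rfl⟩
        exact MeasurableSpace.measurableSet_generateFrom
          ⟨Set.univ, a, MeasurableSet.univ, ha, by simp⟩
    · refine MeasurableSpace.generateFrom_le ?_
      rintro _ ⟨h, a, hh, ha, rfl⟩
      exact MeasurableSet.inter (le_sup_left (a := H) _ hh)
        (le_sup_right (a := H) _ ⟨a, ha, rfl⟩)
  refine IndepSets.indep (p1 := p) (p2 := {s | MeasurableSet[MeasurableSpace.comap N inferInstance] s})
    (sup_le hH hA.comap_le) hN.comap_le hp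
    (@MeasurableSpace.isPiSystem_measurableSet _ (MeasurableSpace.comap N inferInstance)) hgen
    (@MeasurableSpace.generateFrom_measurableSet _ (MeasurableSpace.comap N inferInstance)).symm ?_
  rw [IndepSets_iff]
  rintro _ _ ⟨h, a, hh, ha, rfl⟩ ⟨b, hb, rfl⟩
  rw [Indep_iff] at h1
  have k1 := h1 h _ hh ⟨a ×ˢ b, ha.prod hb, rfl⟩
  have k2 := h1 h _ hh ⟨a ×ˢ Set.univ, ha.prod MeasurableSet.univ, rfl⟩
  have k3 := h2.measure_inter_preimage_eq_mul a b ha hb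
  have e1 : (fun ω => (A ω, N ω)) ⁻¹' a ×ˢ b = A ⁻¹' a ∩ N ⁻¹' b := rfl
  have e2 : (fun ω => (A ω, N ω)) ⁻¹' a ×ˢ (Set.univ : Set β) = A ⁻¹' a := by ext; simp
  rw [e1] at k1
  rw [e2] at k2
  rw [Set.inter_assoc, k1, k2, k3, mul_assoc]

namespace Env

variable {m d : ℕ} {E : Env m d} {KX KC Kμ KS : ℝ}

lemma dot_self_le_of_l2norm_le {k : ℕ} {v : Fin k → ℝ} {r : ℝ} (h : l2norm v ≤ r) :
    v ⬝ᵥ v ≤ r ^ 2 := by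
  have h0 : 0 ≤ v ⬝ᵥ v := Finset.sum_nonneg fun i _ => mul_self_nonneg (v i)
  have := pow_le_pow_left₀ (Real.sqrt_nonneg _) h 2
  rwa [Real.sq_sqrt h0] at this

lemma IsRegular.volume_lt_top (h : E.IsRegular KX KC Kμ KS) : volume E.W < ⊤ := by
  refine lt_of_le_of_lt (measure_mono (t := Metric.closedBall 0 1) fun w hw => ?_)
    measure_closedBall_lt_top
  rw [mem_closedBall_zero_iff, pi_norm_le_iff_of_nonneg zero_le_one]
  intro i
  have h1 := dot_self_le_of_l2norm_le (h.norm_action w hw)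
  have h2 : w i * w i ≤ w ⬝ᵥ w :=
    Finset.single_le_sum (f := fun i => w i * w i) (fun i _ => mul_self_nonneg _) (Finset.mem_univ i)
  rw [Real.norm_eq_abs]
  exact abs_le_one_iff_mul_self_le_one.2 (by linarith)

lemma IsRegular.isProbabilityMeasure_unif (h : E.IsRegular KX KC Kμ KS) :
    IsProbabilityMeasure E.unif :=
  cond_isProbabilityMeasure_of_finite h.volume_pos.ne' h.volume_lt_top.ne

instance : IsProbabilityMeasure E.labelNoise := by unfold labelNoise; infer_instance

instance : IsProbabilityMeasure E.costNoise := by unfold costNoise; infer_instance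

/-- The Gaussian moment generating function, coordinate by coordinate. The `lintegral` form lets the
supermartingale argument run without integrability side conditions. -/
lemma lintegral_exp_noise (q : Fin d → ℝ) (r : ℝ) :
    ∫⁻ z, ENNReal.ofReal (Real.exp (q ⬝ᵥ z.1 + r * z.2)) ∂(E.labelNoise.prod E.costNoise) =
      ENNReal.ofReal (Real.exp ((E.σ : ℝ) ^ 2 / 2 * (q ⬝ᵥ q + r ^ 2))) := by
  have key : ∀ s : ℝ, ∫ x, Real.exp (s * x) ∂(gaussianReal 0 (E.σ ^ 2)) =
      Real.exp ((E.σ : ℝ) ^ 2 / 2 * s ^ 2) := by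
    intro s
    have := congrFun (mgf_id_gaussianReal (μ := 0) (v := E.σ ^ 2)) s
    simp only [mgf, id] at this
    rw [this]
    push_cast
    ring_nf
  have i1 : Integrable (fun e : Fin d → ℝ => ∏ j, Real.exp (q j * e j)) E.labelNoise :=
    Integrable.fintype_prod fun j => integrable_exp_mul_gaussianReal (q j)
  have i2 : Integrable (fun h : ℝ => Real.exp (r * h)) E.costNoise :=
    integrable_exp_mul_gaussianReal r
  have e0 : ∀ z : (Fin d → ℝ) × ℝ, Real.exp (q ⬝ᵥ z.1 + r * z.2) =
      (∏ j, Real.exp (q j * z.1 j)) * Real.exp (r * z.2) := fun z => by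
    rw [Real.exp_add, ← Real.exp_sum]; rfl
  simp_rw [e0]
  rw [← ofReal_integral_eq_lintegral_ofReal (i1.mul_prod i2)
    (Filter.Eventually.of_forall fun z => by positivity),
    integral_prod_mul (fun e : Fin d → ℝ => ∏ j, Real.exp (q j * e j)) fun h => Real.exp (r * h)]
  congr 1
  unfold labelNoise costNoise
  rw [integral_fintype_prod_eq_prod (fun j (x : ℝ) => Real.exp (q j * x)), key,
    Finset.prod_congr rfl fun j _ => key (q j), ← Real.exp_sum, ← Real.exp_add, ← Finset.mul_sum,
    ← mul_add]
  simp [dotProduct, sq]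

end Env

namespace Primitives

variable {m d n : ℕ} {Ω : Type*} {S : Primitives m d n Ω}

/-- Everything except the noises of individual `i` in round `t`. -/
@[reducible] def others (S : Primitives m d n Ω) (t : ℕ) (i : Fin n) : MeasurableSpace Ω :=
  (⨆ k ∈ ({(t, i)}ᶜ : Set (ℕ × Fin n)), MeasurableSpace.comap (S.all k.1 k.2) inferInstance) ⊔
    MeasurableSpace.comap (fun ω => (S.x t i ω, S.u t i ω)) inferInstance

lemma comap_all_le_others {t r : ℕ} {i j : Fin n} (h : (r, j) ≠ (t, i)) :
    MeasurableSpace.comap (S.all r j) inferInstance ≤ S.others t i :=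
  le_trans (le_iSup₂_of_le (f := fun (k : ℕ × Fin n) (_ : k ∈ ({(t, i)}ᶜ : Set (ℕ × Fin n))) =>
    MeasurableSpace.comap (S.all k.1 k.2) inferInstance) (r, j) h le_rfl) le_sup_left

lemma comap_le_comap_all {α : Type*} [MeasurableSpace α] {t : ℕ} {i : Fin n}
    {f : (Fin m → ℝ) × (Fin d → ℝ) × (Fin d → ℝ) × ℝ → α} (hf : Measurable f) :
    MeasurableSpace.comap (fun ω => f (S.all t i ω)) inferInstance ≤
      MeasurableSpace.comap (S.all t i) inferInstance :=
  Measurable.comap_le (hf.comp (comap_measurable (S.all t i)))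

/-- The actions of a round are chosen before its noises are seen. Hence anything measurable for
`info t` is independent of the noise of each individual in round t. -/
lemma info_le_others (t : ℕ) (i : Fin n) : S.info t ≤ S.others t i := by
  refine sup_le (iSup_le fun s => iSup_le fun j => comap_all_le_others ?_) (iSup_le fun j => ?_)
  · intro h
    exact s.2.ne (congrArg Prod.fst h)
  · by_cases hj : j = i
    · subst hj; exact le_sup_right
    · refine le_trans ?_ (comap_all_le_others (S := S) (t := t) (r := t) (i := i) (j := j) ?_)
      · exact comap_le_comap_all (f := fun z => (z.1, z.2.1)) (by fun_prop)
      · intro h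
        exact hj (congrArg Prod.snd h)

lemma comap_all_le_info {s t : ℕ} (h : s < t) (i : Fin n) :
    MeasurableSpace.comap (S.all s i) inferInstance ≤ S.info t :=
  le_trans (le_iSup_of_le (f := fun s : Fin t => ⨆ i : Fin n,
    MeasurableSpace.comap (S.all s i) inferInstance) ⟨s, h⟩
      (le_iSup (fun i : Fin n => MeasurableSpace.comap (S.all s i) inferInstance) i)) le_sup_left

lemma comap_xu_le_info (t : ℕ) (i : Fin n) :
    MeasurableSpace.comap (fun ω => (S.x t i ω, S.u t i ω)) inferInstance ≤ S.info t :=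
  le_trans (le_iSup (fun i : Fin n =>
    MeasurableSpace.comap (fun ω => (S.x t i ω, S.u t i ω)) inferInstance) i) le_sup_right

lemma info_mono {s t : ℕ} (h : s ≤ t) : S.info s ≤ S.info t := by
  rcases h.eq_or_lt with rfl | h
  · exact le_rfl
  refine sup_le (iSup_le fun r => iSup_le fun j => comap_all_le_info (r.2.trans h) j)
    (iSup_le fun j => le_trans ?_ (comap_all_le_info h j))
  exact comap_le_comap_all (f := fun z => (z.1, z.2.1)) (by fun_prop)

lemma measurable_x_info (t : ℕ) (i : Fin n) : Measurable[S.info t] (S.x t i) :=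
  (measurable_fst.comp (comap_measurable fun ω => (S.x t i ω, S.u t i ω))).mono
    (comap_xu_le_info t i) le_rfl

lemma measurable_e_info {s t : ℕ} (h : s < t) (i : Fin n) : Measurable[S.info t] (S.e s i) :=
  ((by fun_prop : Measurable fun z : (Fin m → ℝ) × (Fin d → ℝ) × (Fin d → ℝ) × ℝ => z.2.2.1).comp
    (comap_measurable (S.all s i))).mono (comap_all_le_info h i) le_rfl

lemma measurable_eta_info {s t : ℕ} (h : s < t) (i : Fin n) : Measurable[S.info t] (S.η s i) :=
  ((by fun_prop : Measurable fun z : (Fin m → ℝ) × (Fin d → ℝ) × (Fin d → ℝ) × ℝ => z.2.2.2).comp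
    (comap_measurable (S.all s i))).mono (comap_all_le_info h i) le_rfl

namespace IsSample

variable [mΩ : MeasurableSpace Ω] {P : Measure Ω} {E : Env m d} {KX KC Kμ KS : ℝ}
  (hS : S.IsSample P E)
include hS

lemma measurable_x (t : ℕ) (i : Fin n) : Measurable (S.x t i) :=
  measurable_fst.comp (hS.measurable t i)

lemma measurable_u (t : ℕ) (i : Fin n) : Measurable (S.u t i) :=
  measurable_fst.comp (measurable_snd.comp (hS.measurable t i))

lemma measurable_e (t : ℕ) (i : Fin n) : Measurable (S.e t i) :=
  measurable_fst.comp (measurable_snd.comp (measurable_snd.comp (hS.measurable t i)))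

lemma measurable_eta (t : ℕ) (i : Fin n) : Measurable (S.η t i) :=
  measurable_snd.comp (measurable_snd.comp (measurable_snd.comp (hS.measurable t i)))

lemma others_le (t : ℕ) (i : Fin n) : S.others t i ≤ mΩ :=
  sup_le (iSup₂_le fun k _ => (hS.measurable k.1 k.2).comap_le)
    ((hS.measurable_x t i).prodMk (hS.measurable_u t i)).comap_le

lemma map_xu (hE : E.IsRegular KX KC Kμ KS) (t : ℕ) (i : Fin n) :
    P.map (fun ω => (S.x t i ω, S.u t i ω)) = E.Dx.prod E.unif := by
  have := hE.prob
  have := hE.isProbabilityMeasure_unif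
  have h : (fun ω => (S.x t i ω, S.u t i ω)) =
      (Prod.map id Prod.fst) ∘ S.all t i := rfl
  rw [h, ← Measure.map_map (by fun_prop) (hS.measurable t i), hS.law,
    ← Measure.map_prod_map _ _ measurable_id measurable_fst]
  simp

lemma map_noise (hE : E.IsRegular KX KC Kμ KS) (t : ℕ) (i : Fin n) :
    P.map (fun ω => (S.e t i ω, S.η t i ω)) = E.labelNoise.prod E.costNoise := by
  have := hE.prob
  have := hE.isProbabilityMeasure_unif
  have h : (fun ω => (S.e t i ω, S.η t i ω)) =
      (Prod.snd ∘ Prod.snd) ∘ S.all t i := rfl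
  rw [h, ← Measure.map_map (by fun_prop) (hS.measurable t i), hS.law,
    ← Measure.map_map (by fun_prop) (by fun_prop)]
  simp

/-- Two sources of independence are joined: different (round, individual) pairs are independent, and
within one pair the product law separates (x, u) from the noises. -/
lemma indep_others [IsProbabilityMeasure P] (hE : E.IsRegular KX KC Kμ KS) (t : ℕ) (i : Fin n) :
    Indep (S.others t i)
      (MeasurableSpace.comap (fun ω => (S.e t i ω, S.η t i ω)) inferInstance) P := by
  have := hE.prob
  have := hE.isProbabilityMeasure_unif
  refine indep_sup_comap (iSup₂_le fun k _ => (hS.measurable k.1 k.2).comap_le)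
    ((hS.measurable_x t i).prodMk (hS.measurable_u t i))
    ((hS.measurable_e t i).prodMk (hS.measurable_eta t i)) ?_ ?_
  · have h := indep_iSup_of_disjoint (m := fun k : ℕ × Fin n =>
      MeasurableSpace.comap (S.all k.1 k.2) inferInstance) (fun k => (hS.measurable k.1 k.2).comap_le) hS.indep
      (S := {(t, i)}ᶜ) (T := {(t, i)}) (Set.disjoint_left.2 fun _ h h' => h h')
    refine indep_of_indep_of_le_right h ?_
    rw [iSup_singleton]
    exact comap_le_comap_all (f := fun z => ((z.1, z.2.1), z.2.2)) (by fun_prop)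
  · rw [indepFun_iff_map_prod_eq_prod_map_map
      ((hS.measurable_x t i).prodMk (hS.measurable_u t i)).aemeasurable
      ((hS.measurable_e t i).prodMk (hS.measurable_eta t i)).aemeasurable,
      hS.map_xu hE, hS.map_noise hE]
    have h : (fun ω => ((S.x t i ω, S.u t i ω), S.e t i ω, S.η t i ω)) =
      MeasurableEquiv.prodAssoc.symm ∘ S.all t i := rfl
    rw [h, ← Measure.map_map (by fun_prop) (hS.measurable t i), hS.law, ← Measure.prodAssoc_prod]
    rw [MeasurableEquiv.map_symm_map]

end IsSample

end Primitives

end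

/-! ### The exponential supermartingale -/

section

variable {m d n : ℕ} {Ω : Type*} [mΩ : MeasurableSpace Ω] {S : Primitives m d n Ω} {P : Measure Ω}
  [IsProbabilityMeasure P] {E : Env m d} {KX KC Kμ KS : ℝ}

/-- An upper bound, at least `1`, for the noise variance. -/
def Env.tau (E : Env m d) : ℝ := (E.σ : ℝ) ^ 2 + 1

lemma Env.one_le_tau (E : Env m d) : 1 ≤ E.tau := by
  have := sq_nonneg (E.σ : ℝ)
  unfold Env.tau
  linarith

/-- Compensated linear functional `q·e + r h - τ/2 (|q|² + r²)` of the noises `e`, `h`. -/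
def Env.compensated (E : Env m d) (q : Fin d → ℝ) (r : ℝ) (e : Fin d → ℝ) (h : ℝ) : ℝ :=
  q ⬝ᵥ e + r * h - E.tau / 2 * (q ⬝ᵥ q + r ^ 2)

lemma dot_self_nonneg {ι : Type*} [Fintype ι] (v : ι → ℝ) : 0 ≤ v ⬝ᵥ v :=
  Finset.sum_nonneg fun i _ => mul_self_nonneg (v i)

lemma measurable_dot {α ι : Type*} [Fintype ι] {mα : MeasurableSpace α} {f g : α → ι → ℝ}
    (hf : Measurable f) (hg : Measurable g) : Measurable fun a => f a ⬝ᵥ g a :=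
  Finset.measurable_sum _ fun i _ =>
    ((measurable_pi_apply i).comp hf).mul ((measurable_pi_apply i).comp hg)

lemma Env.measurable_compensated {α : Type*} {mα : MeasurableSpace α} {q e : α → Fin d → ℝ}
    {r h : α → ℝ} (hq : Measurable q) (hr : Measurable r) (he : Measurable e) (hh : Measurable h) :
    Measurable fun a => E.compensated (q a) (r a) (e a) (h a) :=
  ((measurable_dot hq he).add (hr.mul hh)).sub
    (((measurable_dot hq hq).add (hr.pow_const 2)).const_mul _)

/-- Given everything else, q and r are constants and the noise is Gaussian. Its exponential moment
has exponent σ²/2 (|q|² + r²), which the compensator with τ ≥ σ² cancels. -/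
lemma lintegral_mul_exp_compensated_le (hS : S.IsSample P E) (hE : E.IsRegular KX KC Kμ KS)
    (t : ℕ) (i : Fin n) {Y : Ω → ENNReal} {q : Ω → Fin d → ℝ} {r : Ω → ℝ}
    (hY : Measurable[S.others t i] Y) (hq : Measurable[S.others t i] q)
    (hr : Measurable[S.others t i] r) :
    ∫⁻ ω, Y ω * ENNReal.ofReal (Real.exp (E.compensated (q ω) (r ω) (S.e t i ω) (S.η t i ω))) ∂P ≤
      ∫⁻ ω, Y ω ∂P := by
  have hle := hS.others_le t i
  have hR : Measurable[S.others t i] fun ω => (Y ω, q ω, r ω) := hY.prodMk (hq.prodMk hr)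
  have hR' : Measurable fun ω => (Y ω, q ω, r ω) := hR.mono hle le_rfl
  have hN : Measurable fun ω => (S.e t i ω, S.η t i ω) :=
    (hS.measurable_e t i).prodMk (hS.measurable_eta t i)
  have hind : IndepFun (fun ω => (Y ω, q ω, r ω)) (fun ω => (S.e t i ω, S.η t i ω)) P :=
    indep_of_indep_of_le_left (hS.indep_others hE t i) hR.comap_le
  have hmap := (indepFun_iff_map_prod_eq_prod_map_map hR'.aemeasurable hN.aemeasurable).1 hind
  rw [hS.map_noise hE] at hmap
  let f : (ENNReal × (Fin d → ℝ) × ℝ) × ((Fin d → ℝ) × ℝ) → ENNReal := fun z =>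
    z.1.1 * ENNReal.ofReal (Real.exp (E.compensated z.1.2.1 z.1.2.2 z.2.1 z.2.2))
  have hf : Measurable f :=
    (measurable_fst.comp measurable_fst).mul
      (Env.measurable_compensated (by fun_prop) (by fun_prop) (by fun_prop)
        (by fun_prop)).exp.ennreal_ofReal
  have e1 : ∫⁻ ω, f ((Y ω, q ω, r ω), (S.e t i ω, S.η t i ω)) ∂P =
      ∫⁻ z, f z ∂(P.map fun ω => ((Y ω, q ω, r ω), (S.e t i ω, S.η t i ω))) :=
    (lintegral_map hf (hR'.prodMk hN)).symm
  have hfin : Measurable fun z : ENNReal × (Fin d → ℝ) × ℝ => z.1 := measurable_fst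
  calc _ = ∫⁻ ω, f ((Y ω, q ω, r ω), (S.e t i ω, S.η t i ω)) ∂P := rfl
    _ = ∫⁻ z, ∫⁻ y, f (z, y) ∂(E.labelNoise.prod E.costNoise) ∂(P.map fun ω => (Y ω, q ω, r ω)) := by
      rw [e1, hmap, lintegral_prod _ hf.aemeasurable]
    _ ≤ ∫⁻ z, z.1 ∂(P.map fun ω => (Y ω, q ω, r ω)) := by
      refine lintegral_mono fun z => ?_
      have e2 : ∀ y : (Fin d → ℝ) × ℝ, f (z, y) =
          (z.1 * ENNReal.ofReal (Real.exp (-(E.tau / 2 * (z.2.1 ⬝ᵥ z.2.1 + z.2.2 ^ 2))))) *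
            ENNReal.ofReal (Real.exp (z.2.1 ⬝ᵥ y.1 + z.2.2 * y.2)) := fun y => by
        simp only [f, Env.compensated]
        rw [mul_assoc, ← ENNReal.ofReal_mul (Real.exp_nonneg _), ← Real.exp_add]
        ring_nf
      simp_rw [e2]
      have hm : Measurable fun y : (Fin d → ℝ) × ℝ =>
          ENNReal.ofReal (Real.exp (z.2.1 ⬝ᵥ y.1 + z.2.2 * y.2)) :=
        ((measurable_dot measurable_const measurable_fst).add
          (measurable_snd.const_mul _)).exp.ennreal_ofReal
      rw [lintegral_const_mul _ hm, Env.lintegral_exp_noise, mul_assoc,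
        ← ENNReal.ofReal_mul (Real.exp_nonneg _), ← Real.exp_add]
      refine mul_le_of_le_one_right' ?_
      rw [ENNReal.ofReal_le_one, Real.exp_le_one_iff]
      have := dot_self_nonneg z.2.1
      have := sq_nonneg z.2.2
      unfold Env.tau
      nlinarith
    _ = ∫⁻ ω, Y ω ∂P := lintegral_map hfin hR'

/-- The individuals of one round are integrated out one at a time. This works because `others t i`
contains the noises of the remaining individuals of the same round. -/
lemma lintegral_mul_prod_exp_compensated_le (hS : S.IsSample P E) (hE : E.IsRegular KX KC Kμ KS)
    (t : ℕ) {Y : Ω → ENNReal} {q : Fin n → Ω → Fin d → ℝ} {r : Fin n → Ω → ℝ}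
    (hY : Measurable[S.info t] Y) (hq : ∀ i, Measurable[S.info t] (q i))
    (hr : ∀ i, Measurable[S.info t] (r i)) (s : Finset (Fin n)) :
    ∫⁻ ω, Y ω * ∏ i ∈ s, ENNReal.ofReal
        (Real.exp (E.compensated (q i ω) (r i ω) (S.e t i ω) (S.η t i ω))) ∂P ≤
      ∫⁻ ω, Y ω ∂P := by
  classical
  induction s using Finset.induction_on with
  | empty => simp
  | insert i s hi ih =>
    refine le_trans ?_ ih
    have hinfo := S.info_le_others t i
    have key : Measurable[S.others t i] fun ω => Y ω * ∏ j ∈ s, ENNReal.ofReal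
        (Real.exp (E.compensated (q j ω) (r j ω) (S.e t j ω) (S.η t j ω))) := by
      refine (hY.mono hinfo le_rfl).mul (Finset.measurable_prod _ fun j hj => ?_)
      have hne : (t, j) ≠ (t, i) := fun h => hi (by cases h; exact hj)
      have hall := (comap_measurable (S.all t j)).mono
        (Primitives.comap_all_le_others hne) le_rfl
      exact (Env.measurable_compensated ((hq j).mono hinfo le_rfl) ((hr j).mono hinfo le_rfl)
        (measurable_fst.comp (measurable_snd.comp (measurable_snd.comp hall)))
        (measurable_snd.comp (measurable_snd.comp (measurable_snd.comp hall)))).exp.ennreal_ofReal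
    refine le_trans (le_of_eq ?_) (lintegral_mul_exp_compensated_le hS hE t i key
      ((hq i).mono hinfo le_rfl) ((hr i).mono hinfo le_rfl))
    refine lintegral_congr fun ω => ?_
    rw [Finset.prod_insert hi]
    ring

/-- The exponential supermartingale of a predictable linear functional of the noises. -/
lemma lintegral_exp_sum_compensated_le_one (hS : S.IsSample P E) (hE : E.IsRegular KX KC Kμ KS)
    (t : ℕ) {q : ℕ → Fin n → Ω → Fin d → ℝ} {r : ℕ → Fin n → Ω → ℝ}
    (hq : ∀ s < t, ∀ i, Measurable[S.info s] (q s i))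
    (hr : ∀ s < t, ∀ i, Measurable[S.info s] (r s i)) :
    ∫⁻ ω, ENNReal.ofReal (Real.exp (∑ s ∈ Finset.range t, ∑ i,
        E.compensated (q s i ω) (r s i ω) (S.e s i ω) (S.η s i ω))) ∂P ≤ 1 := by
  induction t with
  | zero => simp
  | succ t ih =>
    refine le_trans ?_ (ih (fun s hs => hq s (by omega)) (fun s hs => hr s (by omega)))
    have key : Measurable[S.info t] fun ω => ENNReal.ofReal (Real.exp (∑ s ∈ Finset.range t, ∑ i,
        E.compensated (q s i ω) (r s i ω) (S.e s i ω) (S.η s i ω))) := by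
      refine (Finset.measurable_sum _ fun s hs => Finset.measurable_sum _ fun i _ =>
        ?_).exp.ennreal_ofReal
      rw [Finset.mem_range] at hs
      exact Env.measurable_compensated ((hq s (by omega) i).mono (S.info_mono hs.le) le_rfl)
        ((hr s (by omega) i).mono (S.info_mono hs.le) le_rfl)
        (Primitives.measurable_e_info hs i) (Primitives.measurable_eta_info hs i)
    refine le_trans (le_of_eq ?_) (lintegral_mul_prod_exp_compensated_le hS hE t key
      (fun i => hq t (by omega) i) (fun i => hr t (by omega) i) Finset.univ)
    refine lintegral_congr fun ω => ?_
    rw [Finset.sum_range_succ, Real.exp_add, ENNReal.ofReal_mul (Real.exp_nonneg _),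
      Real.exp_sum Finset.univ, ENNReal.ofReal_prod_of_nonneg fun _ _ => Real.exp_nonneg _]

end

/-! ### Uniform deviation bounds by discretization -/

section

/-- Rounding of a real number towards zero to a multiple of `1 / K`. -/
lemma exists_int_round (K : ℕ) (hK : 0 < K) (p : ℝ) (hp : |p| ≤ 1) :
    ∃ k : ℤ, k ∈ Finset.Icc (-(K : ℤ)) K ∧ |(k : ℝ) / K| ≤ |p| ∧ |p - k / K| ≤ 1 / K := by
  have hK' : (0 : ℝ) < K := by exact_mod_cast hK
  obtain ⟨h1, h2⟩ := abs_le.1 hp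
  rcases le_total 0 p with h0 | h0
  · have a1 := Int.floor_le (K * p)
    have a2 := Int.lt_floor_add_one (K * p)
    have a3 : 0 ≤ ⌊K * p⌋ := Int.floor_nonneg.2 (by positivity)
    have a3' : (0 : ℝ) ≤ ⌊K * p⌋ := by exact_mod_cast a3
    have a4 : (⌊K * p⌋ : ℝ) / K ≤ p := by rw [div_le_iff₀ hK']; linarith
    refine ⟨⌊K * p⌋, ?_, ?_, ?_⟩
    · rw [Finset.mem_Icc]
      refine ⟨by omega, ?_⟩
      have : (⌊K * p⌋ : ℝ) ≤ (K : ℤ) := by push_cast; nlinarith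
      exact_mod_cast this
    · rw [abs_of_nonneg (by positivity), abs_of_nonneg h0]
      exact a4
    · rw [abs_of_nonneg (by linarith), sub_le_iff_le_add, ← add_div, le_div_iff₀ hK']
      linarith
  · have a1 := Int.le_ceil (K * p)
    have a2 := Int.ceil_lt_add_one (K * p)
    have a3' : (⌈K * p⌉ : ℝ) ≤ 0 := by
      have : ⌈K * p⌉ ≤ 0 := Int.ceil_le.2 (by push_cast; nlinarith)
      exact_mod_cast this
    have a4 : p ≤ (⌈K * p⌉ : ℝ) / K := by rw [le_div_iff₀ hK']; linarith
    refine ⟨⌈K * p⌉, ?_, ?_, ?_⟩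
    · rw [Finset.mem_Icc]
      refine ⟨?_, ?_⟩
      · have : ((-(K : ℤ) : ℤ) : ℝ) ≤ ⌈K * p⌉ := by push_cast; nlinarith
        exact_mod_cast this
      · have : (⌈K * p⌉ : ℝ) ≤ ((K : ℤ) : ℝ) := by push_cast; linarith
        exact_mod_cast this
    · rw [abs_of_nonpos (div_nonpos_of_nonpos_of_nonneg a3' hK'.le), abs_of_nonpos h0]
      linarith
    · rw [abs_of_nonpos (by linarith), neg_sub, sub_le_iff_le_add, div_le_iff₀ hK', add_mul,
        one_div_mul_cancel hK'.ne']
      linarith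

/-- A family of random variables with exponential moment at most one, indexed by a solid subset of
the unit box and almost Lipschitz in its index, is uniformly bounded by a random variable whose mean
is the logarithm of the size of a grid, up to the Lipschitz error. -/
lemma exists_integrable_bound {ι Ω : Type*} [Fintype ι] [MeasurableSpace Ω] {P : Measure Ω}
    [IsProbabilityMeasure P] {Θ : Set (ι → ℝ)} (hbox : ∀ p ∈ Θ, ∀ j, |p j| ≤ 1)
    (hsolid : ∀ p ∈ Θ, ∀ p', (∀ j, |p' j| ≤ |p j|) → p' ∈ Θ) {f : (ι → ℝ) → Ω → ℝ}
    (hf : ∀ p ∈ Θ, Measurable (f p))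
    (hexp : ∀ p ∈ Θ, ∫⁻ ω, ENNReal.ofReal (Real.exp (f p ω)) ∂P ≤ 1) {K : ℕ} (hK : 0 < K)
    {H : Ω → ℝ} (hH : Integrable H P)
    (hLip : ∀ᵐ ω ∂P, ∀ p ∈ Θ, ∀ p' ∈ Θ, (∀ j, |p j - p' j| ≤ 1 / K) → f p ω ≤ f p' ω + H ω) :
    ∃ G : Ω → ℝ, Integrable G P ∧
      ∫ ω, G ω ∂P ≤ 1 + Fintype.card ι * Real.log (2 * K + 1) + ∫ ω, H ω ∂P ∧
      ∀ᵐ ω ∂P, ∀ p ∈ Θ, f p ω ≤ G ω := by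
  classical
  let v : (ι → ℤ) → ι → ℝ := fun k j => (k j : ℝ) / K
  let Γ : Finset (ι → ℤ) := (Fintype.piFinset fun _ => Finset.Icc (-(K : ℤ)) K).filter
    fun k => v k ∈ Θ
  -- N bounds the number of grid points in the whole box; only those that lie in Θ are used.
  let N : ℝ := (2 * K + 1) ^ Fintype.card ι
  have hN : 0 < N := by positivity
  have hΓ : (Γ.card : ℝ) ≤ N := by
    have h1 : Γ.card ≤ (2 * K + 1) ^ Fintype.card ι := by
      refine (Finset.card_filter_le _ _).trans (le_of_eq ?_)
      rw [Fintype.card_piFinset, Finset.prod_const, Int.card_Icc, Finset.card_univ]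
      congr 1
      omega
    have h2 : (Γ.card : ℝ) ≤ ((2 * K + 1) ^ Fintype.card ι : ℕ) := by exact_mod_cast h1
    simpa [N] using h2
  have hmem : ∀ k ∈ Γ, v k ∈ Θ := fun k hk => (Finset.mem_filter.1 hk).2
  have hint : ∀ k ∈ Γ, Integrable (fun ω => Real.exp (f (v k) ω)) P := fun k hk => by
    refine ⟨(hf _ (hmem k hk)).exp.aestronglyMeasurable, ?_⟩
    rw [hasFiniteIntegral_iff_ofReal (Filter.Eventually.of_forall fun ω => Real.exp_nonneg _)]
    exact (hexp _ (hmem k hk)).trans_lt ENNReal.one_lt_top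
  have hint1 : ∀ k ∈ Γ, ∫ ω, Real.exp (f (v k) ω) ∂P ≤ 1 := fun k hk => by
    rw [integral_eq_lintegral_of_nonneg_ae (Filter.Eventually.of_forall fun ω => Real.exp_nonneg _)
      (hint k hk).1]
    exact ENNReal.toReal_le_of_le_ofReal zero_le_one (by simpa using hexp _ (hmem k hk))
  have hsum : Integrable (fun ω => N⁻¹ * ∑ k ∈ Γ, Real.exp (f (v k) ω)) P :=
    (integrable_finsetSum _ hint).const_mul _
  have hsum' : Integrable (fun ω => N⁻¹ * ∑ k ∈ Γ, Real.exp (f (v k) ω) + Real.log N) P :=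
    hsum.add (integrable_const _)
  -- A linear surrogate for log ∑ exp: since y ≤ exp(y - log N) + log N, this bounds every grid
  -- value, and its mean is at most 1 + log N plus the Lipschitz error.
  refine ⟨fun ω => N⁻¹ * ∑ k ∈ Γ, Real.exp (f (v k) ω) + Real.log N + H ω, hsum'.add hH, ?_, ?_⟩
  · rw [integral_add hsum' hH, integral_add hsum (integrable_const _),
      integral_const_mul, integral_finsetSum _ hint]
    have h1 : ∑ k ∈ Γ, ∫ ω, Real.exp (f (v k) ω) ∂P ≤ N :=
      (Finset.sum_le_card_nsmul _ _ _ hint1).trans (by simpa using hΓ)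
    have h2 : N⁻¹ * ∑ k ∈ Γ, ∫ ω, Real.exp (f (v k) ω) ∂P ≤ 1 := by
      rw [inv_mul_le_iff₀ hN]
      linarith
    have h3 : Real.log N = Fintype.card ι * Real.log (2 * K + 1) := Real.log_pow _ _
    simp only [integral_const, probReal_univ, one_smul]
    linarith
  · filter_upwards [hLip] with ω hω p hp
    choose k hk1 hk2 hk3 using fun j => exists_int_round K hK (p j) (hbox p hp j)
    -- Rounding is towards zero, so the grid point is coordinatewise smaller in absolute value and
    -- stays in the solid set.
    have hv : v k ∈ Θ := hsolid p hp _ hk2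
    have hkΓ : k ∈ Γ := Finset.mem_filter.2 ⟨Fintype.mem_piFinset.2 hk1, hv⟩
    have h1 := hω p hp (v k) hv hk3
    have h2 : Real.exp (f (v k) ω) ≤ ∑ k ∈ Γ, Real.exp (f (v k) ω) :=
      Finset.single_le_sum (f := fun k => Real.exp (f (v k) ω)) (fun _ _ => Real.exp_nonneg _) hkΓ
    have h3 := Real.add_one_le_exp (f (v k) ω - Real.log N)
    rw [Real.exp_sub, Real.exp_log hN, div_eq_inv_mul] at h3
    have h4 := mul_le_mul_of_nonneg_left h2 (inv_nonneg.2 hN.le)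
    linarith

/-! ### Quadratic and bilinear processes over a grid -/

section Discretization

variable {ι κ Ω : Type*} [Fintype ι] [MeasurableSpace Ω] {P : Measure Ω} [IsProbabilityMeasure P]

lemma abs_dot_le {p z : ι → ℝ} {a : ℝ} (hp : ∀ j, |p j| ≤ a) : |p ⬝ᵥ z| ≤ a * ∑ j, |z j| := by
  unfold dotProduct
  rw [Finset.mul_sum]
  refine (Finset.abs_sum_le_sum_abs _ _).trans (Finset.sum_le_sum fun j _ => ?_)
  rw [abs_mul]
  exact mul_le_mul_of_nonneg_right (hp j) (abs_nonneg _)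

lemma sum_abs_le {z : ι → ℝ} {b : ℝ} (hz : ∀ j, |z j| ≤ b) : ∑ j, |z j| ≤ Fintype.card ι * b := by
  simpa using Finset.sum_le_card_nsmul Finset.univ _ b fun j _ => hz j

lemma abs_dot_sub_dot_le {p p' z : ι → ℝ} {δ : ℝ} (hp : ∀ j, |p j - p' j| ≤ δ) :
    |p ⬝ᵥ z - p' ⬝ᵥ z| ≤ δ * ∑ j, |z j| := by
  rw [← sub_dotProduct]
  exact abs_dot_le hp

lemma abs_dot_self_sub_le {p p' : ι → ℝ} {δ : ℝ} (hδ : 0 ≤ δ) (h : ∀ j, |p j| ≤ 1)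
    (h' : ∀ j, |p' j| ≤ 1) (hp : ∀ j, |p j - p' j| ≤ δ) :
    |p ⬝ᵥ p - p' ⬝ᵥ p'| ≤ δ * (2 * Fintype.card ι) := by
  have e : p ⬝ᵥ p - p' ⬝ᵥ p' = (p - p') ⬝ᵥ (p + p') := by
    rw [sub_dotProduct, dotProduct_add, dotProduct_add, dotProduct_comm p' p]
    ring
  rw [e]
  refine (abs_dot_le hp).trans (mul_le_mul_of_nonneg_left ?_ hδ)
  have := sum_abs_le (z := p + p') (b := 2) fun j => (abs_add_le _ _).trans (by linarith [h j, h' j])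
  linarith

lemma abs_le_one_of_dot_self_le {p : ι → ℝ} (h : p ⬝ᵥ p ≤ 1) (j : ι) : |p j| ≤ 1 := by
  have h2 : p j * p j ≤ p ⬝ᵥ p :=
    Finset.single_le_sum (f := fun i => p i * p i) (fun i _ => mul_self_nonneg _) (Finset.mem_univ j)
  exact abs_le_one_iff_mul_self_le_one.2 (by linarith)

/-- Uniform version, over the unit ball, of an exponential bound for `∑ (c |p|² - θ (p·z)²)`. -/
lemma exists_gram_bound {z : κ → Ω → ι → ℝ} {J : Finset κ} (hz : ∀ k ∈ J, Measurable (z k))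
    {c θ b : ℝ} (hc : 0 ≤ c) (hθ : 0 ≤ θ) (hb : 0 ≤ b)
    (hzb : ∀ᵐ ω ∂P, ∀ k ∈ J, ∀ j, |z k ω j| ≤ b)
    (hexp : ∀ p : ι → ℝ, p ⬝ᵥ p ≤ 1 → ∫⁻ ω, ENNReal.ofReal (Real.exp
      (∑ k ∈ J, (c * (p ⬝ᵥ p) - θ * (p ⬝ᵥ z k ω) ^ 2))) ∂P ≤ 1)
    {K : ℕ} (hK : 0 < K) :
    ∃ G : Ω → ℝ, Integrable G P ∧
      ∫ ω, G ω ∂P ≤ 1 + Fintype.card ι * Real.log (2 * K + 1) +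
        J.card * (2 * c * Fintype.card ι + 2 * θ * (Fintype.card ι * b) ^ 2) / K ∧
      ∀ᵐ ω ∂P, ∀ p : ι → ℝ, p ⬝ᵥ p ≤ 1 →
        ∑ k ∈ J, (c * (p ⬝ᵥ p) - θ * (p ⬝ᵥ z k ω) ^ 2) ≤ G ω := by
  set D : ℝ := (Fintype.card ι : ℝ) with hD
  have hD0 : 0 ≤ D := Nat.cast_nonneg _
  have hK' : (0 : ℝ) < K := by exact_mod_cast hK
  have hδ : (0 : ℝ) ≤ 1 / K := by positivity
  obtain ⟨G, hG1, hG2, hG3⟩ := exists_integrable_bound (P := P) (Θ := {p : ι → ℝ | p ⬝ᵥ p ≤ 1})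
    (f := fun p ω => ∑ k ∈ J, (c * (p ⬝ᵥ p) - θ * (p ⬝ᵥ z k ω) ^ 2)) (K := K)
    (H := fun _ => J.card * (2 * c * D + 2 * θ * (D * b) ^ 2) / K)
    (fun p hp j => abs_le_one_of_dot_self_le hp j)
    (fun p hp p' h => by
      have hp1 : p ⬝ᵥ p ≤ 1 := hp
      change p' ⬝ᵥ p' ≤ 1
      refine le_trans (Finset.sum_le_sum fun j _ => ?_) hp1
      rw [← abs_mul_abs_self, ← abs_mul_abs_self (p j)]
      exact mul_self_le_mul_self (abs_nonneg _) (h j))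
    (fun p _ => Finset.measurable_sum _ fun k hk =>
      (((measurable_dot measurable_const (hz k hk)).pow_const 2).const_mul θ).const_sub _)
    hexp hK (integrable_const _) (by
      filter_upwards [hzb] with ω hω p hp p' hp' hpp
      have hterm : ∀ k ∈ J, c * (p ⬝ᵥ p) - θ * (p ⬝ᵥ z k ω) ^ 2 ≤
          (c * (p' ⬝ᵥ p') - θ * (p' ⬝ᵥ z k ω) ^ 2) + (2 * c * D + 2 * θ * (D * b) ^ 2) / K := by
        intro k hk
        have hz1 := sum_abs_le (hω k hk)
        have hp1 := fun j => abs_le_one_of_dot_self_le hp j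
        have hp2 := fun j => abs_le_one_of_dot_self_le hp' j
        have a1 := abs_le.1 (abs_dot_self_sub_le hδ hp1 hp2 hpp)
        have a2 := (abs_dot_sub_dot_le (z := z k ω) hpp).trans (mul_le_mul_of_nonneg_left hz1 hδ)
        have a3 := (abs_dot_le (z := z k ω) hp1).trans (mul_le_mul_of_nonneg_left hz1 zero_le_one)
        have a4 := (abs_dot_le (z := z k ω) hp2).trans (mul_le_mul_of_nonneg_left hz1 zero_le_one)
        rw [← hD] at a1 a2 a3 a4
        have a5 : (p' ⬝ᵥ z k ω) ^ 2 - (p ⬝ᵥ z k ω) ^ 2 ≤ 1 / K * (2 * (D * b) ^ 2) := by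
          have e : (p' ⬝ᵥ z k ω) ^ 2 - (p ⬝ᵥ z k ω) ^ 2 =
            -(p ⬝ᵥ z k ω - p' ⬝ᵥ z k ω) * (p ⬝ᵥ z k ω + p' ⬝ᵥ z k ω) := by ring
          rw [e]
          refine (le_abs_self _).trans ?_
          rw [abs_mul, abs_neg]
          refine (mul_le_mul a2 ((abs_add_le _ _).trans (add_le_add a3 a4)) (abs_nonneg _)
            (by positivity)).trans (le_of_eq (by ring))
        have a6 := mul_le_mul_of_nonneg_left a1.2 hc
        have a7 := mul_le_mul_of_nonneg_left a5 hθ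
        have e : (2 * c * D + 2 * θ * (D * b) ^ 2) / K =
          c * (1 / K * (2 * D)) + θ * (1 / K * (2 * (D * b) ^ 2)) := by ring
        rw [e]
        linarith
      refine (Finset.sum_le_sum hterm).trans (le_of_eq ?_)
      rw [Finset.sum_add_distrib, Finset.sum_const, nsmul_eq_mul]
      ring)
  refine ⟨G, hG1, by simpa using hG2, hG3⟩

variable {ι' : Type*} [Fintype ι']

/-- Uniform version, over the unit box, of an exponential bound for the compensated bilinear
noise `∑ ((v·ξ)(p·z) - τ/2 |v|² (p·z)²)`. -/
lemma exists_noise_bound {z : κ → Ω → ι → ℝ} {ξ : κ → Ω → ι' → ℝ} {J : Finset κ}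
    (hz : ∀ k ∈ J, Measurable (z k)) (hξ : ∀ k ∈ J, Measurable (ξ k)) {τ b s D : ℝ} (hτ : 0 ≤ τ) (hb : 0 ≤ b)
    (hD : Fintype.card ι ≤ D) (hD' : Fintype.card ι' ≤ D)
    (hzb : ∀ᵐ ω ∂P, ∀ k ∈ J, ∀ j, |z k ω j| ≤ b)
    (hint : ∀ k ∈ J, ∀ j, Integrable (fun ω => ξ k ω j) P)
    (hs : ∀ k ∈ J, ∀ j, ∫ ω, |ξ k ω j| ∂P ≤ s)
    (hexp : ∀ (v : ι' → ℝ) (p : ι → ℝ), ∫⁻ ω, ENNReal.ofReal (Real.exp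
      (∑ k ∈ J, ((v ⬝ᵥ ξ k ω) * (p ⬝ᵥ z k ω) - τ / 2 * ((v ⬝ᵥ v) * (p ⬝ᵥ z k ω) ^ 2)))) ∂P ≤ 1)
    {K : ℕ} (hK : 0 < K) :
    ∃ G : Ω → ℝ, Integrable G P ∧
      ∫ ω, G ω ∂P ≤ 1 + (Fintype.card ι' + Fintype.card ι) * Real.log (2 * K + 1) +
        J.card * (2 * D * b * (Fintype.card ι' * s) + 2 * τ * D ^ 3 * b ^ 2) / K ∧
      ∀ᵐ ω ∂P, ∀ (v : ι' → ℝ) (p : ι → ℝ), (∀ j, |v j| ≤ 1) → (∀ j, |p j| ≤ 1) →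
        ∑ k ∈ J, ((v ⬝ᵥ ξ k ω) * (p ⬝ᵥ z k ω) - τ / 2 * ((v ⬝ᵥ v) * (p ⬝ᵥ z k ω) ^ 2)) ≤ G ω := by
  have hD0 : 0 ≤ D := (Nat.cast_nonneg _).trans hD
  have hK' : (0 : ℝ) < K := by exact_mod_cast hK
  have hδ : (0 : ℝ) ≤ 1 / K := by positivity
  -- The noises are unbounded, so here the Lipschitz error is random; only its mean enters the final
  -- estimate.
  have hHint : ∀ k ∈ J, Integrable (fun ω =>
      (2 * D * b * (∑ j, |ξ k ω j|) + 2 * τ * D ^ 3 * b ^ 2) / K) P :=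
    fun k hk => (((integrable_finsetSum _ fun j _ =>
      (hint k hk j).abs).const_mul _).add (integrable_const _)).div_const _
  have hlip : ∀ᵐ ω ∂P, ∀ p ∈ {p : ι' ⊕ ι → ℝ | ∀ j, |p j| ≤ 1},
      ∀ p' ∈ {p : ι' ⊕ ι → ℝ | ∀ j, |p j| ≤ 1}, (∀ j, |p j - p' j| ≤ 1 / (K : ℝ)) →
      ∑ k ∈ J, (((fun j => p (.inl j)) ⬝ᵥ ξ k ω) * ((fun j => p (.inr j)) ⬝ᵥ z k ω) -
        τ / 2 * (((fun j => p (.inl j)) ⬝ᵥ (fun j => p (.inl j))) *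
          ((fun j => p (.inr j)) ⬝ᵥ z k ω) ^ 2)) ≤
      ∑ k ∈ J, (((fun j => p' (.inl j)) ⬝ᵥ ξ k ω) * ((fun j => p' (.inr j)) ⬝ᵥ z k ω) -
        τ / 2 * (((fun j => p' (.inl j)) ⬝ᵥ (fun j => p' (.inl j))) *
          ((fun j => p' (.inr j)) ⬝ᵥ z k ω) ^ 2)) +
      ∑ k ∈ J, (2 * D * b * (∑ j, |ξ k ω j|) + 2 * τ * D ^ 3 * b ^ 2) / K := by
    filter_upwards [hzb] with ω hω p hp p' hp' hpp
    rw [← Finset.sum_add_distrib]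
    refine Finset.sum_le_sum fun k hk => ?_
    have hz1 := (sum_abs_le (hω k hk)).trans (mul_le_mul_of_nonneg_right hD hb)
    set v : ι' → ℝ := fun j => p (.inl j) with hv
    set v' : ι' → ℝ := fun j => p' (.inl j)
    set l : ι → ℝ := fun j => p (.inr j) with hl
    set l' : ι → ℝ := fun j => p' (.inr j)
    have hv1 : ∀ j, |v j| ≤ 1 := fun j => hp _
    have hv1' : ∀ j, |v' j| ≤ 1 := fun j => hp' _
    have hl1 : ∀ j, |l j| ≤ 1 := fun j => hp _
    have hl1' : ∀ j, |l' j| ≤ 1 := fun j => hp' _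
    have hvv : ∀ j, |v j - v' j| ≤ 1 / K := fun j => hpp _
    have hll : ∀ j, |l j - l' j| ≤ 1 / K := fun j => hpp _
    have b1 := abs_dot_sub_dot_le (z := ξ k ω) hvv
    have b2 := (abs_dot_le (z := ξ k ω) hv1')
    have b3 := (abs_dot_sub_dot_le (z := z k ω) hll).trans (mul_le_mul_of_nonneg_left hz1 hδ)
    have b4 := (abs_dot_le (z := z k ω) hl1).trans (mul_le_mul_of_nonneg_left hz1 zero_le_one)
    have b5 := (abs_dot_le (z := z k ω) hl1').trans (mul_le_mul_of_nonneg_left hz1 zero_le_one)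
    have b6 := (abs_dot_self_sub_le hδ hv1 hv1' hvv).trans
      (mul_le_mul_of_nonneg_left (mul_le_mul_of_nonneg_left hD' zero_le_two) hδ)
    have b7 : v ⬝ᵥ v ≤ D := by
      refine (le_abs_self _).trans ((abs_dot_le hv1).trans ?_)
      have := sum_abs_le hv1
      linarith
    have b8 := dot_self_nonneg v
    have hE : 0 ≤ ∑ j, |ξ k ω j| := Finset.sum_nonneg fun _ _ => abs_nonneg _
    set e := ∑ j, |ξ k ω j|
    set x := v ⬝ᵥ ξ k ω
    set x' := v' ⬝ᵥ ξ k ω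
    set y := l ⬝ᵥ z k ω
    set y' := l' ⬝ᵥ z k ω
    set V := v ⬝ᵥ v
    set V' := v' ⬝ᵥ v'
    rw [one_mul] at b2 b4 b5
    have c1 : x * y - x' * y' ≤ 1 / K * (2 * D * b * e) := by
      have h : x * y - x' * y' = (x - x') * y + x' * (y - y') := by ring
      rw [h]
      have h1 : (x - x') * y ≤ 1 / K * e * (D * b) := by
        refine (le_abs_self _).trans ?_
        rw [abs_mul]
        exact mul_le_mul b1 b4 (abs_nonneg _) (by positivity)
      have h2 : x' * (y - y') ≤ e * (1 / K * (D * b)) := by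
        refine (le_abs_self _).trans ?_
        rw [abs_mul]
        exact mul_le_mul b2 b3 (abs_nonneg _) (by positivity)
      linarith
    have c2 : V' * y' ^ 2 - V * y ^ 2 ≤ 1 / K * (4 * D ^ 3 * b ^ 2) := by
      have h : V' * y' ^ 2 - V * y ^ 2 = -(V - V') * (y' * y') + V * (-(y - y') * (y + y')) := by ring
      rw [h]
      have h1 : -(V - V') * (y' * y') ≤ 1 / K * (2 * D) * ((D * b) * (D * b)) := by
        refine (le_abs_self _).trans ?_
        rw [abs_mul, abs_neg, abs_mul y']
        exact mul_le_mul b6 (mul_le_mul b5 b5 (abs_nonneg _) (by positivity)) (by positivity)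
          (by positivity)
      have h2 : V * (-(y - y') * (y + y')) ≤ D * (1 / K * (D * b) * (D * b + D * b)) := by
        refine (le_abs_self _).trans ?_
        rw [abs_mul, abs_mul, abs_neg, abs_of_nonneg b8]
        exact mul_le_mul b7 (mul_le_mul b3 ((abs_add_le _ _).trans (add_le_add b4 b5)) (abs_nonneg _)
          (by positivity)) (by positivity) hD0
      linarith
    have c3 := mul_le_mul_of_nonneg_left c2 (by positivity : 0 ≤ τ / 2)
    have c4 : (2 * D * b * e + 2 * τ * D ^ 3 * b ^ 2) / K =
      1 / K * (2 * D * b * e) + τ / 2 * (1 / K * (4 * D ^ 3 * b ^ 2)) := by ring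
    rw [c4]
    linarith
  -- The direction v of the noise and the direction p of the regressor are discretized jointly, as
  -- one point of a box indexed by the sum type.
  obtain ⟨G, hG1, hG2, hG3⟩ := exists_integrable_bound (P := P)
    (Θ := {p : ι' ⊕ ι → ℝ | ∀ j, |p j| ≤ 1})
    (f := fun p ω => ∑ k ∈ J, (((fun j => p (.inl j)) ⬝ᵥ ξ k ω) * ((fun j => p (.inr j)) ⬝ᵥ z k ω) -
      τ / 2 * (((fun j => p (.inl j)) ⬝ᵥ (fun j => p (.inl j))) *
        ((fun j => p (.inr j)) ⬝ᵥ z k ω) ^ 2))) (K := K)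
    (fun p hp j => hp j) (fun p hp p' h j => (h j).trans (hp j))
    (fun p _ => Finset.measurable_sum _ fun k hk =>
      ((measurable_dot measurable_const (hξ k hk)).mul
        (measurable_dot measurable_const (hz k hk))).sub
      ((((measurable_dot measurable_const (hz k hk)).pow_const 2).const_mul _).const_mul _))
    (fun p _ => hexp _ _) hK (integrable_finsetSum _ hHint) hlip
  refine ⟨G, hG1, hG2.trans ?_, ?_⟩
  · rw [Fintype.card_sum, Nat.cast_add]
    refine add_le_add le_rfl ?_
    rw [integral_finsetSum _ hHint]
    have h1 : ∀ k ∈ J, ∫ ω, (2 * D * b * (∑ j, |ξ k ω j|) + 2 * τ * D ^ 3 * b ^ 2) / K ∂P ≤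
        (2 * D * b * (Fintype.card ι' * s) + 2 * τ * D ^ 3 * b ^ 2) / K := by
      intro k hk
      rw [integral_div, integral_add ((integrable_finsetSum _ fun j _ =>
        (hint k hk j).abs).const_mul _) (integrable_const _), integral_const_mul,
        integral_finsetSum _ fun j _ => (hint k hk j).abs]
      have h2 : ∑ j, ∫ ω, |ξ k ω j| ∂P ≤ Fintype.card ι' * s := by
        simpa using Finset.sum_le_card_nsmul Finset.univ _ s fun j _ => hs k hk j
      simp only [integral_const, probReal_univ, one_smul]
      gcongr
    refine (Finset.sum_le_card_nsmul _ _ _ h1).trans (le_of_eq ?_)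
    rw [nsmul_eq_mul]
    ring
  · filter_upwards [hG3] with ω hω v p hv hp
    exact hω (Sum.elim v p) (by rintro (j | j); exacts [hv j, hp j])

end Discretization

end

/-! ### Second moments of the exploratory regressors -/

section

variable {m d n : ℕ} {Ω : Type*} [mΩ : MeasurableSpace Ω] {S : Primitives m d n Ω} {P : Measure Ω}
  {E : Env m d} {KX KC Kμ KS : ℝ}

lemma dot_sq_le {ι : Type*} [Fintype ι] (a b : ι → ℝ) : (a ⬝ᵥ b) ^ 2 ≤ (a ⬝ᵥ a) * (b ⬝ᵥ b) := by
  have := Finset.sum_mul_sq_le_sq_mul_sq Finset.univ a b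
  simpa [dotProduct, sq] using this

lemma dot_add_dot_sq_le {ι κ : Type*} [Fintype ι] [Fintype κ] (a x : ι → ℝ) (b w : κ → ℝ) :
    (a ⬝ᵥ x + b ⬝ᵥ w) ^ 2 ≤ (a ⬝ᵥ a + b ⬝ᵥ b) * (x ⬝ᵥ x + w ⬝ᵥ w) := by
  have := dot_sq_le (Sum.elim a b) (Sum.elim x w)
  simpa only [sumElim_dotProduct_sumElim] using this

/-- Linearizes the exponential of a bounded variable, so that a lower bound on its mean yields an
exponential moment bound. -/
lemma exp_neg_le_one_sub_half {t : ℝ} (h0 : 0 ≤ t) (h1 : t ≤ 1) : Real.exp (-t) ≤ 1 - t / 2 := by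
  rw [Real.exp_neg, inv_le_comm₀ (Real.exp_pos _) (by linarith)]
  refine le_trans ?_ (Real.add_one_le_exp t)
  rw [inv_le_iff_one_le_mul₀ (by linarith)]
  nlinarith

lemma ae_mem (hS : S.IsSample P E) (hE : E.IsRegular KX KC Kμ KS) :
    ∀ᵐ ω ∂P, ∀ t i, S.x t i ω ∈ E.X ∧ S.u t i ω ∈ E.W := by
  have := hE.prob
  have := hE.isProbabilityMeasure_unif
  rw [ae_all_iff]
  intro t
  rw [ae_all_iff]
  intro i
  have hm := (hS.measurable_x t i).prodMk (hS.measurable_u t i)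
  have h1 : ∀ᵐ z ∂(E.Dx.prod E.unif), z.1 ∈ E.X :=
    (Measure.quasiMeasurePreserving_fst (μ := E.Dx) (ν := E.unif)).ae hE.ae_mem
  have h2 : ∀ᵐ z ∂(E.Dx.prod E.unif), z.2 ∈ E.W :=
    (Measure.quasiMeasurePreserving_snd (μ := E.Dx) (ν := E.unif)).ae
      (ae_cond_mem hE.measurableSet_action)
  have h3 := h1.and h2
  rw [← hS.map_xu hE t i] at h3
  exact ae_of_ae_map hm.aemeasurable h3

lemma feature_sq_le (hE : E.IsRegular KX KC Kμ KS) {x : Fin m → ℝ} (hx : x ∈ E.X) :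
    x ⬝ᵥ x ≤ KX ^ 2 := Env.dot_self_le_of_l2norm_le (hE.norm_feature x hx)

lemma action_sq_le (hE : E.IsRegular KX KC Kμ KS) {w : Fin d → ℝ} (hw : w ∈ E.W) :
    w ⬝ᵥ w ≤ 1 := by simpa using Env.dot_self_le_of_l2norm_le (hE.norm_action w hw)

/-- The crude bound r² + 1 ≥ |r| avoids any sign condition on r and is the constant used for all
regressors. -/
lemma abs_le_of_dot_self_le {ι : Type*} [Fintype ι] {p : ι → ℝ} {r : ℝ} (h : p ⬝ᵥ p ≤ r ^ 2)
    (j : ι) : |p j| ≤ r ^ 2 + 1 := by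
  have h2 : p j * p j ≤ p ⬝ᵥ p :=
    Finset.single_le_sum (f := fun i => p i * p i) (fun i _ => mul_self_nonneg _) (Finset.mem_univ j)
  rw [abs_le]
  constructor <;> nlinarith [sq_nonneg (p j - 1), sq_nonneg (p j + 1)]

/-- The factor θ = 1/(KX² + 1) puts θ (p·z)² into [0, 1], where exp(-t) ≤ 1 - t/2. Each factor is
then at most exp(c - θ E(p·z)²/2) ≤ 1 by the eigenvalue assumption, and independence multiplies the
factors. -/
lemma lintegral_exp_gram_le_one [IsProbabilityMeasure P] (hS : S.IsSample P E)
    (hE : E.IsRegular KX KC Kμ KS) (J : Finset (ℕ × Fin n)) (a : Fin m → ℝ) (b : Fin d → ℝ) (hab : a ⬝ᵥ a + b ⬝ᵥ b ≤ 1) :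
    ∫⁻ ω, ENNReal.ofReal (Real.exp (∑ k ∈ J, (KS / (m + d) / (2 * (KX ^ 2 + 1)) *
      (a ⬝ᵥ a + b ⬝ᵥ b) - 1 / (KX ^ 2 + 1) *
        (a ⬝ᵥ S.x k.1 k.2 ω + b ⬝ᵥ S.u k.1 k.2 ω) ^ 2))) ∂P ≤ 1 := by
  have hB : 0 < KX ^ 2 + 1 := by positivity
  set θ := 1 / (KX ^ 2 + 1) with hθ
  have hθ0 : 0 < θ := by positivity
  set c := KS / (m + d) / (2 * (KX ^ 2 + 1)) * (a ⬝ᵥ a + b ⬝ᵥ b) with hc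
  let g : (Fin m → ℝ) × (Fin d → ℝ) → ℝ := fun z => (a ⬝ᵥ z.1 + b ⬝ᵥ z.2) ^ 2
  have hg : Measurable g := ((measurable_dot measurable_const measurable_fst).add
    (measurable_dot measurable_const measurable_snd)).pow_const 2
  have hxu : ∀ k : ℕ × Fin n, Measurable fun ω => (S.x k.1 k.2 ω, S.u k.1 k.2 ω) := fun k =>
    (hS.measurable_x k.1 k.2).prodMk (hS.measurable_u k.1 k.2)
  have hgm : ∀ k : ℕ × Fin n, Measurable fun ω => g (S.x k.1 k.2 ω, S.u k.1 k.2 ω) := fun k =>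
    hg.comp (hxu k)
  have hind : iIndepFun (fun (k : ℕ × Fin n) ω => ENNReal.ofReal
      (Real.exp (c - θ * g (S.x k.1 k.2 ω, S.u k.1 k.2 ω)))) P :=
    hS.indep.comp (fun _ z => ENNReal.ofReal (Real.exp (c - θ * g (z.1, z.2.1))))
      fun _ => (((hg.comp (by fun_prop : Measurable fun z :
        (Fin m → ℝ) × (Fin d → ℝ) × (Fin d → ℝ) × ℝ => (z.1, z.2.1))).const_mul
          θ).const_sub c).exp.ennreal_ofReal
  have e1 : ∀ ω, ENNReal.ofReal (Real.exp (∑ k ∈ J, (c - θ *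
      (a ⬝ᵥ S.x k.1 k.2 ω + b ⬝ᵥ S.u k.1 k.2 ω) ^ 2))) =
      ∏ k ∈ J, ENNReal.ofReal (Real.exp (c - θ * g (S.x k.1 k.2 ω, S.u k.1 k.2 ω))) := fun ω => by
    rw [Real.exp_sum, ENNReal.ofReal_prod_of_nonneg fun _ _ => Real.exp_nonneg _]
  simp_rw [e1]
  rw [lintegral_prod_eq_prod_lintegral_of_indepFun J _ hind
    fun k => (((hgm k).const_mul θ).const_sub c).exp.ennreal_ofReal]
  refine Finset.prod_le_one' fun k _ => ?_
  have hb : ∀ᵐ ω ∂P, 0 ≤ θ * g (S.x k.1 k.2 ω, S.u k.1 k.2 ω) ∧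
      θ * g (S.x k.1 k.2 ω, S.u k.1 k.2 ω) ≤ 1 := by
    filter_upwards [ae_mem hS hE] with ω hω
    obtain ⟨hx, hu⟩ := hω k.1 k.2
    have h1 := dot_add_dot_sq_le a (S.x k.1 k.2 ω) b (S.u k.1 k.2 ω)
    have h2 := feature_sq_le hE hx
    have h3 := action_sq_le hE hu
    have h4 := dot_self_nonneg (S.x k.1 k.2 ω)
    have h5 := dot_self_nonneg (S.u k.1 k.2 ω)
    refine ⟨mul_nonneg hθ0.le (sq_nonneg _), ?_⟩
    rw [hθ, one_div, inv_mul_le_iff₀ hB, mul_one]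
    refine h1.trans ((mul_le_of_le_one_left (by linarith) hab).trans (by linarith))
  have hgi : Integrable (fun ω => g (S.x k.1 k.2 ω, S.u k.1 k.2 ω)) P := by
    refine Integrable.of_bound (hgm k).aestronglyMeasurable (KX ^ 2 + 1) ?_
    filter_upwards [hb] with ω hω
    rw [Real.norm_of_nonneg (sq_nonneg _)]
    have := hω.2
    rwa [hθ, one_div, inv_mul_le_iff₀ hB, mul_one] at this
  have hmean : KS / (m + d) * (a ⬝ᵥ a + b ⬝ᵥ b) ≤
      ∫ ω, g (S.x k.1 k.2 ω, S.u k.1 k.2 ω) ∂P := by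
    refine (hE.eigenvalue a b).trans (le_of_eq ?_)
    rw [← hS.map_xu hE k.1 k.2, integral_map (hxu k).aemeasurable hg.aestronglyMeasurable]
  have hlin : Integrable (fun ω => 1 - θ * g (S.x k.1 k.2 ω, S.u k.1 k.2 ω) / 2) P :=
    (integrable_const _).sub ((hgi.const_mul θ).div_const 2)
  have h1 : ∫⁻ ω, ENNReal.ofReal (Real.exp (c - θ * g (S.x k.1 k.2 ω, S.u k.1 k.2 ω))) ∂P ≤
      ∫⁻ ω, ENNReal.ofReal (Real.exp c) *
        ENNReal.ofReal (1 - θ * g (S.x k.1 k.2 ω, S.u k.1 k.2 ω) / 2) ∂P := by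
    refine lintegral_mono_ae ?_
    filter_upwards [hb] with ω hω
    rw [← ENNReal.ofReal_mul (Real.exp_nonneg _), sub_eq_add_neg, Real.exp_add]
    exact ENNReal.ofReal_le_ofReal (mul_le_mul_of_nonneg_left
      (exp_neg_le_one_sub_half hω.1 hω.2) (Real.exp_nonneg _))
  refine h1.trans ?_
  rw [lintegral_const_mul _ ((((hgm k).const_mul θ).div_const 2).const_sub 1).ennreal_ofReal,
    ← ofReal_integral_eq_lintegral_ofReal hlin (by
      filter_upwards [hb] with ω hω
      simp only [Pi.zero_apply]
      linarith [hω.2]), ← ENNReal.ofReal_mul (Real.exp_nonneg _), ENNReal.ofReal_le_one,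
    integral_sub (integrable_const _) ((hgi.const_mul θ).div_const 2), integral_div,
    integral_const_mul]
  simp only [integral_const, probReal_univ, one_smul]
  have h2 := Real.add_one_le_exp (-(θ * (∫ ω, g (S.x k.1 k.2 ω, S.u k.1 k.2 ω) ∂P) / 2))
  calc _ ≤ Real.exp c * Real.exp (-(θ * (∫ ω, g (S.x k.1 k.2 ω, S.u k.1 k.2 ω) ∂P) / 2)) :=
        mul_le_mul_of_nonneg_left (by linarith) (Real.exp_nonneg _)
    _ ≤ 1 := by
      rw [← Real.exp_add, Real.exp_le_one_iff]
      have h3 : c = θ * (KS / (m + d) * (a ⬝ᵥ a + b ⬝ᵥ b)) / 2 := by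
        rw [hc, hθ]
        field_simp
      have h4 := mul_le_mul_of_nonneg_left hmean hθ0.le
      rw [h3]
      linarith

/-- Mean absolute value of a centred Gaussian with standard deviation `σ`. -/
def gaussianAbs (σ : ℝ≥0) : ℝ := ∫ x, |x| ∂(gaussianReal 0 (σ ^ 2))

lemma gaussianAbs_nonneg (σ : ℝ≥0) : 0 ≤ gaussianAbs σ := integral_nonneg fun _ => abs_nonneg _

lemma map_e (hS : S.IsSample P E) (hE : E.IsRegular KX KC Kμ KS) (t : ℕ) (i : Fin n) (j : Fin d) :
    P.map (fun ω => S.e t i ω j) = gaussianReal 0 (E.σ ^ 2) := by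
  have h : (fun ω => S.e t i ω j) = (Function.eval j ∘ Prod.fst) ∘
    fun ω => (S.e t i ω, S.η t i ω) := rfl
  rw [h, ← Measure.map_map (by fun_prop)
    ((hS.measurable_e t i).prodMk (hS.measurable_eta t i)), hS.map_noise hE,
    ← Measure.map_map (by fun_prop) (by fun_prop)]
  simp only [Measure.map_fst_prod, measure_univ, one_smul]
  exact (measurePreserving_eval (fun _ : Fin d => gaussianReal 0 (E.σ ^ 2)) j).map_eq

lemma map_eta (hS : S.IsSample P E) (hE : E.IsRegular KX KC Kμ KS) (t : ℕ) (i : Fin n) :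
    P.map (S.η t i) = gaussianReal 0 (E.σ ^ 2) := by
  have h : S.η t i = Prod.snd ∘ fun ω => (S.e t i ω, S.η t i ω) := rfl
  rw [h, ← Measure.map_map (by fun_prop)
    ((hS.measurable_e t i).prodMk (hS.measurable_eta t i)), hS.map_noise hE]
  simp [Env.costNoise]

section GaussianLaw

variable {f : Ω → ℝ} {σ : ℝ≥0}

lemma integrable_of_map_gaussian (hf : Measurable f) (h : P.map f = gaussianReal 0 (σ ^ 2)) :
    Integrable f P := by
  have h1 : Integrable id (P.map f) := by
    rw [h]
    exact (memLp_id_gaussianReal 1).integrable (by simp)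
  exact (integrable_map_measure aestronglyMeasurable_id hf.aemeasurable).1 h1

lemma integral_of_map_gaussian (hf : Measurable f) (h : P.map f = gaussianReal 0 (σ ^ 2)) :
    ∫ ω, f ω ∂P = 0 := by
  have h1 := integral_map (μ := P) hf.aemeasurable (f := fun x : ℝ => x) aestronglyMeasurable_id
  rw [h, integral_id_gaussianReal] at h1
  exact h1.symm

lemma integral_abs_of_map_gaussian (hf : Measurable f) (h : P.map f = gaussianReal 0 (σ ^ 2)) :
    ∫ ω, |f ω| ∂P = gaussianAbs σ := by
  rw [gaussianAbs, ← h, integral_map hf.aemeasurable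
    (continuous_abs.measurable.aestronglyMeasurable)]

end GaussianLaw

end

/-! ### Deviation bounds for a run of the algorithm -/

section

/-- Normalizing p to length one turns a deviation bound on the unit ball into a lower bound for the
Gram form in every direction. -/
lemma gram_homogeneous {ι κ : Type*} [Fintype ι] {J : Finset κ} {z : κ → ι → ℝ} {c θ G : ℝ}
    (hθ : 0 ≤ θ)
    (h : ∀ p : ι → ℝ, p ⬝ᵥ p ≤ 1 → ∑ k ∈ J, (c * (p ⬝ᵥ p) - θ * (p ⬝ᵥ z k) ^ 2) ≤ G) (p : ι → ℝ) :
    (p ⬝ᵥ p) * (c * J.card - G) ≤ θ * ∑ k ∈ J, (p ⬝ᵥ z k) ^ 2 := by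
  rcases (dot_self_nonneg p).eq_or_lt with h0 | h0
  · rw [← h0, zero_mul]
    exact mul_nonneg hθ (Finset.sum_nonneg fun _ _ => sq_nonneg _)
  set r := p ⬝ᵥ p with hr
  have hs : 0 < √r := Real.sqrt_pos.2 h0
  have hss : √r * √r = r := Real.mul_self_sqrt h0.le
  have e1 : ((√r)⁻¹ • p) ⬝ᵥ ((√r)⁻¹ • p) = 1 := by
    rw [smul_dotProduct, dotProduct_smul, ← hr, smul_eq_mul, smul_eq_mul, ← mul_assoc, ← mul_inv,
      hss, inv_mul_cancel₀ h0.ne']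
  have h1 := h _ e1.le
  rw [e1] at h1
  have e2 : ∀ k, (((√r)⁻¹ • p) ⬝ᵥ z k) ^ 2 = r⁻¹ * (p ⬝ᵥ z k) ^ 2 := fun k => by
    rw [smul_dotProduct, smul_eq_mul, mul_pow, inv_pow, Real.sq_sqrt h0.le]
  simp_rw [e2] at h1
  rw [Finset.sum_sub_distrib, Finset.sum_const, nsmul_eq_mul, ← Finset.mul_sum, ← Finset.mul_sum]
    at h1
  have h2 : r * (θ * (r⁻¹ * ∑ k ∈ J, (p ⬝ᵥ z k) ^ 2)) = θ * ∑ k ∈ J, (p ⬝ᵥ z k) ^ 2 := by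
    field_simp
  nlinarith

/-- Resolution of the grids used to discretize the unit balls. -/
def gridSize (m d n T : ℕ) : ℕ := (m + d) ^ 3 * (n * T)

lemma gridSize_pos {m d n T : ℕ} (hm : 1 ≤ m) (hn : 1 ≤ n) (hT : 1 ≤ T) : 0 < gridSize m d n T := by
  unfold gridSize; positivity

/-- The grid size is chosen for this: Lipschitz errors are at most cubic in m + d per observation,
and there are at most nT observations, so the total discretization error is a constant. -/
lemma card_mul_div_gridSize_le {m d n T : ℕ} (hm : 1 ≤ m) (hn : 1 ≤ n) (hT : 1 ≤ T) {c A y : ℝ}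
    (hc0 : 0 ≤ c) (hc : c ≤ n * T) (hA : 0 ≤ A) (hy : y ≤ (m + d : ℝ) ^ 3 * A) :
    c * y / gridSize m d n T ≤ A := by
  have h : (0 : ℝ) < gridSize m d n T := by exact_mod_cast gridSize_pos hm hn hT
  rw [div_le_iff₀ h]
  have e : ((gridSize m d n T : ℕ) : ℝ) = (m + d : ℝ) ^ 3 * (n * T) := by
    unfold gridSize; push_cast; ring
  rw [e]
  have h1 := mul_le_mul_of_nonneg_left hy hc0
  have h2 := mul_le_mul_of_nonneg_right hc (by positivity : 0 ≤ (m + d : ℝ) ^ 3 * A)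
  linarith

lemma measurable_of_coord {α ι : Type*} {mα : MeasurableSpace α} {f : α → ι → ℝ}
    (h : ∀ j, Measurable fun a => f a j) : Measurable f := measurable_pi_iff.2 h

/-- Exploratory draws lie in W only almost surely, so their membership is a pathwise hypothesis.
Initial and exploiting actions lie in W on every path. -/
lemma IsRun.mem_of_mem {m d n : ℕ} {Ω : Type*} {E : Env m d} {S : Primitives m d n Ω}
    {w : ℕ → Fin n → Ω → (Fin d → ℝ)} {b : Fin d → Fin d → ℝ} {γ : ℝ} {T₀ T : ℕ}
    (hrun : IsRun E S w b γ T₀ T) {t : ℕ} (ht : t ≤ T) (i : Fin n) {ω : Ω}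
    (hu : S.u t i ω ∈ E.W) : w t i ω ∈ E.W := by
  rcases Nat.eq_zero_or_pos t with rfl | h0
  · exact hrun.initial i ω
  · by_cases h : t ≤ T₀
    · rw [hrun.explore t h0 h ht i]
      exact hu
    · obtain ⟨F', G', -, h2⟩ := hrun.exploit t (by omega) ht ω
      exact (h2 i).1

variable {m d n : ℕ} {Ω : Type*} [mΩ : MeasurableSpace Ω] {S : Primitives m d n Ω} {P : Measure Ω}
  {E : Env m d} {KX KC Kμ KS : ℝ} {w : ℕ → Fin n → Ω → (Fin d → ℝ)} {b : Fin d → Fin d → ℝ} {γ : ℝ}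
  {T₀ T : ℕ}

lemma ae_action_mem (hS : S.IsSample P E) (hE : E.IsRegular KX KC Kμ KS)
    (hrun : IsRun E S w b γ T₀ T) :
    ∀ᵐ ω ∂P, ∀ t ≤ T, ∀ i, S.x t i ω ∈ E.X ∧ w t i ω ∈ E.W := by
  filter_upwards [ae_mem hS hE] with ω hω t ht i
  exact ⟨(hω t i).1, hrun.mem_of_mem ht i (hω t i).2⟩

lemma IsRun.measurable_action (hrun : IsRun E S w b γ T₀ T) (hS : S.IsSample P E) {t : ℕ}
    (ht : t ≤ T) (i : Fin n) : Measurable (w t i) :=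
  (hrun.adapted t ht i).mono ((S.info_le_others t i).trans (hS.others_le t i)) le_rfl

variable [IsProbabilityMeasure P]

/-- Lower bound for the regression Gram form. The exploration data of all individuals are pooled,
which gives the size n T₀ / (m + d) up to the deviation G. -/
lemma exists_joint_gram_bound (hS : S.IsSample P E) (hE : E.IsRegular KX KC Kμ KS) (hKS : 0 < KS)
    (hm : 1 ≤ m) (hn : 1 ≤ n) (hT : 1 ≤ T) (hT₀ : T₀ ≤ T) :
    ∃ G : Ω → ℝ, Integrable G P ∧
      ∫ ω, G ω ∂P ≤ 1 + (m + d) * Real.log (2 * gridSize m d n T + 1) +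
        (KS + 2 * (KX ^ 2 + 1) ^ 2) ∧
      ∀ᵐ ω ∂P, 0 ≤ G ω ∧ ∀ (a : Fin m → ℝ) (b : Fin d → ℝ),
        (a ⬝ᵥ a + b ⬝ᵥ b) * (KS / (m + d) * (n * T₀) / 2 - (KX ^ 2 + 1) * G ω) ≤
          ∑ s ∈ Finset.Icc 1 T₀, ∑ i, (a ⬝ᵥ S.x s i ω + b ⬝ᵥ S.u s i ω) ^ 2 := by
  have hB : 0 < KX ^ 2 + 1 := by positivity
  have hB1 : 1 ≤ KX ^ 2 + 1 := by nlinarith [sq_nonneg KX]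
  have hm' : (1 : ℝ) ≤ m := by exact_mod_cast hm
  have hd' : (0 : ℝ) ≤ d := Nat.cast_nonneg _
  have hD1 : (1 : ℝ) ≤ m + d := by linarith
  set J : Finset (ℕ × Fin n) := Finset.Icc 1 T₀ ×ˢ Finset.univ with hJ
  have hJc : (J.card : ℝ) = n * T₀ := by simp [hJ, mul_comm]
  have hq : KS / (m + d) / (2 * (KX ^ 2 + 1)) ≤ KS / 2 :=
    div_le_div₀ hKS.le (div_le_self hKS.le hD1) two_pos (by linarith)
  have hθ : 1 / (KX ^ 2 + 1) ≤ 1 := by rw [div_le_one hB]; exact hB1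
  obtain ⟨G, hG1, hG2, hG3⟩ := exists_gram_bound (P := P) (J := J)
    (z := fun (k : ℕ × Fin n) ω => Sum.elim (S.x k.1 k.2 ω) (S.u k.1 k.2 ω))
    (c := KS / (m + d) / (2 * (KX ^ 2 + 1))) (θ := 1 / (KX ^ 2 + 1)) (b := KX ^ 2 + 1)
    (fun k _ => by
      rw [measurable_pi_iff]
      rintro (j | j)
      · exact (measurable_pi_apply j).comp (hS.measurable_x k.1 k.2)
      · exact (measurable_pi_apply j).comp (hS.measurable_u k.1 k.2))
    (by positivity) (by positivity) hB.le
    (by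
      filter_upwards [ae_mem hS hE] with ω hω k _
      obtain ⟨hx, hu⟩ := hω k.1 k.2
      rintro (j | j)
      · exact abs_le_of_dot_self_le (feature_sq_le hE hx) j
      · exact (abs_le_one_of_dot_self_le (action_sq_le hE hu) j).trans hB1)
    (fun p hp => by
      have := lintegral_exp_gram_le_one hS hE J (fun j => p (.inl j)) (fun j => p (.inr j))
        (by simpa [dotProduct] using hp)
      simpa [dotProduct] using this)
    (gridSize_pos (d := d) hm hn hT)
  refine ⟨G, hG1, hG2.trans ?_, ?_⟩
  · have hcard : (Fintype.card (Fin m ⊕ Fin d) : ℝ) = m + d := by simp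
    rw [hcard]
    refine add_le_add le_rfl (card_mul_div_gridSize_le hm hn hT (Nat.cast_nonneg _) ?_
      (by positivity) ?_)
    · rw [hJc]; gcongr
    · have h1 : (m + d : ℝ) ≤ (m + d) ^ 3 := le_self_pow₀ hD1 (by norm_num)
      have h2 : (m + d : ℝ) ^ 2 ≤ (m + d) ^ 3 := pow_le_pow_right₀ hD1 (by norm_num)
      have h3 : 2 * (KS / (m + d) / (2 * (KX ^ 2 + 1))) * (m + d) ≤ KS * (m + d) ^ 3 :=
        mul_le_mul (by linarith) h1 (by positivity) hKS.le
      have h4 : 2 * (1 / (KX ^ 2 + 1)) * ((m + d) * (KX ^ 2 + 1)) ^ 2 ≤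
          (m + d) ^ 3 * (2 * (KX ^ 2 + 1) ^ 2) := by
        rw [mul_pow]
        calc _ ≤ 2 * 1 * ((m + d : ℝ) ^ 3 * (KX ^ 2 + 1) ^ 2) := by gcongr
          _ = _ := by ring
      linarith
  · filter_upwards [hG3] with ω hω
    refine ⟨by simpa using hω 0 (by simp), fun a b => ?_⟩
    have h1 := gram_homogeneous (by positivity) hω (Sum.elim a b)
    simp only [sumElim_dotProduct_sumElim] at h1
    rw [hJ, Finset.sum_product, ← hJ, hJc, one_div, ← div_eq_inv_mul, le_div_iff₀ hB] at h1
    refine le_trans (le_of_eq ?_) h1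
    field_simp

/-- The joint process with feature direction 0, restricted to one individual: each individual has
its own ridge regression, so only T₀ observations are available here. -/
lemma exists_action_gram_bound (hS : S.IsSample P E) (hE : E.IsRegular KX KC Kμ KS) (hKS : 0 < KS)
    (hm : 1 ≤ m) (hn : 1 ≤ n) (hT : 1 ≤ T) (hT₀ : T₀ ≤ T) (i : Fin n) :
    ∃ G : Ω → ℝ, Integrable G P ∧
      ∫ ω, G ω ∂P ≤ 1 + d * Real.log (2 * gridSize m d n T + 1) +
        (KS + 2 * (KX ^ 2 + 1) ^ 2) ∧
      ∀ᵐ ω ∂P, 0 ≤ G ω ∧ ∀ b : Fin d → ℝ,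
        (b ⬝ᵥ b) * (KS / (m + d) * T₀ / 2 - (KX ^ 2 + 1) * G ω) ≤
          ∑ s ∈ Finset.Icc 1 T₀, (b ⬝ᵥ S.u s i ω) ^ 2 := by
  have hB : 0 < KX ^ 2 + 1 := by positivity
  have hB1 : 1 ≤ KX ^ 2 + 1 := by nlinarith [sq_nonneg KX]
  have hm' : (1 : ℝ) ≤ m := by exact_mod_cast hm
  have hn' : (1 : ℝ) ≤ n := by exact_mod_cast hn
  have hd' : (0 : ℝ) ≤ d := Nat.cast_nonneg _
  have hD1 : (1 : ℝ) ≤ m + d := by linarith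
  set J : Finset (ℕ × Fin n) := Finset.Icc 1 T₀ ×ˢ {i} with hJ
  have hJc : (J.card : ℝ) = T₀ := by simp [hJ]
  have hq : KS / (m + d) / (2 * (KX ^ 2 + 1)) ≤ KS / 2 :=
    div_le_div₀ hKS.le (div_le_self hKS.le hD1) two_pos (by linarith)
  have hθ : 1 / (KX ^ 2 + 1) ≤ 1 := by rw [div_le_one hB]; exact hB1
  obtain ⟨G, hG1, hG2, hG3⟩ := exists_gram_bound (P := P) (J := J)
    (z := fun (k : ℕ × Fin n) ω => S.u k.1 k.2 ω)
    (c := KS / (m + d) / (2 * (KX ^ 2 + 1))) (θ := 1 / (KX ^ 2 + 1)) (b := KX ^ 2 + 1)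
    (fun k _ => hS.measurable_u k.1 k.2)
    (by positivity) (by positivity) hB.le
    (by
      filter_upwards [ae_mem hS hE] with ω hω k _ j
      exact (abs_le_one_of_dot_self_le (action_sq_le hE (hω k.1 k.2).2) j).trans hB1)
    (fun p hp => by simpa using lintegral_exp_gram_le_one hS hE J 0 p (by simpa using hp))
    (gridSize_pos (d := d) hm hn hT)
  refine ⟨G, hG1, hG2.trans ?_, ?_⟩
  · rw [Fintype.card_fin]
    refine add_le_add le_rfl (card_mul_div_gridSize_le hm hn hT (Nat.cast_nonneg _) ?_
      (by positivity) ?_)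
    · rw [hJc]
      have : (T₀ : ℝ) ≤ T := by exact_mod_cast hT₀
      nlinarith
    · have h1 : (d : ℝ) ≤ (m + d) ^ 3 :=
        (by linarith : (d : ℝ) ≤ m + d).trans (le_self_pow₀ hD1 (by norm_num))
      have h2 : (d : ℝ) ^ 2 ≤ (m + d) ^ 3 :=
        (pow_le_pow_left₀ hd' (by linarith : (d : ℝ) ≤ m + d) 2).trans
          (pow_le_pow_right₀ hD1 (by norm_num))
      have h3 : 2 * (KS / (m + d) / (2 * (KX ^ 2 + 1))) * d ≤ KS * (m + d) ^ 3 :=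
        mul_le_mul (by linarith) h1 (by positivity) hKS.le
      have h4 : 2 * (1 / (KX ^ 2 + 1)) * (d * (KX ^ 2 + 1)) ^ 2 ≤
          (m + d) ^ 3 * (2 * (KX ^ 2 + 1) ^ 2) := by
        rw [mul_pow]
        calc _ ≤ 2 * 1 * ((m + d : ℝ) ^ 3 * (KX ^ 2 + 1) ^ 2) := by gcongr
          _ = _ := by ring
      linarith
  · filter_upwards [hG3] with ω hω
    refine ⟨by simpa using hω 0 (by simp), fun b => ?_⟩
    have h1 := gram_homogeneous (by positivity) hω b
    rw [hJ, Finset.sum_product, ← hJ, hJc, one_div, ← div_eq_inv_mul, le_div_iff₀ hB] at h1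
    simp only [Finset.sum_singleton] at h1
    refine le_trans (le_of_eq ?_) h1
    field_simp

/-- Features and actions are known before the label noise of their round, so the supermartingale
applies with q = (p·z) v and r = 0. All of rounds 0, …, t - 1 enter, adaptive or not. -/
lemma exists_label_noise_bound (hS : S.IsSample P E) (hE : E.IsRegular KX KC Kμ KS)
    (hrun : IsRun E S w b γ T₀ T) (hm : 1 ≤ m) (hn : 1 ≤ n) (hT : 1 ≤ T) {t : ℕ} (ht : t ≤ T) :
    ∃ G : Ω → ℝ, Integrable G P ∧
      ∫ ω, G ω ∂P ≤ 1 + (d + (m + d)) * Real.log (2 * gridSize m d n T + 1) +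
        (2 * (KX ^ 2 + 1) * gaussianAbs E.σ + 2 * E.tau * (KX ^ 2 + 1) ^ 2) ∧
      ∀ᵐ ω ∂P, ∀ (v : Fin d → ℝ) (α : Fin m → ℝ) (β : Fin d → ℝ), v ⬝ᵥ v ≤ 1 →
        α ⬝ᵥ α + β ⬝ᵥ β ≤ 1 →
        ∑ s ∈ Finset.range t, ∑ i, ((v ⬝ᵥ S.e s i ω) * (α ⬝ᵥ S.x s i ω + β ⬝ᵥ w s i ω) -
          E.tau / 2 * ((v ⬝ᵥ v) * (α ⬝ᵥ S.x s i ω + β ⬝ᵥ w s i ω) ^ 2)) ≤ G ω := by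
  have hB : 0 < KX ^ 2 + 1 := by positivity
  have hB1 : 1 ≤ KX ^ 2 + 1 := by nlinarith [sq_nonneg KX]
  have hm' : (1 : ℝ) ≤ m := by exact_mod_cast hm
  have hd' : (0 : ℝ) ≤ d := Nat.cast_nonneg _
  have hD1 : (1 : ℝ) ≤ m + d := by linarith
  have hτ : 0 ≤ E.tau := zero_le_one.trans E.one_le_tau
  have hg := gaussianAbs_nonneg E.σ
  set J : Finset (ℕ × Fin n) := Finset.range t ×ˢ Finset.univ with hJ
  have hJm : ∀ k ∈ J, k.1 < t := fun k hk => Finset.mem_range.1 (Finset.mem_product.1 hk).1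
  have hJc : (J.card : ℝ) = n * t := by simp [hJ, mul_comm]
  obtain ⟨G, hG1, hG2, hG3⟩ := exists_noise_bound (P := P) (J := J) (D := m + d)
    (z := fun (k : ℕ × Fin n) ω => Sum.elim (S.x k.1 k.2 ω) (w k.1 k.2 ω))
    (ξ := fun (k : ℕ × Fin n) ω => S.e k.1 k.2 ω) (τ := E.tau) (b := KX ^ 2 + 1)
    (s := gaussianAbs E.σ)
    (fun k hk => by
      rw [measurable_pi_iff]
      rintro (j | j)
      · exact (measurable_pi_apply j).comp (hS.measurable_x k.1 k.2)
      · exact (measurable_pi_apply j).comp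
          (hrun.measurable_action hS ((hJm k hk).le.trans ht) k.2))
    (fun k _ => hS.measurable_e k.1 k.2) hτ hB.le (by simp) (by simp)
    (by
      filter_upwards [ae_action_mem hS hE hrun] with ω hω k hk
      obtain ⟨hx, hu⟩ := hω k.1 ((hJm k hk).le.trans ht) k.2
      rintro (j | j)
      · exact abs_le_of_dot_self_le (feature_sq_le hE hx) j
      · exact (abs_le_one_of_dot_self_le (action_sq_le hE hu) j).trans hB1)
    (fun k _ j => integrable_of_map_gaussian
      ((measurable_pi_apply j).comp (hS.measurable_e k.1 k.2)) (map_e hS hE k.1 k.2 j))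
    (fun k _ j => (integral_abs_of_map_gaussian
      ((measurable_pi_apply j).comp (hS.measurable_e k.1 k.2)) (map_e hS hE k.1 k.2 j)).le)
    (fun v p => by
      have hmeas : ∀ s < t, ∀ i, Measurable[S.info s] fun ω =>
          p ⬝ᵥ Sum.elim (S.x s i ω) (w s i ω) := fun s hs i => by
        refine @measurable_dot _ _ _ (S.info s) _ _ measurable_const ?_
        refine measurable_of_coord (mα := S.info s) ?_
        rintro (j | j)
        · exact (measurable_pi_apply j).comp (Primitives.measurable_x_info s i)
        · exact (measurable_pi_apply j).comp (hrun.adapted s (hs.le.trans ht) i)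
      have h1 := lintegral_exp_sum_compensated_le_one hS hE t
        (q := fun s i ω => (p ⬝ᵥ Sum.elim (S.x s i ω) (w s i ω)) • v) (r := fun _ _ _ => 0)
        (fun s hs i => by
          refine measurable_of_coord (mα := S.info s) fun j => ?_
          exact (hmeas s hs i).mul_const _)
        (fun s hs i => measurable_const)
      refine le_trans (le_of_eq (lintegral_congr fun ω => ?_)) h1
      rw [hJ, Finset.sum_product]
      congr 2
      refine Finset.sum_congr rfl fun s _ => Finset.sum_congr rfl fun i _ => ?_
      simp only [Env.compensated, smul_dotProduct, dotProduct_smul, smul_eq_mul]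
      ring)
    (gridSize_pos (d := d) hm hn hT)
  refine ⟨G, hG1, hG2.trans ?_, ?_⟩
  · have hcard : (Fintype.card (Fin m ⊕ Fin d) : ℝ) = m + d := by simp
    rw [hcard, Fintype.card_fin]
    refine add_le_add le_rfl (card_mul_div_gridSize_le hm hn hT (Nat.cast_nonneg _) ?_
      (by positivity) ?_)
    · rw [hJc]; gcongr
    · have h2 : (m + d : ℝ) ^ 2 ≤ (m + d) ^ 3 := pow_le_pow_right₀ hD1 (by norm_num)
      have h3 : (m + d : ℝ) * d ≤ (m + d) ^ 2 := by nlinarith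
      have h4 := mul_le_mul_of_nonneg_right (h3.trans h2)
        (by positivity : 0 ≤ 2 * (KX ^ 2 + 1) * gaussianAbs E.σ)
      linarith
  · filter_upwards [hG3] with ω hω v α β hv hαβ
    have h1 := hω v (Sum.elim α β) (abs_le_one_of_dot_self_le hv)
      (abs_le_one_of_dot_self_le (by rw [sumElim_dotProduct_sumElim]; exact hαβ))
    rw [hJ, Finset.sum_product] at h1
    simpa only [sumElim_dotProduct_sumElim] using h1

/-- The supermartingale with only the cost noise switched on. That noise is scalar, so its direction
v ranges over a one-dimensional box and is finally set to 1. -/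
lemma exists_bandit_noise_bound (hS : S.IsSample P E) (hE : E.IsRegular KX KC Kμ KS)
    (hrun : IsRun E S w b γ T₀ T) (hm : 1 ≤ m) (hn : 1 ≤ n) (hT : 1 ≤ T) {t : ℕ} (ht : t ≤ T)
    (i : Fin n) :
    ∃ G : Ω → ℝ, Integrable G P ∧
      ∫ ω, G ω ∂P ≤ 1 + (1 + d) * Real.log (2 * gridSize m d n T + 1) +
        (2 * (KX ^ 2 + 1) * gaussianAbs E.σ + 2 * E.tau * (KX ^ 2 + 1) ^ 2) ∧
      ∀ᵐ ω ∂P, ∀ β : Fin d → ℝ, β ⬝ᵥ β ≤ 1 →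
        ∑ s ∈ Finset.Ico 1 t, (S.η s i ω * (β ⬝ᵥ w s i ω) -
          E.tau / 2 * (β ⬝ᵥ w s i ω) ^ 2) ≤ G ω := by
  have hB : 0 < KX ^ 2 + 1 := by positivity
  have hB1 : 1 ≤ KX ^ 2 + 1 := by nlinarith [sq_nonneg KX]
  have hm' : (1 : ℝ) ≤ m := by exact_mod_cast hm
  have hn' : (1 : ℝ) ≤ n := by exact_mod_cast hn
  have hd' : (0 : ℝ) ≤ d := Nat.cast_nonneg _
  have hD1 : (1 : ℝ) ≤ m + d := by linarith
  have hτ : 0 ≤ E.tau := zero_le_one.trans E.one_le_tau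
  have hg := gaussianAbs_nonneg E.σ
  have hJm : ∀ s ∈ Finset.Ico 1 t, s < t := fun s hs => (Finset.mem_Ico.1 hs).2
  obtain ⟨G, hG1, hG2, hG3⟩ := exists_noise_bound (P := P) (J := Finset.Ico 1 t) (D := m + d)
    (z := fun s ω => w s i ω) (ξ := fun s ω (_ : Unit) => S.η s i ω) (τ := E.tau) (b := KX ^ 2 + 1)
    (s := gaussianAbs E.σ)
    (fun s hs => hrun.measurable_action hS ((hJm s hs).le.trans ht) i)
    (fun s _ => measurable_pi_iff.2 fun _ => hS.measurable_eta s i) hτ hB.le (by simp)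
    (by simpa using hD1)
    (by
      filter_upwards [ae_action_mem hS hE hrun] with ω hω s hs j
      exact (abs_le_one_of_dot_self_le (action_sq_le hE
        (hω s ((hJm s hs).le.trans ht) i).2) j).trans hB1)
    (fun s _ _ => integrable_of_map_gaussian (hS.measurable_eta s i) (map_eta hS hE s i))
    (fun s _ _ => (integral_abs_of_map_gaussian (hS.measurable_eta s i) (map_eta hS hE s i)).le)
    (fun v p => by
      have h1 := lintegral_exp_sum_compensated_le_one hS hE t
        (q := fun _ _ _ => 0)
        -- The indicator removes the other individuals, and round 0, which the ridge estimate does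
        -- not use.
        (r := fun s j ω => if j = i ∧ 1 ≤ s then v () * (p ⬝ᵥ w s i ω) else 0)
        (fun s hs j => measurable_const)
        (fun s hs j => by
          split_ifs
          · exact (@measurable_dot _ _ _ (S.info s) _ _ measurable_const
              (hrun.adapted s (hs.le.trans ht) i)).const_mul _
          · exact measurable_const)
      refine le_trans (le_of_eq (lintegral_congr fun ω => ?_)) h1
      congr 2
      rw [← Finset.sum_subset (s₁ := Finset.Ico 1 t) (fun s hs => Finset.mem_range.2 (hJm s hs))]
      · refine Finset.sum_congr rfl fun s hs => ?_
        have hs1 : 1 ≤ s := (Finset.mem_Ico.1 hs).1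
        rw [Finset.sum_eq_single i]
        · simp [Env.compensated, hs1, dotProduct]
          ring
        · intro j _ hj
          simp [Env.compensated, hj]
        · simp
      · intro s hs hs'
        have : ¬ 1 ≤ s := fun h => hs' (Finset.mem_Ico.2 ⟨h, Finset.mem_range.1 hs⟩)
        simp [Env.compensated, this])
    (gridSize_pos (d := d) hm hn hT)
  refine ⟨G, hG1, hG2.trans ?_, ?_⟩
  · rw [Fintype.card_fin, Fintype.card_unit, Nat.cast_one, one_mul]
    refine add_le_add le_rfl (card_mul_div_gridSize_le hm hn hT (Nat.cast_nonneg _) ?_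
      (by positivity) ?_)
    · have h1 : ((Finset.Ico 1 t).card : ℝ) ≤ T := by
        rw [Nat.card_Ico]
        exact_mod_cast (Nat.sub_le t 1).trans ht
      have h2 : (0 : ℝ) ≤ T := Nat.cast_nonneg _
      nlinarith
    · have h2 : (m + d : ℝ) ≤ (m + d) ^ 3 := le_self_pow₀ hD1 (by norm_num)
      have h4 := mul_le_mul_of_nonneg_right h2
        (by positivity : 0 ≤ 2 * (KX ^ 2 + 1) * gaussianAbs E.σ)
      linarith
  · filter_upwards [hG3] with ω hω β hβ
    have h1 := hω (fun _ => 1) β (by simp) (abs_le_one_of_dot_self_le hβ)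
    simpa [dotProduct] using h1

end

/-! ### Estimation errors -/

section

/-- A quantity `r` that is controlled by the noise level `G` at every scale `a` allowed by the
constraint `a r ≤ 1`, and whose square is dominated by `L / N`, is small. -/
lemma le_of_forall_scale {τ r L G N ε : ℝ} (hτ : 1 ≤ τ) (hr : 0 ≤ r) (hN : 0 < N) (hε : 0 < ε)
    (hL : N * r ^ 2 ≤ L) (h : ∀ a, 0 < a → a ≤ 1 / τ → a * r ≤ 1 → a * L / 2 ≤ G) :
    r ≤ ε + (2 * τ / ε + 2) * (G / N) := by
  have hτ0 : 0 < τ := by linarith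
  have hL0 : 0 ≤ L := le_trans (by positivity) hL
  -- The best admissible scale is a = 1/τ for small r, which bounds r², and a = 1/r for large r,
  -- which bounds r itself.
  rcases le_total r τ with hrτ | hrτ
  · have h1 := h (1 / τ) (by positivity) le_rfl (by rw [one_div, inv_mul_le_iff₀ hτ0]; linarith)
    have hG : 0 ≤ G := le_trans (by positivity) h1
    have hGN : 0 ≤ G / N := by positivity
    have h2 : r ^ 2 ≤ 2 * τ * (G / N) := by
      have e : 1 / τ * L / 2 = L / (2 * τ) := by field_simp
      rw [e, div_le_iff₀ (by positivity)] at h1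
      rw [← mul_div_assoc, le_div_iff₀ hN]
      linarith
    -- Trading r² for r at threshold ε keeps the bound linear in G, so that expectations can be
    -- taken.
    have h3 : r ≤ ε + r ^ 2 / ε := by
      rw [← sub_le_iff_le_add', le_div_iff₀ hε]
      nlinarith [sq_nonneg (r - ε), mul_nonneg hr hε.le]
    have h4 : r ^ 2 / ε ≤ 2 * τ / ε * (G / N) := by
      rw [div_mul_eq_mul_div]
      exact div_le_div_of_nonneg_right h2 hε.le
    linarith
  · have hr0 : 0 < r := by linarith
    have h1 := h (1 / r) (by positivity) (one_div_le_one_div_of_le hτ0 hrτ)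
      (by rw [one_div_mul_cancel hr0.ne'])
    have hG : 0 ≤ G := le_trans (by positivity) h1
    have h2 : r ≤ 2 * (G / N) := by
      have e : 1 / r * L / 2 = L / (2 * r) := by field_simp
      rw [e, div_le_iff₀ (by positivity)] at h1
      rw [← mul_div_assoc, le_div_iff₀ hN]
      have h3 : r * (r * N) ≤ r * (2 * G) := by linarith
      exact le_of_mul_le_mul_left h3 hr0
    have h3 : 0 ≤ 2 * τ / ε * (G / N) := by positivity
    linarith

lemma l2norm_sq {k : ℕ} (v : Fin k → ℝ) : l2norm v ^ 2 = v ⬝ᵥ v :=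
  Real.sq_sqrt (dot_self_nonneg v)

lemma abs_dot_le_l2norm {k : ℕ} (a b : Fin k → ℝ) : |a ⬝ᵥ b| ≤ l2norm a * l2norm b := by
  unfold l2norm
  rw [← Real.sqrt_mul (dot_self_nonneg a)]
  exact Real.abs_le_sqrt (dot_sq_le a b)

lemma eq_zero_of_forall_quadratic {A Q : ℝ} (hQ : 0 ≤ Q) (h : ∀ r : ℝ, 2 * r * A ≤ r ^ 2 * Q) :
    A = 0 := by
  -- Q + 1 instead of Q keeps the denominator positive when Q = 0.
  have h1 := h (A / (Q + 1))
  have hQ1 : 0 < Q + 1 := by linarith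
  have e1 : 2 * (A / (Q + 1)) * A = 2 * A ^ 2 * (Q + 1) / (Q + 1) ^ 2 := by field_simp
  have e2 : (A / (Q + 1)) ^ 2 * Q = A ^ 2 * Q / (Q + 1) ^ 2 := by field_simp
  rw [e1, e2, div_le_div_iff_of_pos_right (by positivity)] at h1
  nlinarith [sq_nonneg A, mul_nonneg (sq_nonneg A) hQ]

variable {m d n : ℕ} {Ω : Type*} {S : Primitives m d n Ω} {E : Env m d} {KX KC Kμ KS : ℝ}
  {w : ℕ → Fin n → Ω → (Fin d → ℝ)} {b : Fin d → Fin d → ℝ} {γ : ℝ} {T₀ T : ℕ}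

/-- Normal equations of least squares. -/
lemma IsOLS.normal_equation {t : ℕ} {ω : Ω} {F' : Matrix (Fin d) (Fin m) ℝ}
    {G' : Matrix (Fin d) (Fin d) ℝ} (h : IsOLS E S w t ω F' G') (v : Fin d → ℝ) (α : Fin m → ℝ)
    (β : Fin d → ℝ) :
    ∑ s ∈ Finset.range t, ∑ i, (v ⬝ᵥ (S.e s i ω - ((F' - E.F) *ᵥ S.x s i ω +
      (G' - E.G) *ᵥ w s i ω))) * (α ⬝ᵥ S.x s i ω + β ⬝ᵥ w s i ω) = 0 := by
  set R : ℕ → Fin n → Fin d → ℝ := fun s i => S.e s i ω - ((F' - E.F) *ᵥ S.x s i ω +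
      (G' - E.G) *ᵥ w s i ω) with hR
  set y : ℕ → Fin n → ℝ := fun s i => α ⬝ᵥ S.x s i ω + β ⬝ᵥ w s i ω with hy
  refine eq_zero_of_forall_quadratic
    (Q := ∑ s ∈ Finset.range t, ∑ i, (v ⬝ᵥ v) * y s i ^ 2)
    (Finset.sum_nonneg fun s _ => Finset.sum_nonneg fun i _ =>
      mul_nonneg (dot_self_nonneg v) (sq_nonneg _)) fun r => ?_
  -- A rank-one perturbation of the fit in direction v ⊗ (α, β); the vanishing of the first
  -- variation is the normal equation.
  have h1 := h (F' + r • Matrix.vecMulVec v α) (G' + r • Matrix.vecMulVec v β)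
  have e0 : ∀ s i, obsLabel E S w s i ω - (F' *ᵥ S.x s i ω + G' *ᵥ w s i ω) = R s i := by
    intro s i
    simp only [hR, obsLabel, Env.label, Matrix.sub_mulVec]
    abel
  have e1 : ∀ s i, obsLabel E S w s i ω - ((F' + r • Matrix.vecMulVec v α) *ᵥ S.x s i ω +
      (G' + r • Matrix.vecMulVec v β) *ᵥ w s i ω) = R s i - (r * y s i) • v := by
    intro s i
    rw [← e0]
    simp only [hy, Matrix.add_mulVec, Matrix.smul_mulVec, Matrix.vecMulVec_mulVec,
      op_smul_eq_smul]
    rw [mul_add, add_smul, mul_smul, mul_smul]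
    abel
  have e2 : ∀ s i, (R s i - (r * y s i) • v) ⬝ᵥ (R s i - (r * y s i) • v) =
      R s i ⬝ᵥ R s i - 2 * r * ((v ⬝ᵥ R s i) * y s i) + r ^ 2 * ((v ⬝ᵥ v) * y s i ^ 2) := by
    intro s i
    generalize R s i = R'
    rw [sub_dotProduct, dotProduct_sub, dotProduct_sub, smul_dotProduct, dotProduct_smul,
      smul_dotProduct, dotProduct_smul, dotProduct_comm R' v]
    simp only [smul_eq_mul]
    ring
  simp only [squaredLoss, e0, e1, l2norm_sq, e2] at h1
  simp only [Finset.sum_add_distrib, Finset.sum_sub_distrib, ← Finset.mul_sum] at h1 ⊢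
  linarith

/-- Directional error bound for least squares on data that contain `T₀` exploratory rounds. -/
lemma IsRun.ols_error_le (hrun : IsRun E S w b γ T₀ T) {t : ℕ} (htT₀ : T₀ < t) (htT : t ≤ T) {ω : Ω}
    {F' : Matrix (Fin d) (Fin m) ℝ} {G' : Matrix (Fin d) (Fin d) ℝ} (h : IsOLS E S w t ω F' G')
    {N C ε : ℝ} (hN : 0 < N) (hε : 0 < ε)
    (hgram : ∀ (α : Fin m → ℝ) (β : Fin d → ℝ), (α ⬝ᵥ α + β ⬝ᵥ β) * N ≤
      ∑ s ∈ Finset.Icc 1 T₀, ∑ i, (α ⬝ᵥ S.x s i ω + β ⬝ᵥ S.u s i ω) ^ 2)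
    (hnoise : ∀ (v : Fin d → ℝ) (α : Fin m → ℝ) (β : Fin d → ℝ), v ⬝ᵥ v ≤ 1 →
      α ⬝ᵥ α + β ⬝ᵥ β ≤ 1 →
      ∑ s ∈ Finset.range t, ∑ i, ((v ⬝ᵥ S.e s i ω) * (α ⬝ᵥ S.x s i ω + β ⬝ᵥ w s i ω) -
        E.tau / 2 * ((v ⬝ᵥ v) * (α ⬝ᵥ S.x s i ω + β ⬝ᵥ w s i ω) ^ 2)) ≤ C)
    {v : Fin d → ℝ} (hv : v ⬝ᵥ v ≤ 1) (x : Fin m → ℝ) (u : Fin d → ℝ) :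
    |v ⬝ᵥ ((F' - E.F) *ᵥ x + (G' - E.G) *ᵥ u)| ≤
      (ε + (2 * E.tau / ε + 2) * (C / N)) * √(x ⬝ᵥ x + u ⬝ᵥ u) := by
  set α := v ᵥ* (F' - E.F) with hα
  set β := v ᵥ* (G' - E.G) with hβ
  have e1 : ∀ (x : Fin m → ℝ) (u : Fin d → ℝ),
      v ⬝ᵥ ((F' - E.F) *ᵥ x + (G' - E.G) *ᵥ u) = α ⬝ᵥ x + β ⬝ᵥ u := fun x u => by
    rw [dotProduct_add, Matrix.dotProduct_mulVec, Matrix.dotProduct_mulVec]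
  have hr0 : 0 ≤ α ⬝ᵥ α + β ⬝ᵥ β := add_nonneg (dot_self_nonneg _) (dot_self_nonneg _)
  have hτ := E.one_le_tau
  set L := ∑ s ∈ Finset.range t, ∑ i, (α ⬝ᵥ S.x s i ω + β ⬝ᵥ w s i ω) ^ 2 with hLdef
  -- The normal equation tested against the error's own direction: the squared prediction error
  -- equals its correlation with the noise.
  have hnormal : ∑ s ∈ Finset.range t, ∑ i,
      (v ⬝ᵥ S.e s i ω) * (α ⬝ᵥ S.x s i ω + β ⬝ᵥ w s i ω) = L := by
    have h1 := h.normal_equation v α β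
    simp only [dotProduct_sub v, e1, sub_mul, Finset.sum_sub_distrib] at h1
    rw [sub_eq_zero] at h1
    rw [h1, hLdef]
    simp only [sq]
  -- Round 0 and the exploitation rounds only add nonnegative terms, so the exploration data already
  -- give the lower bound.
  have hL : N * √(α ⬝ᵥ α + β ⬝ᵥ β) ^ 2 ≤ L := by
    rw [Real.sq_sqrt hr0, mul_comm]
    refine (hgram α β).trans (le_trans (le_of_eq ?_) (Finset.sum_le_sum_of_subset_of_nonneg
      (s := Finset.Icc 1 T₀) (fun s hs => Finset.mem_range.2 (by
        have := (Finset.mem_Icc.1 hs).2; omega))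
      fun s _ _ => Finset.sum_nonneg fun i _ => sq_nonneg _))
    refine Finset.sum_congr rfl fun s hs => Finset.sum_congr rfl fun i _ => ?_
    rw [Finset.mem_Icc] at hs
    rw [hrun.explore s hs.1 hs.2 (by omega) i]
  have key := le_of_forall_scale (G := C) hτ (Real.sqrt_nonneg (α ⬝ᵥ α + β ⬝ᵥ β)) hN hε hL ?_
  · rw [e1]
    refine (Real.abs_le_sqrt (dot_add_dot_sq_le α x β u)).trans ?_
    rw [Real.sqrt_mul hr0]
    exact mul_le_mul_of_nonneg_right key (Real.sqrt_nonneg _)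
  · intro a ha0 ha1 ha2
    -- The noise bound holds only on the unit ball, so the error direction is shrunk by a. As τ a ≤
    -- 1, the compensator absorbs at most half of a L.
    have h1 := hnoise v (a • α) (a • β) hv (by
      simp only [smul_dotProduct, dotProduct_smul, smul_eq_mul]
      have h2 := mul_self_le_mul_self (mul_nonneg ha0.le (Real.sqrt_nonneg _)) ha2
      have h3 := Real.mul_self_sqrt hr0
      calc _ = (a * √(α ⬝ᵥ α + β ⬝ᵥ β)) * (a * √(α ⬝ᵥ α + β ⬝ᵥ β)) := by
            rw [mul_mul_mul_comm, h3]; ring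
        _ ≤ 1 := by linarith)
    have e2 : ∀ s i, (v ⬝ᵥ S.e s i ω) * ((a • α) ⬝ᵥ S.x s i ω + (a • β) ⬝ᵥ w s i ω) -
        E.tau / 2 * ((v ⬝ᵥ v) * ((a • α) ⬝ᵥ S.x s i ω + (a • β) ⬝ᵥ w s i ω) ^ 2) =
        a * ((v ⬝ᵥ S.e s i ω) * (α ⬝ᵥ S.x s i ω + β ⬝ᵥ w s i ω)) -
        E.tau / 2 * (v ⬝ᵥ v) * a ^ 2 * (α ⬝ᵥ S.x s i ω + β ⬝ᵥ w s i ω) ^ 2 := fun s i => by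
      simp only [smul_dotProduct, smul_eq_mul]
      ring
    simp only [e2, Finset.sum_sub_distrib, ← Finset.mul_sum] at h1
    rw [hnormal, ← hLdef] at h1
    have hL0 : 0 ≤ L := Finset.sum_nonneg fun s _ => Finset.sum_nonneg fun i _ => sq_nonneg _
    have h3 : E.tau * a ≤ 1 := by
      rw [le_div_iff₀ (by linarith)] at ha1
      linarith
    have h4 : E.tau / 2 * (v ⬝ᵥ v) * a ^ 2 * L ≤ a * L / 2 := by
      have h5 : E.tau / 2 * (v ⬝ᵥ v) * a ^ 2 ≤ E.tau / 2 * 1 * a ^ 2 := by gcongr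
      have h6 : E.tau / 2 * 1 * a ^ 2 ≤ a / 2 := by nlinarith
      have := mul_le_mul_of_nonneg_right (h5.trans h6) hL0
      linarith
    linarith

/-! ### The ridge estimate and its confidence ball -/

lemma dot_vecMulVec_mulVec {k : ℕ} (p a q : Fin k → ℝ) :
    p ⬝ᵥ (Matrix.vecMulVec a a *ᵥ q) = (p ⬝ᵥ a) * (a ⬝ᵥ q) := by
  rw [Matrix.vecMulVec_mulVec, op_smul_eq_smul, dotProduct_smul, smul_eq_mul, mul_comm]

lemma dot_gram_mulVec (t : ℕ) (i : Fin n) (ω : Ω) (p q : Fin d → ℝ) :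
    p ⬝ᵥ (gram w b t i ω *ᵥ q) = ∑ j, (p ⬝ᵥ b j) * (b j ⬝ᵥ q) +
      ∑ s ∈ Finset.Ico 1 t, (p ⬝ᵥ w s i ω) * (w s i ω ⬝ᵥ q) := by
  unfold gram
  rw [Matrix.add_mulVec, dotProduct_add, Matrix.sum_mulVec, Matrix.sum_mulVec, dotProduct_sum,
    dotProduct_sum]
  simp only [dot_vecMulVec_mulVec]

/-- The spanner terms and the exploitation rounds are positive semidefinite, so exploration alone
bounds the Gram matrix from below. -/
lemma IsRun.le_dot_gram (hrun : IsRun E S w b γ T₀ T) {t : ℕ} (htT₀ : T₀ < t) (htT : t ≤ T)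
    {i : Fin n} {ω : Ω} {N : ℝ}
    (hgram : ∀ β : Fin d → ℝ, (β ⬝ᵥ β) * N ≤ ∑ s ∈ Finset.Icc 1 T₀, (β ⬝ᵥ S.u s i ω) ^ 2)
    (p : Fin d → ℝ) : (p ⬝ᵥ p) * N ≤ p ⬝ᵥ (gram w b t i ω *ᵥ p) := by
  rw [dot_gram_mulVec]
  have h1 : 0 ≤ ∑ j, (p ⬝ᵥ b j) * (b j ⬝ᵥ p) := Finset.sum_nonneg fun j _ => by
    rw [dotProduct_comm (b j)]
    exact mul_self_nonneg _
  have h2 : ∑ s ∈ Finset.Icc 1 T₀, (p ⬝ᵥ S.u s i ω) ^ 2 ≤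
      ∑ s ∈ Finset.Ico 1 t, (p ⬝ᵥ w s i ω) * (w s i ω ⬝ᵥ p) := by
    refine le_trans (le_of_eq ?_) (Finset.sum_le_sum_of_subset_of_nonneg
      (s := Finset.Icc 1 T₀) (fun s hs => ?_) fun s _ _ => ?_)
    · refine Finset.sum_congr rfl fun s hs => ?_
      rw [Finset.mem_Icc] at hs
      rw [hrun.explore s hs.1 hs.2 (by omega) i, dotProduct_comm (S.u s i ω), sq]
    · rw [Finset.mem_Icc] at hs
      rw [Finset.mem_Ico]
      omega
    · rw [dotProduct_comm (w s i ω)]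
      exact mul_self_nonneg _
  linarith [hgram p]

/-- Error bound for the ridge estimate `μ̂` when its data contain `T₀` exploratory rounds. -/
lemma IsRun.muHat_error_le (hrun : IsRun E S w b γ T₀ T) (hE : E.IsRegular KX KC Kμ KS)
    {t : ℕ} (htT₀ : T₀ < t) (htT : t ≤ T) {i : Fin n} {ω : Ω} {N C ε : ℝ} (hN : 0 < N) (hε : 0 < ε)
    (hgram : ∀ β : Fin d → ℝ, (β ⬝ᵥ β) * N ≤ ∑ s ∈ Finset.Icc 1 T₀, (β ⬝ᵥ S.u s i ω) ^ 2)
    (hnoise : ∀ β : Fin d → ℝ, β ⬝ᵥ β ≤ 1 → ∑ s ∈ Finset.Ico 1 t,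
      (S.η s i ω * (β ⬝ᵥ w s i ω) - E.tau / 2 * (β ⬝ᵥ w s i ω) ^ 2) ≤ C) :
    l2norm (muHat E S w b t i ω - E.μ) ≤
      ε + (2 * E.tau / ε + 2) * (2 * (C + d * Kμ ^ 2) / N) := by
  set A := gram w b t i ω with hA
  have hquad := hrun.le_dot_gram htT₀ htT hgram
  have hdet : IsUnit A.det := by
    rw [isUnit_iff_ne_zero]
    intro h0
    obtain ⟨v, hv0, hv⟩ := Matrix.exists_mulVec_eq_zero_iff.2 h0
    have h1 := hquad v
    rw [← hA, hv, dotProduct_zero] at h1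
    have h2 : 0 < v ⬝ᵥ v := lt_of_le_of_ne (dot_self_nonneg v)
      fun h => hv0 (dotProduct_self_eq_zero.1 h.symm)
    nlinarith [mul_pos h2 hN]
  set δ := muHat E S w b t i ω - E.μ with hδ
  have hAmu : A *ᵥ muHat E S w b t i ω =
      ∑ s ∈ Finset.Ico 1 t, obsBandit E S w s i ω • w s i ω := by
    unfold muHat
    rw [← hA, Matrix.mulVec_mulVec, Matrix.mul_nonsing_inv A hdet, Matrix.one_mulVec]
  set Q := δ ⬝ᵥ (A *ᵥ δ) with hQdef
  -- Two expressions for the same quadratic form: as a sum of squares, and, through the definition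
  -- of μ̂, as noise minus the regularization bias.
  have hQ2 : Q = ∑ j, (δ ⬝ᵥ b j) ^ 2 + ∑ s ∈ Finset.Ico 1 t, (δ ⬝ᵥ w s i ω) ^ 2 := by
    rw [hQdef, hA, dot_gram_mulVec]
    simp only [dotProduct_comm _ δ, sq]
  have hQ3 : Q = ∑ s ∈ Finset.Ico 1 t, S.η s i ω * (δ ⬝ᵥ w s i ω) -
      ∑ j, (δ ⬝ᵥ b j) * (b j ⬝ᵥ E.μ) := by
    have h1 : Q = δ ⬝ᵥ (A *ᵥ muHat E S w b t i ω) - δ ⬝ᵥ (A *ᵥ E.μ) := by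
      rw [hQdef, ← dotProduct_sub, ← Matrix.mulVec_sub]
    rw [h1, hAmu, hA, dot_gram_mulVec, dotProduct_sum]
    have h2 : ∑ s ∈ Finset.Ico 1 t, δ ⬝ᵥ (obsBandit E S w s i ω • w s i ω) =
        ∑ s ∈ Finset.Ico 1 t, S.η s i ω * (δ ⬝ᵥ w s i ω) +
          ∑ s ∈ Finset.Ico 1 t, (δ ⬝ᵥ w s i ω) * (w s i ω ⬝ᵥ E.μ) := by
      rw [← Finset.sum_add_distrib]
      refine Finset.sum_congr rfl fun s _ => ?_
      rw [dotProduct_smul, smul_eq_mul, obsBandit, dotProduct_comm E.μ]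
      ring
    rw [h2]
    ring
  have hb0 : 0 ≤ ∑ j, (δ ⬝ᵥ b j) ^ 2 := Finset.sum_nonneg fun _ _ => sq_nonneg _
  have hw0 : 0 ≤ ∑ s ∈ Finset.Ico 1 t, (δ ⬝ᵥ w s i ω) ^ 2 :=
    Finset.sum_nonneg fun _ _ => sq_nonneg _
  -- Young's inequality: a quarter of the spanner part of Q absorbs the bias, and each of the d
  -- spanner vectors leaves at most Kμ².
  have hbias : -∑ j, (δ ⬝ᵥ b j) * (b j ⬝ᵥ E.μ) ≤ (∑ j, (δ ⬝ᵥ b j) ^ 2) / 4 + d * Kμ ^ 2 := by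
    have h1 : ∀ j ∈ Finset.univ, -((δ ⬝ᵥ b j) * (b j ⬝ᵥ E.μ)) ≤ (δ ⬝ᵥ b j) ^ 2 / 4 + Kμ ^ 2 := by
      intro j _
      have h2 := dot_sq_le (b j) E.μ
      have h3 := action_sq_le hE (hrun.spanner.1 j)
      have h4 := Env.dot_self_le_of_l2norm_le hE.norm_mu
      have h5 := mul_le_mul h3 h4 (dot_self_nonneg _) zero_le_one
      nlinarith [sq_nonneg ((δ ⬝ᵥ b j) / 2 + b j ⬝ᵥ E.μ)]
    have h2 := Finset.sum_le_sum h1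
    rw [Finset.sum_add_distrib, Finset.sum_neg_distrib, ← Finset.sum_div] at h2
    simpa using h2
  have hτ := E.one_le_tau
  refine le_of_forall_scale hτ (Real.sqrt_nonneg _) hN hε (L := Q) ?_ ?_
  · rw [l2norm_sq, mul_comm]
    exact hquad δ
  · intro a ha0 ha1 ha2
    have h3 : E.tau * a ≤ 1 := by
      rw [le_div_iff₀ (by linarith)] at ha1
      linarith
    have h1 := hnoise (a • δ) (by
      simp only [smul_dotProduct, dotProduct_smul, smul_eq_mul]
      have h2 := mul_self_le_mul_self (mul_nonneg ha0.le (Real.sqrt_nonneg _)) ha2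
      rw [mul_mul_mul_comm, Real.mul_self_sqrt (dot_self_nonneg _)] at h2
      linarith)
    have e2 : ∀ s, S.η s i ω * ((a • δ) ⬝ᵥ w s i ω) - E.tau / 2 * ((a • δ) ⬝ᵥ w s i ω) ^ 2 =
        a * (S.η s i ω * (δ ⬝ᵥ w s i ω)) - E.tau / 2 * a ^ 2 * (δ ⬝ᵥ w s i ω) ^ 2 := fun s => by
      simp only [smul_dotProduct, smul_eq_mul]
      ring
    simp only [e2, Finset.sum_sub_distrib, ← Finset.mul_sum] at h1
    set W2 := ∑ s ∈ Finset.Ico 1 t, (δ ⬝ᵥ w s i ω) ^ 2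
    set B2 := ∑ j, (δ ⬝ᵥ b j) ^ 2
    set X := ∑ s ∈ Finset.Ico 1 t, S.η s i ω * (δ ⬝ᵥ w s i ω)
    set Y := ∑ j, (δ ⬝ᵥ b j) * (b j ⬝ᵥ E.μ)
    have h4 : E.tau / 2 * a ^ 2 * W2 ≤ a * W2 / 2 := by
      have := mul_le_mul_of_nonneg_right h3 (by positivity : 0 ≤ a * W2 / 2)
      linarith
    have h5 := mul_le_mul_of_nonneg_left hbias ha0.le
    -- This is where τ ≥ 1 matters: the bias term d Kμ² does not grow under scaling by a.
    have ha : a ≤ 1 := ha1.trans (by rw [div_le_one (by linarith)]; exact hτ)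
    have h6 : a * (d * Kμ ^ 2) ≤ d * Kμ ^ 2 := mul_le_of_le_one_left (by positivity) ha
    have h7 : a * Q = a * X + a * -Y := by rw [hQ3]; ring
    have h8 : a * Q = a * B2 + a * W2 := by rw [hQ2]; ring
    have h9 := mul_nonneg ha0.le hb0
    have h10 := mul_nonneg ha0.le hw0
    linarith

lemma radius_nonneg (d n : ℕ) (γ : ℝ) (t : ℕ) : 0 ≤ radius d n γ t :=
  le_max_of_le_right (sq_nonneg _)

/-- In a Gram norm bounded below by N, a ball of squared radius β has Euclidean radius at most √(β /
N). -/
lemma IsRun.confBall_error_le (hrun : IsRun E S w b γ T₀ T) {t : ℕ} (htT₀ : T₀ < t) (htT : t ≤ T)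
    {i : Fin n} {ω : Ω} {N : ℝ} (hN : 0 < N)
    (hgram : ∀ β : Fin d → ℝ, (β ⬝ᵥ β) * N ≤ ∑ s ∈ Finset.Icc 1 T₀, (β ⬝ᵥ S.u s i ω) ^ 2)
    {ν : Fin d → ℝ} (hν : ν ∈ confBall E S w b γ t i ω) :
    l2norm (ν - muHat E S w b t i ω) ≤ √(radius d n γ t / N) := by
  refine Real.sqrt_le_sqrt ?_
  rw [le_div_iff₀ hN]
  refine (hrun.le_dot_gram htT₀ htT hgram _).trans ?_
  exact (Real.sqrt_le_sqrt_iff (radius_nonneg _ _ _ _)).1 hν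

/-- Expected excess cost of action `v` over action `v'` for feature `x`. -/
def Env.gap (E : Env m d) (x : Fin m → ℝ) (v v' : Fin d → ℝ) : ℝ :=
  (E.F *ᵥ x + E.G *ᵥ v + E.μ) ⬝ᵥ v - (E.F *ᵥ x + E.G *ᵥ v' + E.μ) ⬝ᵥ v'

lemma Env.abs_gap_le (hE : E.IsRegular KX KC Kμ KS) {x : Fin m → ℝ} (hx : x ∈ E.X)
    {v v' : Fin d → ℝ} (hv : v ∈ E.W) (hv' : v' ∈ E.W) :
    |E.gap x v v'| ≤ 2 * (|KC| + |Kμ|) := by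
  have key : ∀ v ∈ E.W, |(E.F *ᵥ x + E.G *ᵥ v + E.μ) ⬝ᵥ v| ≤ |KC| + |Kμ| := by
    intro v hv
    rw [add_dotProduct]
    have h0 : 0 ≤ l2norm v := Real.sqrt_nonneg _
    have h1 := hE.norm_action v hv
    have h2 : |(E.F *ᵥ x + E.G *ᵥ v) ⬝ᵥ v| ≤ |KC| * 1 :=
      (abs_dot_le_l2norm _ _).trans (mul_le_mul ((hE.norm_label x hx v hv).trans (le_abs_self _))
        h1 h0 (abs_nonneg _))
    have h3 : |E.μ ⬝ᵥ v| ≤ |Kμ| * 1 :=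
      (abs_dot_le_l2norm _ _).trans (mul_le_mul (hE.norm_mu.trans (le_abs_self _))
        h1 h0 (abs_nonneg _))
    refine (abs_add_le _ _).trans (by linarith)
  have h1 := abs_le.1 (key v hv)
  have h2 := abs_le.1 (key v' hv')
  unfold Env.gap
  rw [abs_le]
  constructor <;> linarith [h1.1, h1.2, h2.1, h2.2]

/-- Excess cost of an optimistic choice in terms of the estimation errors. -/
lemma gap_le_of_isOptimisticChoice (hE : E.IsRegular KX KC Kμ KS) {x : Fin m → ℝ}
    {F' : Matrix (Fin d) (Fin m) ℝ} {G' : Matrix (Fin d) (Fin d) ℝ} {B : Set (Fin d → ℝ)}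
    {v v' μ' : Fin d → ℝ}
    (h : IsOptimisticChoice E.W B (fun v => F' *ᵥ x + G' *ᵥ v) v) (hv' : v' ∈ E.W) {r r₁ r₂ : ℝ}
    (hr : ∀ v ∈ E.W, |v ⬝ᵥ ((F' - E.F) *ᵥ x + (G' - E.G) *ᵥ v)| ≤ r)
    (hB : ∀ ν ∈ B, l2norm (ν - μ') ≤ r₁) (hμ : l2norm (μ' - E.μ) ≤ r₂) :
    E.gap x v v' ≤ 2 * r + 2 * (r₁ + r₂) := by
  obtain ⟨hv, ν, hν, hle⟩ := h
  -- The comparison action is evaluated with the same ν that the algorithm selected, so only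
  -- distances from elements of B to μ are needed, not μ ∈ B.
  have h1 := hle v' hv' ν hν
  have key : ∀ v ∈ E.W, |(E.F *ᵥ x + E.G *ᵥ v + E.μ) ⬝ᵥ v - (F' *ᵥ x + G' *ᵥ v + ν) ⬝ᵥ v| ≤
      r + (r₁ + r₂) := by
    intro v hv
    have e : (E.F *ᵥ x + E.G *ᵥ v + E.μ) ⬝ᵥ v - (F' *ᵥ x + G' *ᵥ v + ν) ⬝ᵥ v =
        -(v ⬝ᵥ ((F' - E.F) *ᵥ x + (G' - E.G) *ᵥ v)) +
          (-((ν - μ') ⬝ᵥ v) + -((μ' - E.μ) ⬝ᵥ v)) := by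
      rw [dotProduct_comm v]
      simp only [Matrix.sub_mulVec, add_dotProduct, sub_dotProduct]
      ring
    have h0 : 0 ≤ l2norm v := Real.sqrt_nonneg _
    have h2 := hE.norm_action v hv
    have h3 := (abs_dot_le_l2norm (ν - μ') v).trans
      (mul_le_mul (hB ν hν) h2 h0 ((Real.sqrt_nonneg _).trans (hB ν hν)))
    have h4 := (abs_dot_le_l2norm (μ' - E.μ) v).trans
      (mul_le_mul hμ h2 h0 ((Real.sqrt_nonneg _).trans hμ))
    rw [e]
    refine (abs_add_le _ _).trans (add_le_add (by rw [abs_neg]; exact hr v hv)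
      ((abs_add_le _ _).trans (add_le_add ?_ ?_)))
    · rw [abs_neg]; linarith
    · rw [abs_neg]; linarith
  have h2 := abs_le.1 (key v hv)
  have h3 := abs_le.1 (key v' hv')
  unfold Env.gap
  linarith [h2.2, h3.1]

end

/-! ### The excess cost of a round -/

section

variable {m d n : ℕ} {Ω : Type*} [mΩ : MeasurableSpace Ω] {S : Primitives m d n Ω} {P : Measure Ω}
  {E : Env m d} {KX KC Kμ KS : ℝ} {w : ℕ → Fin n → Ω → (Fin d → ℝ)}
  {b : Fin d → Fin d → ℝ} {γ : ℝ} {T₀ T : ℕ} {π : (Fin m → ℝ) → (Fin d → ℝ)}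

/-- The cost noise does not depend on the action and cancels; the label noise survives linearly,
paired with the difference of the actions. -/
lemma Env.cost_sub_cost (x : Fin m → ℝ) (e : Fin d → ℝ) (h : ℝ) (v v' : Fin d → ℝ) :
    E.cost x e h v - E.cost x e h v' = E.gap x v v' + ∑ j, e j * (v j - v' j) := by
  have h1 : ∑ j, e j * (v j - v' j) = e ⬝ᵥ v - e ⬝ᵥ v' := by
    rw [← dotProduct_sub]; rfl
  rw [h1]
  simp only [Env.cost, Env.gap, Env.label, add_dotProduct]
  ring

lemma Env.measurable_gap {α : Type*} [MeasurableSpace α] {x : α → Fin m → ℝ} {v v' : α → Fin d → ℝ}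
    (hx : Measurable x) (hv : Measurable v) (hv' : Measurable v') :
    Measurable fun a => E.gap (x a) (v a) (v' a) := by
  have hmul : ∀ {k : ℕ} (M : Matrix (Fin d) (Fin k) ℝ) {f : α → Fin k → ℝ}, Measurable f →
      Measurable fun a => M *ᵥ f a := fun M f hf =>
    measurable_pi_iff.2 fun j => measurable_dot measurable_const hf
  exact (measurable_dot (((hmul E.F hx).add (hmul E.G hv)).add measurable_const) hv).sub
    (measurable_dot (((hmul E.F hx).add (hmul E.G hv')).add measurable_const) hv')

section Decomposition

variable (hS : S.IsSample P E) (hE : E.IsRegular KX KC Kμ KS) (hrun : IsRun E S w b γ T₀ T)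
  (hπ : E.IsOptimalPolicy π) {t : ℕ} (ht : t ≤ T) (i : Fin n)
include hS hE hrun hπ ht

lemma ae_abs_gap_le :
    ∀ᵐ ω ∂P, |E.gap (S.x t i ω) (w t i ω) (π (S.x t i ω))| ≤ 2 * (|KC| + |Kμ|) := by
  filter_upwards [ae_action_mem hS hE hrun] with ω hω
  obtain ⟨hx, hw⟩ := hω t ht i
  exact Env.abs_gap_le hE hx hw (hπ.mem _ hx)

variable [IsProbabilityMeasure P]

lemma integrable_gap : Integrable (fun ω => E.gap (S.x t i ω) (w t i ω) (π (S.x t i ω))) P :=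
  Integrable.of_bound (Env.measurable_gap (hS.measurable_x t i) (hrun.measurable_action hS ht i)
    (hπ.measurable.comp (hS.measurable_x t i))).aestronglyMeasurable _
      (ae_abs_gap_le hS hE hrun hπ ht i)

/-- Both actions are determined before the label noise is drawn, so the product factorizes and the
centred noise makes its mean vanish. -/
lemma noise_mul_action (j : Fin d) :
    Integrable (fun ω => S.e t i ω j * (w t i ω j - π (S.x t i ω) j)) P ∧
      ∫ ω, S.e t i ω j * (w t i ω j - π (S.x t i ω) j) ∂P = 0 := by
  have hm : Measurable[S.info t] fun ω => w t i ω j - π (S.x t i ω) j :=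
    ((measurable_pi_apply j).comp (hrun.adapted t ht i)).sub
      ((measurable_pi_apply j).comp (hπ.measurable.comp (Primitives.measurable_x_info t i)))
  have hm' : Measurable fun ω => w t i ω j - π (S.x t i ω) j :=
    hm.mono ((S.info_le_others t i).trans (hS.others_le t i)) le_rfl
  have hej : Measurable fun ω => S.e t i ω j := (measurable_pi_apply j).comp (hS.measurable_e t i)
  have hint := integrable_of_map_gaussian hej (map_e hS hE t i j)
  have hind : IndepFun (fun ω => S.e t i ω j) (fun ω => w t i ω j - π (S.x t i ω) j) P := by
    have h1 := indep_of_indep_of_le_left (hS.indep_others hE t i)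
      (hm.comap_le.trans (S.info_le_others t i))
    refine IndepFun.symm (indep_of_indep_of_le_right h1 ?_)
    exact Measurable.comap_le (((measurable_pi_apply j).comp measurable_fst).comp
      (comap_measurable fun ω => (S.e t i ω, S.η t i ω)))
  refine ⟨hint.mul_bdd (c := 2) hm'.aestronglyMeasurable ?_, ?_⟩
  · filter_upwards [ae_action_mem hS hE hrun] with ω hω
    obtain ⟨hx, hw⟩ := hω t ht i
    have h1 := abs_le_one_of_dot_self_le (action_sq_le hE hw) j
    have h2 := abs_le_one_of_dot_self_le (action_sq_le hE (hπ.mem _ hx)) j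
    exact (abs_sub _ _).trans (by linarith)
  · rw [hind.integral_fun_mul_eq_mul_integral hej.aestronglyMeasurable hm'.aestronglyMeasurable,
      integral_of_map_gaussian hej (map_e hS hE t i j), zero_mul]

lemma integrable_cost_sub :
    Integrable (fun ω => E.cost (S.x t i ω) (S.e t i ω) (S.η t i ω) (w t i ω) -
      E.cost (S.x t i ω) (S.e t i ω) (S.η t i ω) (π (S.x t i ω))) P := by
  simp only [Env.cost_sub_cost]
  exact (integrable_gap hS hE hrun hπ ht i).add
    (integrable_finsetSum _ fun j _ => (noise_mul_action hS hE hrun hπ ht i j).1)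

lemma integral_cost_sub :
    ∫ ω, (E.cost (S.x t i ω) (S.e t i ω) (S.η t i ω) (w t i ω) -
      E.cost (S.x t i ω) (S.e t i ω) (S.η t i ω) (π (S.x t i ω))) ∂P =
    ∫ ω, E.gap (S.x t i ω) (w t i ω) (π (S.x t i ω)) ∂P := by
  simp only [Env.cost_sub_cost]
  rw [integral_add (integrable_gap hS hE hrun hπ ht i)
    (integrable_finsetSum _ fun j _ => (noise_mul_action hS hE hrun hπ ht i j).1),
    integral_finsetSum _ fun j _ => (noise_mul_action hS hE hrun hπ ht i j).1,
    Finset.sum_eq_zero fun j _ => (noise_mul_action hS hE hrun hπ ht i j).2, add_zero]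

lemma integral_gap_le :
    ∫ ω, E.gap (S.x t i ω) (w t i ω) (π (S.x t i ω)) ∂P ≤ 2 * (|KC| + |Kμ|) := by
  have h := integral_mono_ae (integrable_gap hS hE hrun hπ ht i) (integrable_const _)
    ((ae_abs_gap_le hS hE hrun hπ ht i).mono fun ω hω => (le_abs_self _).trans hω)
  simpa using h

/-- Expected excess cost in an exploitation round. -/
lemma integral_gap_exploit_le (hKS : 0 < KS) (hm : 1 ≤ m) (hn : 1 ≤ n) (hT : 1 ≤ T) (hT₀ : 1 ≤ T₀)
    (htT₀ : T₀ < t) {ε g₁ g₂ g₃ g₄ N₁ N₂ : ℝ} (hε : 0 < ε)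
    (hN₁ : N₁ = KS / (m + d) * (n * T₀) / 4) (hN₂ : N₂ = KS / (m + d) * T₀ / 4)
    (hg₁ : 1 + (d + (m + d)) * Real.log (2 * gridSize m d n T + 1) +
        (2 * (KX ^ 2 + 1) * gaussianAbs E.σ + 2 * E.tau * (KX ^ 2 + 1) ^ 2) ≤ g₁)
    (hg₂ : 1 + (1 + d) * Real.log (2 * gridSize m d n T + 1) +
        (2 * (KX ^ 2 + 1) * gaussianAbs E.σ + 2 * E.tau * (KX ^ 2 + 1) ^ 2) ≤ g₂)
    (hg₃ : 1 + (m + d) * Real.log (2 * gridSize m d n T + 1) + (KS + 2 * (KX ^ 2 + 1) ^ 2) ≤ g₃)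
    (hg₄ : 1 + d * Real.log (2 * gridSize m d n T + 1) + (KS + 2 * (KX ^ 2 + 1) ^ 2) ≤ g₄) :
    ∫ ω, E.gap (S.x t i ω) (w t i ω) (π (S.x t i ω)) ∂P ≤
      2 * ((ε + (2 * E.tau / ε + 2) * (g₁ / N₁)) * √(KX ^ 2 + 1)) +
      2 * (√(radius d n γ t / N₂) + (ε + (2 * E.tau / ε + 2) * (2 * (g₂ + d * Kμ ^ 2) / N₂))) +
      2 * (|KC| + |Kμ|) * ((KX ^ 2 + 1) * (g₃ / N₁ + g₄ / N₂)) := by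
  obtain ⟨G₁, i1, m1, a1⟩ := exists_label_noise_bound hS hE hrun hm hn hT ht
  obtain ⟨G₂, i2, m2, a2⟩ := exists_bandit_noise_bound hS hE hrun hm hn hT ht i
  obtain ⟨G₃, i3, m3, a3⟩ := exists_joint_gram_bound (T₀ := T₀) (T := T) hS hE hKS hm hn hT (by omega)
  obtain ⟨G₄, i4, m4, a4⟩ :=
    exists_action_gram_bound (T₀ := T₀) (T := T) hS hE hKS hm hn hT (by omega) i
  have hm' : (0 : ℝ) < m := by exact_mod_cast hm
  have hn' : (0 : ℝ) < n := by exact_mod_cast hn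
  have hT₀' : (0 : ℝ) < T₀ := by exact_mod_cast hT₀
  have hN₁0 : 0 < N₁ := by rw [hN₁]; positivity
  have hN₂0 : 0 < N₂ := by rw [hN₂]; positivity
  have hτ : 0 ≤ E.tau := zero_le_one.trans E.one_le_tau
  have hB : 0 < KX ^ 2 + 1 := by positivity
  set Kg := 2 * (|KC| + |Kμ|) with hKg
  have hKg0 : 0 ≤ Kg := by positivity
  set c := 2 * E.tau / ε + 2 with hc
  have hc0 : 0 ≤ c := by positivity
  -- The pathwise bound is affine and increasing in the four deviations, so its expectation is its
  -- value at their means.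
  set U : ℝ → ℝ → ℝ → ℝ → ℝ := fun y₁ y₂ y₃ y₄ =>
    2 * ((ε + c * (y₁ / N₁)) * √(KX ^ 2 + 1)) +
      2 * (√(radius d n γ t / N₂) + (ε + c * (2 * (y₂ + d * Kμ ^ 2) / N₂))) +
      Kg * ((KX ^ 2 + 1) * (y₃ / N₁ + y₄ / N₂)) with hU
  have hUint : Integrable (fun ω => U (G₁ ω) (G₂ ω) (G₃ ω) (G₄ ω)) P := by
    refine Integrable.add (Integrable.add ?_ ?_) ?_
    · exact (((integrable_const _).add ((i1.div_const _).const_mul _)).mul_const _).const_mul _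
    · exact ((integrable_const _).add ((integrable_const _).add
        ((((i2.add (integrable_const _)).const_mul _).div_const _).const_mul _))).const_mul _
    · exact (((i3.div_const _).add (i4.div_const _)).const_mul _).const_mul _
  have hUe : ∫ ω, U (G₁ ω) (G₂ ω) (G₃ ω) (G₄ ω) ∂P =
      U (∫ ω, G₁ ω ∂P) (∫ ω, G₂ ω ∂P) (∫ ω, G₃ ω ∂P) (∫ ω, G₄ ω ∂P) := by
    have e : ∀ y₁ y₂ y₃ y₄, U y₁ y₂ y₃ y₄ = 2 * c / N₁ * √(KX ^ 2 + 1) * y₁ + 4 * c / N₂ * y₂ +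
        Kg * (KX ^ 2 + 1) / N₁ * y₃ + Kg * (KX ^ 2 + 1) / N₂ * y₄ + U 0 0 0 0 := by
      intro y₁ y₂ y₃ y₄
      simp only [hU]
      ring
    have j1 := i1.const_mul (2 * c / N₁ * √(KX ^ 2 + 1))
    have j2 := i2.const_mul (4 * c / N₂)
    have j3 := i3.const_mul (Kg * (KX ^ 2 + 1) / N₁)
    have j4 := i4.const_mul (Kg * (KX ^ 2 + 1) / N₂)
    rw [e (∫ ω, G₁ ω ∂P)]
    simp_rw [e (G₁ _)]
    have k2 : Integrable (fun ω => 2 * c / N₁ * √(KX ^ 2 + 1) * G₁ ω + 4 * c / N₂ * G₂ ω) P :=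
      j1.add j2
    have k3 : Integrable (fun ω => 2 * c / N₁ * √(KX ^ 2 + 1) * G₁ ω + 4 * c / N₂ * G₂ ω +
      Kg * (KX ^ 2 + 1) / N₁ * G₃ ω) P := k2.add j3
    have k4 : Integrable (fun ω => 2 * c / N₁ * √(KX ^ 2 + 1) * G₁ ω + 4 * c / N₂ * G₂ ω +
      Kg * (KX ^ 2 + 1) / N₁ * G₃ ω + Kg * (KX ^ 2 + 1) / N₂ * G₄ ω) P := k3.add j4
    rw [integral_add k4 (integrable_const _), integral_add k3 j4, integral_add k2 j3,
      integral_add j1 j2]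
    simp only [integral_const_mul, integral_const, probReal_univ, one_smul]
  have hUmono : U (∫ ω, G₁ ω ∂P) (∫ ω, G₂ ω ∂P) (∫ ω, G₃ ω ∂P) (∫ ω, G₄ ω ∂P) ≤ U g₁ g₂ g₃ g₄ := by
    have m1' := m1.trans hg₁
    have m2' := m2.trans hg₂
    have m3' := m3.trans hg₃
    have m4' := m4.trans hg₄
    simp only [hU]
    gcongr
  refine le_trans ?_ hUmono
  rw [← hUe]
  refine integral_mono_ae (integrable_gap hS hE hrun hπ ht i) hUint ?_
  filter_upwards [a1, a2, a3, a4, ae_action_mem hS hE hrun, ae_abs_gap_le hS hE hrun hπ ht i]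
    with ω h1 h2 h3 h4 hmem hgap
  obtain ⟨hx, hw⟩ := hmem t ht i
  -- The zero direction makes the process vanish, so the deviations are nonnegative.
  have p1 : 0 ≤ G₁ ω := by simpa using h1 0 0 0 (by simp) (by simp)
  have p2 : 0 ≤ G₂ ω := by simpa using h2 0 (by simp)
  have p3 := h3.1
  have p4 := h4.1
  have q1 : 0 ≤ 2 * ((ε + c * (G₁ ω / N₁)) * √(KX ^ 2 + 1)) := by positivity
  have q2 : 0 ≤ 2 * (√(radius d n γ t / N₂) + (ε + c * (2 * (G₂ ω + d * Kμ ^ 2) / N₂))) := by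
    positivity
  have q3 : 0 ≤ Kg * ((KX ^ 2 + 1) * (G₃ ω / N₁ + G₄ ω / N₂)) := by positivity
  -- N₁ and N₂ are half of the leading terms of the Gram bounds; on the good event the deviations
  -- consume at most the other half.
  by_cases hgood : (KX ^ 2 + 1) * G₃ ω ≤ N₁ ∧ (KX ^ 2 + 1) * G₄ ω ≤ N₂
  · obtain ⟨F', G', hols, hopt⟩ := hrun.exploit t htT₀ ht ω
    have hgram2 : ∀ β : Fin d → ℝ, (β ⬝ᵥ β) * N₂ ≤
        ∑ s ∈ Finset.Icc 1 T₀, (β ⬝ᵥ S.u s i ω) ^ 2 := fun β =>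
      (mul_le_mul_of_nonneg_left (by linarith [hgood.2]) (dot_self_nonneg β)).trans (h4.2 β)
    have hgram1 : ∀ (α : Fin m → ℝ) (β : Fin d → ℝ), (α ⬝ᵥ α + β ⬝ᵥ β) * N₁ ≤
        ∑ s ∈ Finset.Icc 1 T₀, ∑ i, (α ⬝ᵥ S.x s i ω + β ⬝ᵥ S.u s i ω) ^ 2 := fun α β =>
      (mul_le_mul_of_nonneg_left (by linarith [hgood.1])
        (add_nonneg (dot_self_nonneg α) (dot_self_nonneg β))).trans (h3.2 α β)
    have hle := gap_le_of_isOptimisticChoice hE (hopt i) (hπ.mem _ hx)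
      (r := (ε + c * (G₁ ω / N₁)) * √(KX ^ 2 + 1))
      (fun v hv => (hrun.ols_error_le htT₀ ht hols hN₁0 hε hgram1 h1 (action_sq_le hE hv)
        (S.x t i ω) v).trans (mul_le_mul_of_nonneg_left (Real.sqrt_le_sqrt
          (add_le_add (feature_sq_le hE hx) (action_sq_le hE hv))) (by positivity)))
      (fun ν hν => hrun.confBall_error_le htT₀ ht hN₂0 hgram2 hν)
      (hrun.muHat_error_le hE htT₀ ht hN₂0 hε hgram2 h2)
    linarith
  -- Off the good event one of the normalized Gram deviations exceeds 1, so the trivial bound on the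
  -- gap is dominated by the last summand of U.
  · have hbad : 1 ≤ (KX ^ 2 + 1) * (G₃ ω / N₁ + G₄ ω / N₂) := by
      rw [mul_add, ← mul_div_assoc, ← mul_div_assoc]
      have r3 : 0 ≤ (KX ^ 2 + 1) * G₃ ω / N₁ := by positivity
      have r4 : 0 ≤ (KX ^ 2 + 1) * G₄ ω / N₂ := by positivity
      rcases not_and_or.1 hgood with h | h
      · have := (one_le_div hN₁0).2 (not_le.1 h).le
        linarith
      · have := (one_le_div hN₂0).2 (not_le.1 h).le
        linarith
    have hfin := le_mul_of_one_le_right hKg0 hbad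
    have := (le_abs_self _).trans hgap
    linarith

end Decomposition

end

/-! ### The regret bound -/

section

/-- The exploration length before rounding, up to constants the regret per individual. -/
def rate (m d T : ℕ) : ℝ := (m : ℝ) ^ (1 / 3 : ℝ) * (d : ℝ) ^ (2 / 3 : ℝ) * (T : ℝ) ^ (2 / 3 : ℝ)

/-- The cubed form removes the fractional powers; it is the only property of the exponents that the
balancing of error terms needs. -/
lemma rate_pow_three (m d T : ℕ) : rate m d T ^ 3 = m * (d : ℝ) ^ 2 * (T : ℝ) ^ 2 := by
  have h1 : ((m : ℝ) ^ (1 / 3 : ℝ)) ^ 3 = m := by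
    rw [← Real.rpow_natCast, ← Real.rpow_mul (Nat.cast_nonneg _)]
    norm_num
  have h2 : ∀ k : ℕ, ((k : ℝ) ^ (2 / 3 : ℝ)) ^ 3 = (k : ℝ) ^ 2 := fun k => by
    rw [← Real.rpow_natCast, ← Real.rpow_mul (Nat.cast_nonneg _), ← Real.rpow_natCast]
    norm_num
  rw [rate, mul_pow, mul_pow, h1, h2, h2]

lemma rate_pos {m d T : ℕ} (hm : 1 ≤ m) (hd : 1 ≤ d) (hT : 1 ≤ T) : 0 < rate m d T := by
  have : (0 : ℝ) < m := by exact_mod_cast hm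
  have : (0 : ℝ) < d := by exact_mod_cast hd
  have : (0 : ℝ) < T := by exact_mod_cast hT
  unfold rate
  positivity

/-- If the horizon exceeds eight times the rate, then the rate dominates `m d²`. -/
lemma mul_sq_le_rate {m d T : ℕ} (hm : 1 ≤ m) (hd : 1 ≤ d) (hT : 1 ≤ T)
    (h : 8 * rate m d T < T) : 64 * (m * (d : ℝ) ^ 2) ≤ rate m d T := by
  have hρ := rate_pos hm hd hT
  have h3 := rate_pow_three m d T
  have h4 : (64 * (m * (d : ℝ) ^ 2)) * rate m d T ^ 2 ≤ rate m d T * rate m d T ^ 2 := by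
    have h5 : (8 * rate m d T) ^ 2 ≤ (T : ℝ) ^ 2 := pow_le_pow_left₀ (by positivity) h.le 2
    have h6 := mul_le_mul_of_nonneg_left h5 (by positivity : (0 : ℝ) ≤ m * (d : ℝ) ^ 2)
    nlinarith
  exact le_of_mul_le_mul_right h4 (by positivity)

lemma add_le_two_mul_mul {m d : ℕ} (hm : 1 ≤ m) (hd : 1 ≤ d) : (m + d : ℝ) ≤ 2 * (m * d) := by
  have hm' : (1 : ℝ) ≤ m := by exact_mod_cast hm
  have hd' : (1 : ℝ) ≤ d := by exact_mod_cast hd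
  nlinarith

/-- The assumption m d² ≤ T eliminates m and d from the logarithm: 2 `gridSize` + 1 ≤ 32 (nT)⁴, and
5 log 2 + 4 log(nT) gives the 9. -/
lemma log_gridSize_le {m d n T : ℕ} {γ : ℝ} (hm : 1 ≤ m) (hd : 1 ≤ d) (hn : 1 ≤ n) (hT : 1 ≤ T)
    (hγ0 : 0 < γ) (hγ : γ ≤ 1) (h : (m * (d : ℝ) ^ 2) ≤ T) :
    Real.log (2 * gridSize m d n T + 1) ≤ 9 * (1 + Real.log (n * T / γ)) := by
  have hd' : (1 : ℝ) ≤ d := by exact_mod_cast hd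
  have hm' : (1 : ℝ) ≤ m := by exact_mod_cast hm
  have hn' : (1 : ℝ) ≤ n := by exact_mod_cast hn
  have hT' : (1 : ℝ) ≤ T := by exact_mod_cast hT
  have hnT : (1 : ℝ) ≤ n * T := by nlinarith
  have h1 : (m + d : ℝ) ≤ 2 * T := by
    have := add_le_two_mul_mul hm hd
    have h2 : (m * d : ℝ) ≤ m * (d : ℝ) ^ 2 :=
      mul_le_mul_of_nonneg_left (le_self_pow₀ hd' (by norm_num)) (by linarith)
    linarith
  have h2 : (2 * gridSize m d n T + 1 : ℝ) ≤ 32 * (n * T : ℝ) ^ 4 := by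
    have e : ((gridSize m d n T : ℕ) : ℝ) = (m + d : ℝ) ^ 3 * (n * T) := by
      unfold gridSize; push_cast; ring
    rw [e]
    have h3 : (m + d : ℝ) ^ 3 ≤ (2 * (n * T)) ^ 3 :=
      pow_le_pow_left₀ (by positivity) (h1.trans (by nlinarith)) 3
    have h4 := mul_le_mul_of_nonneg_right h3 (by positivity : (0 : ℝ) ≤ n * T)
    have h5 : (1 : ℝ) ≤ (n * T) ^ 4 := one_le_pow₀ hnT
    nlinarith
  have h3 : (0 : ℝ) ≤ Real.log (n * T) := Real.log_nonneg hnT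
  have h4 : Real.log (n * T) ≤ Real.log (n * T / γ) :=
    Real.log_le_log (by positivity) (by rw [le_div_iff₀ hγ0]; nlinarith)
  have h5 := Real.log_le_log (by positivity) h2
  have h6 : Real.log (32 * (n * T : ℝ) ^ 4) = 5 * Real.log 2 + 4 * Real.log (n * T) := by
    rw [Real.log_mul (by norm_num) (by positivity), Real.log_pow,
      (by norm_num : (32 : ℝ) = 2 ^ 5), Real.log_pow]
    norm_num
  have h7 : Real.log 2 ≤ 1 := by linarith [Real.log_two_lt_d9]
  linarith

lemma radius_le {d n t T : ℕ} {γ : ℝ} (hd : 1 ≤ d) (hn : 1 ≤ n) (ht : 1 ≤ t) (htT : t ≤ T)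
    (hγ0 : 0 < γ) (hγ : γ ≤ 1) :
    radius d n γ t ≤ 256 * d * (1 + Real.log (n * T / γ)) ^ 2 := by
  have hd' : (1 : ℝ) ≤ d := by exact_mod_cast hd
  have hn' : (1 : ℝ) ≤ n := by exact_mod_cast hn
  have ht' : (1 : ℝ) ≤ t := by exact_mod_cast ht
  have htT' : (t : ℝ) ≤ T := by exact_mod_cast htT
  have hT' : (1 : ℝ) ≤ T := ht'.trans htT'
  set l := Real.log (n * T / γ) with hl
  have hnT : (T : ℝ) ≤ n * T := by nlinarith
  have hnTγ : (n * T : ℝ) ≤ n * T / γ := by rw [le_div_iff₀ hγ0]; nlinarith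
  have hl0 : 0 ≤ l := Real.log_nonneg (by linarith)
  have h1 : Real.log t ≤ l := Real.log_le_log (by linarith) (by linarith)
  have h10 : 0 ≤ Real.log t := Real.log_nonneg ht'
  have h2 : Real.log (n * (t : ℝ) ^ 2 / γ) ≤ 2 * l := by
    have e : 2 * l = Real.log ((n * T / γ) ^ 2) := by rw [hl, Real.log_pow]; norm_num
    rw [e]
    refine Real.log_le_log (by positivity) ?_
    calc (n * (t : ℝ) ^ 2 / γ) ≤ n * (T : ℝ) ^ 2 / γ := by gcongr
      _ = (n * T / γ) * T := by ring
      _ ≤ (n * T / γ) * (n * T / γ) := mul_le_mul_of_nonneg_left (by linarith) (by positivity)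
      _ = (n * T / γ) ^ 2 := by ring
  have h20 : 0 ≤ Real.log (n * (t : ℝ) ^ 2 / γ) := by
    refine Real.log_nonneg ?_
    rw [le_div_iff₀ hγ0]
    have := one_le_pow₀ (n := 2) ht'
    nlinarith
  have hll : l ^ 2 ≤ (1 + l) ^ 2 := pow_le_pow_left₀ hl0 (by linarith) 2
  refine max_le ?_ ?_
  · have h3 : 128 * d * Real.log t * Real.log (n * (t : ℝ) ^ 2 / γ) ≤ 128 * d * l * (2 * l) := by
      gcongr
    have h4 := mul_le_mul_of_nonneg_left hll (by positivity : (0 : ℝ) ≤ 256 * d)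
    linarith
  · have h3 : (8 / 3 * Real.log (n * (t : ℝ) ^ 2 / γ)) ^ 2 ≤ (8 / 3 * (2 * l)) ^ 2 := by gcongr
    have h4 : (8 / 3 * (2 * l)) ^ 2 ≤ 256 * l ^ 2 := by nlinarith [sq_nonneg l]
    have h5 : 256 * l ^ 2 ≤ 256 * d * (1 + l) ^ 2 := by nlinarith [sq_nonneg l]
    linarith

lemma nonneg_of_le_mul_natCast {m n : ℕ} {κ : ℝ} (hn : 1 ≤ n) (h : (m : ℝ) ≤ κ * n) : 0 ≤ κ := by
  have hn' : (0 : ℝ) < n := by exact_mod_cast hn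
  exact nonneg_of_mul_nonneg_left ((Nat.cast_nonneg m).trans h) hn'

lemma one_le_one_add_log {n T : ℕ} {γ : ℝ} (hn : 1 ≤ n) (hT : 1 ≤ T) (hγ0 : 0 < γ) (hγ : γ ≤ 1) :
    1 ≤ 1 + Real.log (n * T / γ) := by
  have hn' : (1 : ℝ) ≤ n := by exact_mod_cast hn
  have hT' : (1 : ℝ) ≤ T := by exact_mod_cast hT
  have h : 0 ≤ Real.log (n * T / γ) := Real.log_nonneg (by
    rw [le_div_iff₀ hγ0, one_mul]
    exact hγ.trans (one_le_mul_of_one_le_of_one_le hn' hT'))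
  linarith

/-- Elementary bounds relating the sizes of the estimation problems to the rate. -/
lemma div_gram_le {m d n T₀ : ℕ} {KS κ ρ ε l c g₁ g₂ : ℝ} (hm : 1 ≤ m) (hd : 1 ≤ d) (hn : 1 ≤ n)
    (hκ : (m : ℝ) ≤ κ * n) (hKS : 0 < KS) (hρ : 0 < ρ) (hT₀ : ρ / 2 ≤ T₀)
    (hε : m * (d : ℝ) ^ 2 = ε ^ 2 * ρ) (hl : 0 ≤ l) (hc : 0 ≤ c)
    (hg₁ : g₁ ≤ c * (m + d) * l) (hg₂ : g₂ ≤ c * d * l) :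
    g₁ / (KS / (m + d) * (n * T₀) / 4) ≤ 32 * κ * c / KS * (ε ^ 2 * l) ∧
      g₂ / (KS / (m + d) * T₀ / 4) ≤ 16 * c / KS * (ε ^ 2 * l) := by
  have hd' : (1 : ℝ) ≤ d := by exact_mod_cast hd
  have hm' : (1 : ℝ) ≤ m := by exact_mod_cast hm
  have hn' : (1 : ℝ) ≤ n := by exact_mod_cast hn
  have hT₀' : (0 : ℝ) < T₀ := by linarith
  have hκ0 : 0 ≤ κ := nonneg_of_le_mul_natCast hn hκ
  have h1 := add_le_two_mul_mul hm hd
  have hD : (0 : ℝ) < m + d := by linarith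
  constructor
  · rw [div_le_iff₀ (by positivity)]
    refine hg₁.trans ?_
    have e : 32 * κ * c / KS * (ε ^ 2 * l) * (KS / (m + d) * (n * T₀) / 4) =
        c * l * (8 * ε ^ 2 * T₀ * (κ * n)) / (m + d) := by field_simp; ring
    rw [e, le_div_iff₀ hD]
    -- From m + d ≤ 2 m d; the surplus factor m is paid for by the n pooled individuals through m ≤
    -- κ n.
    have h2 : (m + d : ℝ) ^ 2 ≤ 4 * (m * (d : ℝ) ^ 2) * m := by
      have := pow_le_pow_left₀ hD.le h1 2
      linarith
    have h3 : 4 * (m * (d : ℝ) ^ 2) * m ≤ 8 * ε ^ 2 * T₀ * (κ * n) := by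
      have h4 : 4 * (m * (d : ℝ) ^ 2) ≤ 8 * ε ^ 2 * T₀ := by
        rw [hε]
        nlinarith [sq_nonneg ε]
      exact mul_le_mul h4 hκ (by linarith) (by positivity)
    have h5 := mul_le_mul_of_nonneg_left (h2.trans h3) (mul_nonneg hc hl)
    linarith
  · rw [div_le_iff₀ (by positivity)]
    refine hg₂.trans ?_
    have e : 16 * c / KS * (ε ^ 2 * l) * (KS / (m + d) * T₀ / 4) =
        c * l * (4 * ε ^ 2 * T₀) / (m + d) := by field_simp; ring
    rw [e, le_div_iff₀ hD]
    have h2 : (d * (m + d) : ℝ) ≤ 2 * (m * (d : ℝ) ^ 2) := by nlinarith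
    have h3 : 2 * (m * (d : ℝ) ^ 2) ≤ 4 * ε ^ 2 * T₀ := by
      rw [hε]
      nlinarith [sq_nonneg ε]
    have h5 := mul_le_mul_of_nonneg_left (h2.trans h3) (mul_nonneg hc hl)
    linarith

/-- Size of the deviations of the noise and Gram processes, per degree of freedom. -/
def deviationConst (σ : ℝ≥0) (KX Kμ KS : ℝ) : ℝ :=
  19 + (2 * (KX ^ 2 + 1) * gaussianAbs σ + 2 * ((σ : ℝ) ^ 2 + 1) * (KX ^ 2 + 1) ^ 2) +
    (KS + 2 * (KX ^ 2 + 1) ^ 2) + Kμ ^ 2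

/-- Constant in the bound for the excess cost of an exploitation round. -/
def exploitConst (σ : ℝ≥0) (KX KC Kμ KS κ : ℝ) : ℝ :=
  2 * (1 + (2 * ((σ : ℝ) ^ 2 + 1) + 2) * (32 * κ * deviationConst σ KX Kμ KS / KS)) *
      √(KX ^ 2 + 1) +
    2 * (√(4096 / KS) + (1 + (2 * ((σ : ℝ) ^ 2 + 1) + 2) *
      (2 * (16 * deviationConst σ KX Kμ KS / KS)))) +
    2 * (|KC| + |Kμ|) * ((KX ^ 2 + 1) *
      (32 * κ * deviationConst σ KX Kμ KS / KS + 16 * deviationConst σ KX Kμ KS / KS))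

lemma deviationConst_nonneg (σ : ℝ≥0) (KX Kμ : ℝ) {KS : ℝ} (hKS : 0 < KS) :
    0 ≤ deviationConst σ KX Kμ KS := by
  have := gaussianAbs_nonneg σ
  unfold deviationConst
  positivity

lemma exploitConst_nonneg (σ : ℝ≥0) (KX KC Kμ : ℝ) {KS κ : ℝ} (hKS : 0 < KS) (hκ : 0 ≤ κ) :
    0 ≤ exploitConst σ KX KC Kμ KS κ := by
  have := deviationConst_nonneg σ KX Kμ hKS
  unfold exploitConst
  positivity

variable {m d n : ℕ} {Ω : Type*} [mΩ : MeasurableSpace Ω] {S : Primitives m d n Ω} {P : Measure Ω}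
  [IsProbabilityMeasure P] {E : Env m d} {KX KC Kμ KS κ : ℝ} {w : ℕ → Fin n → Ω → (Fin d → ℝ)}
  {b : Fin d → Fin d → ℝ} {γ : ℝ} {T₀ T : ℕ} {π : (Fin m → ℝ) → (Fin d → ℝ)}

/-- Balances the error terms at ε = ρ / T: deviations over Gram sizes are O(ε² l), and the factor
2τ/ε in front of them leaves O(ε l). -/
lemma integral_gap_exploit_le_rate (hS : S.IsSample P E) (hE : E.IsRegular KX KC Kμ KS)
    (hrun : IsRun E S w b γ T₀ T) (hπ : E.IsOptimalPolicy π) {t : ℕ} (ht : t ≤ T) (i : Fin n)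
    (hKS : 0 < KS) (hm : 1 ≤ m) (hd : 1 ≤ d) (hn : 1 ≤ n) (hT : 1 ≤ T) (hκ : (m : ℝ) ≤ κ * n)
    (hγ0 : 0 < γ) (hγ : γ ≤ 1) (hbig : 8 * rate m d T < T) (hT₀ : |(T₀ : ℝ) - rate m d T| < 1)
    (htT₀ : T₀ < t) :
    ∫ ω, E.gap (S.x t i ω) (w t i ω) (π (S.x t i ω)) ∂P ≤
      exploitConst E.σ KX KC Kμ KS κ * (rate m d T / T * (1 + Real.log (n * T / γ))) := by
  have hd' : (1 : ℝ) ≤ d := by exact_mod_cast hd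
  have hm' : (1 : ℝ) ≤ m := by exact_mod_cast hm
  have hn' : (1 : ℝ) ≤ n := by exact_mod_cast hn
  have hT' : (1 : ℝ) ≤ T := by exact_mod_cast hT
  have hρ := rate_pos hm hd hT
  have hρ64 := mul_sq_le_rate hm hd hT hbig
  have hρ3 := rate_pow_three m d T
  set ρ := rate m d T
  set ε := ρ / T with hε
  have hε0 : 0 < ε := by positivity
  have hε1 : ε ≤ 1 := by rw [hε, div_le_one (by linarith)]; linarith
  have hε2 : m * (d : ℝ) ^ 2 = ε ^ 2 * ρ := by
    rw [hε]
    field_simp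
    linarith
  have hmd : (1 : ℝ) ≤ m * (d : ℝ) ^ 2 := one_le_mul_of_one_le_of_one_le hm' (one_le_pow₀ hd')
  have hT₀ρ : ρ / 2 ≤ T₀ := by linarith [(abs_lt.1 hT₀).1]
  have hT₀1 : 1 ≤ T₀ := by
    have : (1 : ℝ) ≤ T₀ := by linarith
    exact_mod_cast this
  have hlog := log_gridSize_le (n := n) hm hd hn hT hγ0 hγ (by linarith)
  have hrad := radius_le (d := d) (n := n) hd hn (by omega : 1 ≤ t) ht hγ0 hγ
  set l := 1 + Real.log (n * T / γ) with hl
  have hl1 : 1 ≤ l := one_le_one_add_log hn hT hγ0 hγ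
  have hl0 : 0 ≤ l := by linarith
  set c := deviationConst E.σ KX Kμ KS with hc
  have hc0 : 0 ≤ c := deviationConst_nonneg _ _ _ hKS
  set Lg := Real.log (2 * gridSize m d n T + 1)
  have hg := gaussianAbs_nonneg E.σ
  have hτ : E.tau = (E.σ : ℝ) ^ 2 + 1 := rfl
  set H := 2 * (KX ^ 2 + 1) * gaussianAbs E.σ + 2 * E.tau * (KX ^ 2 + 1) ^ 2 with hH
  set H' := KS + 2 * (KX ^ 2 + 1) ^ 2 with hH'
  have hτ1 := E.one_le_tau
  have hH0 : 0 ≤ H := by positivity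
  have hH'0 : 0 ≤ H' := by positivity
  have hcH : c = 19 + H + H' + Kμ ^ 2 := rfl
  have hμ0 := sq_nonneg Kμ
  -- The 19 in `deviationConst` arises here: 1 from the constant and 2 · 9 from f ≤ 2k and the bound
  -- 9 l for the grid logarithm.
  have key : ∀ k f A : ℝ, 1 ≤ k → f ≤ 2 * k → 0 ≤ f → 0 ≤ A →
      1 + f * Lg + A ≤ (19 + A) * k * l := by
    intro k f A hk hf hf0 hA
    have hkl : 1 ≤ k * l := one_le_mul_of_one_le_of_one_le hk hl1
    have h1 : f * Lg ≤ 2 * k * (9 * l) :=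
      (mul_le_mul_of_nonneg_left hlog hf0).trans (mul_le_mul_of_nonneg_right hf (by positivity))
    have h2 := le_mul_of_one_le_right (by linarith : 0 ≤ 1 + A) hkl
    linarith
  have kD : (1 : ℝ) ≤ m + d := by linarith
  have mono : ∀ k A : ℝ, 1 ≤ k → 19 + A ≤ c → (19 + A) * k * l ≤ c * k * l := by
    intro k A hk hA
    gcongr
  have hg₂ : ((19 + H) * d * l + d * Kμ ^ 2) ≤ c * d * l := by
    have h1 : d * Kμ ^ 2 ≤ d * Kμ ^ 2 * l := le_mul_of_one_le_right (by positivity) hl1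
    have h2 : 0 ≤ H' * d * l := by positivity
    rw [hcH]
    linarith
  have main := integral_gap_exploit_le hS hE hrun hπ ht i hKS hm hn hT hT₀1 htT₀ hε0 rfl rfl
    ((key (m + d) (d + (m + d)) H kD (by linarith) (by positivity) hH0).trans
      (mono _ H kD (by linarith)))
    (key d (1 + d) H hd' (by linarith) (by positivity) hH0)
    ((key (m + d) (m + d) H' kD (by linarith) (by positivity) hH'0).trans
      (mono _ H' kD (by linarith)))
    ((key d d H' hd' (by linarith) (by positivity) hH'0).trans (mono _ H' hd' (by linarith)))
  obtain ⟨b1, b4⟩ := div_gram_le hm hd hn hκ hKS hρ hT₀ρ hε2 hl0 hc0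
    (le_refl (c * (m + d) * l)) (le_refl (c * d * l))
  have b2 := (div_gram_le (g₁ := 0) hm hd hn hκ hKS hρ hT₀ρ hε2 hl0 hc0 (by positivity) hg₂).2
  -- The squared confidence radius is 256 d l², one logarithm more than the deviations; the square
  -- root brings it back to ε l, with constant √(16 · 256 / KS).
  have b5 := (div_gram_le (g₁ := 0) (c := 256 * l) hm hd hn hκ hKS hρ hT₀ρ hε2 hl0 (by positivity)
    (by positivity) (hrad.trans (le_of_eq (by ring)))).2
  have hκ0 : 0 ≤ κ := nonneg_of_le_mul_natCast hn hκ
  set N₁ := KS / (m + d) * (n * T₀) / 4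
  set N₂ := KS / (m + d) * T₀ / 4
  set a₁ := 32 * κ * c / KS with ha₁
  set a₂ := 16 * c / KS with ha₂
  have ha₁0 : 0 ≤ a₁ := by positivity
  have ha₂0 : 0 ≤ a₂ := by positivity
  have hsq : √(radius d n γ t / N₂) ≤ √(4096 / KS) * (ε * l) := by
    refine (Real.sqrt_le_sqrt b5).trans (le_of_eq ?_)
    have e : 16 * (256 * l) / KS * (ε ^ 2 * l) = 4096 / KS * (ε * l) ^ 2 := by ring
    rw [e, Real.sqrt_mul (by positivity), Real.sqrt_sq (by positivity)]
  have hlin : ∀ X a : ℝ, 0 ≤ a → X ≤ a * (ε ^ 2 * l) →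
      ε + (2 * E.tau / ε + 2) * X ≤ (1 + (2 * E.tau + 2) * a) * (ε * l) := by
    intro X a ha hX
    have h1 : (2 * E.tau / ε + 2) * X ≤ (2 * E.tau / ε + 2) * (a * (ε ^ 2 * l)) :=
      mul_le_mul_of_nonneg_left hX (by positivity)
    have h2 : (2 * E.tau / ε + 2) * (a * (ε ^ 2 * l)) = (2 * E.tau + 2 * ε) * a * (ε * l) := by
      field_simp
    have h3 : (2 * E.tau + 2 * ε) * a * (ε * l) ≤ (2 * E.tau + 2) * a * (ε * l) := by
      have : 2 * ε ≤ 2 := by linarith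
      gcongr
    have h4 : ε ≤ ε * l := le_mul_of_one_le_right hε0.le hl1
    linarith
  have hquad : ∀ X a : ℝ, 0 ≤ a → X ≤ a * (ε ^ 2 * l) → X ≤ a * (ε * l) := by
    intro X a ha hX
    exact hX.trans (mul_le_mul_of_nonneg_left (mul_le_mul_of_nonneg_right
      (pow_le_of_le_one hε0.le hε1 two_ne_zero) hl0) ha)
  have t1 := hlin _ _ ha₁0 b1
  have t2 := hlin (2 * ((19 + H) * d * l + d * Kμ ^ 2) / N₂) (2 * a₂) (by positivity) (by
    rw [mul_div_assoc]
    linarith)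
  have t3 := hquad _ _ ha₁0 b1
  have t4 := hquad _ _ ha₂0 b4
  refine main.trans ?_
  have s1 := mul_le_mul_of_nonneg_right t1 (Real.sqrt_nonneg (KX ^ 2 + 1))
  have s3 := mul_le_mul_of_nonneg_left (mul_le_mul_of_nonneg_left (add_le_add t3 t4)
    (by positivity : 0 ≤ KX ^ 2 + 1)) (by positivity : 0 ≤ 2 * (|KC| + |Kμ|))
  have e : exploitConst E.σ KX KC Kμ KS κ = 2 * (1 + (2 * E.tau + 2) * a₁) * √(KX ^ 2 + 1) +
    2 * (√(4096 / KS) + (1 + (2 * E.tau + 2) * (2 * a₂))) +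
    2 * (|KC| + |Kμ|) * ((KX ^ 2 + 1) * (a₁ + a₂)) := rfl
  rw [e]
  linarith

lemma integrable_excessCost (hS : S.IsSample P E) (hE : E.IsRegular KX KC Kμ KS)
    (hrun : IsRun E S w b γ T₀ T) (hπ : E.IsOptimalPolicy π) :
    Integrable (excessCost E S w π T) P :=
  integrable_finsetSum _ fun _ ht => integrable_finsetSum _ fun i _ =>
    integrable_cost_sub hS hE hrun hπ (Finset.mem_Icc.1 ht).2 i

lemma regret_eq (hS : S.IsSample P E) (hE : E.IsRegular KX KC Kμ KS)
    (hrun : IsRun E S w b γ T₀ T) (hπ : E.IsOptimalPolicy π) :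
    regret E S w P π T = ∑ t ∈ Finset.Icc 1 T, ∑ i,
      ∫ ω, E.gap (S.x t i ω) (w t i ω) (π (S.x t i ω)) ∂P := by
  unfold regret excessCost
  have hi : ∀ t ∈ Finset.Icc 1 T, ∀ i ∈ Finset.univ, Integrable (fun ω =>
      E.cost (S.x t i ω) (S.e t i ω) (S.η t i ω) (w t i ω) -
        E.cost (S.x t i ω) (S.e t i ω) (S.η t i ω) (π (S.x t i ω))) P := fun t ht i _ =>
    integrable_cost_sub hS hE hrun hπ (Finset.mem_Icc.1 ht).2 i
  rw [integral_finsetSum _ fun t ht => integrable_finsetSum _ (hi t ht)]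
  refine Finset.sum_congr rfl fun t ht => ?_
  rw [integral_finsetSum _ (hi t ht)]
  exact Finset.sum_congr rfl fun i _ =>
    integral_cost_sub hS hE hrun hπ (Finset.mem_Icc.1 ht).2 i

/-- Exploration costs about ρ per individual, and at most T exploitation rounds cost O(ε l) each,
with T ε = ρ. -/
lemma regret_le (hS : S.IsSample P E) (hE : E.IsRegular KX KC Kμ KS)
    (hrun : IsRun E S w b γ T₀ T) (hπ : E.IsOptimalPolicy π)
    (hKS : 0 < KS) (hm : 1 ≤ m) (hd : 1 ≤ d) (hn : 1 ≤ n) (hT : 1 ≤ T) (hκ : (m : ℝ) ≤ κ * n)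
    (hγ0 : 0 < γ) (hγ : γ ≤ 1) (hT₀ : |(T₀ : ℝ) - rate m d T| < 1) :
    regret E S w P π T ≤ (8 * (2 * (|KC| + |Kμ|)) + exploitConst E.σ KX KC Kμ KS κ) *
      (1 + Real.log (n * T / γ)) * (n * rate m d T) := by
  have hd' : (1 : ℝ) ≤ d := by exact_mod_cast hd
  have hm' : (1 : ℝ) ≤ m := by exact_mod_cast hm
  have hn' : (1 : ℝ) ≤ n := by exact_mod_cast hn
  have hT' : (1 : ℝ) ≤ T := by exact_mod_cast hT
  have hκ0 : 0 ≤ κ := nonneg_of_le_mul_natCast hn hκ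
  have hρ := rate_pos hm hd hT
  have hC0 := exploitConst_nonneg E.σ KX KC Kμ hKS hκ0
  set Ce := exploitConst E.σ KX KC Kμ KS κ
  set Kg := 2 * (|KC| + |Kμ|) with hKg
  have hKg0 : 0 ≤ Kg := by positivity
  set l := 1 + Real.log (n * T / γ) with hl
  have hl1 : 1 ≤ l := one_le_one_add_log hn hT hγ0 hγ
  rw [regret_eq hS hE hrun hπ]
  -- For a short horizon every round is charged the trivial bound. Otherwise 64 m d² ≤ ρ, so ρ ≥ 64
  -- and rounding T₀ is harmless.
  rcases le_or_gt (T : ℝ) (8 * rate m d T) with hsmall | hbig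
  · have h1 : ∑ t ∈ Finset.Icc 1 T, ∑ i,
        ∫ ω, E.gap (S.x t i ω) (w t i ω) (π (S.x t i ω)) ∂P ≤ ∑ t ∈ Finset.Icc 1 T, ∑ i : Fin n, Kg :=
      Finset.sum_le_sum fun t ht => Finset.sum_le_sum fun i _ =>
        integral_gap_le hS hE hrun hπ (Finset.mem_Icc.1 ht).2 i
    refine h1.trans ?_
    simp only [Finset.sum_const, Finset.card_univ, Fintype.card_fin, Nat.card_Icc, nsmul_eq_mul,
      add_tsub_cancel_right]
    have h2 : (T : ℝ) * (n * Kg) ≤ 8 * rate m d T * (n * Kg) :=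
      mul_le_mul_of_nonneg_right hsmall (by positivity)
    have h3 : 8 * rate m d T * (n * Kg) ≤ 8 * rate m d T * (n * Kg) * l :=
      le_mul_of_one_le_right (by positivity) hl1
    have h4 : 0 ≤ Ce * l * (n * rate m d T) := by positivity
    linarith
  · set ρ := rate m d T
    have hρ64 := mul_sq_le_rate hm hd hT hbig
    have hmd : (1 : ℝ) ≤ m * (d : ℝ) ^ 2 := one_le_mul_of_one_le_of_one_le hm' (one_le_pow₀ hd')
    have hT₀ρ : (T₀ : ℝ) ≤ 2 * ρ := by linarith [(abs_lt.1 hT₀).2]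
    have hT₀T : T₀ ≤ T := by
      have : (T₀ : ℝ) ≤ T := by linarith
      exact_mod_cast this
    have h1 : ∑ t ∈ Finset.Icc 1 T, ∑ i,
        ∫ ω, E.gap (S.x t i ω) (w t i ω) (π (S.x t i ω)) ∂P ≤
        ∑ t ∈ Finset.Icc 1 T, ∑ i : Fin n, ((if t ≤ T₀ then Kg else 0) + Ce * (ρ / T * l)) := by
      refine Finset.sum_le_sum fun t ht => Finset.sum_le_sum fun i _ => ?_
      have ht2 := (Finset.mem_Icc.1 ht).2
      have h0 : 0 ≤ Ce * (ρ / T * l) := by positivity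
      split_ifs with h
      · have := integral_gap_le hS hE hrun hπ ht2 i
        linarith
      · rw [zero_add]
        exact integral_gap_exploit_le_rate hS hE hrun hπ ht2 i hKS hm hd hn hT hκ hγ0 hγ hbig hT₀
          (not_le.1 h)
    refine h1.trans ?_
    have h2 : ∑ t ∈ Finset.Icc 1 T, (if t ≤ T₀ then Kg else 0) = T₀ * Kg := by
      rw [← Finset.sum_filter]
      have : (Finset.Icc 1 T).filter (fun t => t ≤ T₀) = Finset.Icc 1 T₀ := by
        ext t
        simp only [Finset.mem_filter, Finset.mem_Icc]
        omega
      rw [this]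
      simp
    have h3 : ∑ t ∈ Finset.Icc 1 T, ∑ i : Fin n, ((if t ≤ T₀ then Kg else 0) + Ce * (ρ / T * l)) =
        n * (T₀ * Kg) + n * (Ce * (ρ * l)) := by
      simp only [Finset.sum_const, Finset.card_univ, Fintype.card_fin, nsmul_eq_mul]
      rw [← Finset.mul_sum, Finset.sum_add_distrib, h2, Finset.sum_const, Nat.card_Icc,
        nsmul_eq_mul, add_tsub_cancel_right]
      field_simp
    rw [h3]
    have h4 : n * (T₀ * Kg) ≤ n * (2 * ρ * Kg) := by gcongr
    have h5 : n * (2 * ρ * Kg) ≤ n * (2 * ρ * Kg) * l := le_mul_of_one_le_right (by positivity) hl1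
    have h6 : 0 ≤ n * (6 * ρ * Kg) * l := by positivity
    linarith

end

end PROOFBandit

end

/-! ### The main theorem -/

theorem mainTheorem8 :
    ∃ p : ℕ, ∀ (σ : ℝ≥0) (KX KC Kμ KS κ : ℝ), 0 < KS →
      ∃ C : ℝ, ∀ (m d n T T₀ : ℕ), 1 ≤ m → 1 ≤ d → 1 ≤ n → 1 ≤ T → (m : ℝ) ≤ κ * n →
        |(T₀ : ℝ) - (m : ℝ) ^ (1 / 3 : ℝ) * (d : ℝ) ^ (2 / 3 : ℝ) * (T : ℝ) ^ (2 / 3 : ℝ)| < 1 →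
        ∀ (γ : ℝ), 0 < γ → γ ≤ 1 →
        ∀ (E : PROOFBandit.Env m d), E.σ = σ → E.IsRegular KX KC Kμ KS →
        ∀ (π : (Fin m → ℝ) → (Fin d → ℝ)), E.IsOptimalPolicy π →
        ∀ (Ω : Type*) [MeasurableSpace Ω] (P : Measure Ω) [IsProbabilityMeasure P]
          (S : PROOFBandit.Primitives m d n Ω), S.IsSample P E →
        ∀ (b : Fin d → Fin d → ℝ) (w : ℕ → Fin n → Ω → (Fin d → ℝ)),
          PROOFBandit.IsRun E S w b γ T₀ T →
          Integrable (PROOFBandit.excessCost E S w π T) P ∧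
          PROOFBandit.regret E S w P π T ≤
            C * (1 + Real.log (n * T / γ)) ^ p *
              ((m : ℝ) ^ (1 / 3 : ℝ) * (d : ℝ) ^ (2 / 3 : ℝ) * n * (T : ℝ) ^ (2 / 3 : ℝ)) := by
  -- A single logarithm suffices: the grid entropy is linear in l, and the squared confidence
  -- radius, quadratic in l, enters through its root.
  refine ⟨1, fun σ KX KC Kμ KS κ hKS => ⟨8 * (2 * (|KC| + |Kμ|)) +
    PROOFBandit.exploitConst σ KX KC Kμ KS κ, ?_⟩⟩
  rintro m d n T T₀ hm hd hn hT hκ hT₀ γ hγ0 hγ E rfl hE π hπ Ω _ P _ S hS b w hrun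
  refine ⟨PROOFBandit.integrable_excessCost hS hE hrun hπ, ?_⟩
  refine (PROOFBandit.regret_le hS hE hrun hπ hKS hm hd hn hT hκ hγ0 hγ hT₀).trans (le_of_eq ?_)
  rw [pow_one, PROOFBandit.rate]
  ring
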